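/- Let $m\ge 1$ be an integer, $n=2m+2$, $p_j=e^{2\pi i j/n}$ for $0\le j\le n-1$, and let $\rho>1$. Let $\mathcal W^{\ge0}_{\mathbb R}$ be the Banach space of power series $f(\lambda)=\sum_{k\ge0}f_k\lambda^k$ with real coefficients and $\|f\|_\rho=\sum_k|f_k|\rho^k<\infty$, and write $f^0=f_0$. For a parameter ${\bf x}=(r,a,b,c)\in\mathbb R\times(\mathcal W^{\ge0}_{\mathbb R})^3$ and $t\in\mathbb R$ consider on $\mathbb C\setminus\{p_0,\dots,p_{n-1}\}$ the potential $$\eta_t^{\bf x}=\begin{pmatrix}0&0\\ mrz^{m-1}&0\end{pmatrix}dz+t\sum_{j=0}^{n-1}A_j(\lambda)\frac{dz}{z-p_j},$$ $$A_0(\lambda)=\begin{pmatrix}a(\lambda)&\lambda^{-1}b(\lambda)\\ \lambda c(\lambda)&-a(\lambda)\end{pmatrix},\qquad A_{j+1}(\lambda)=D^{-1}A_j(-\lambda)D,\qquad D=\begin{pmatrix}e^{i\pi m/n}&0\\0&e^{-i\pi m/n}\end{pmatrix}.$$ Let $\gamma_0$ be the loop $\gamma_0(s)=2\sin(\pi s)\,e^{i\pi(2s-1)/n}$,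 $s\in[0,1]$, which is based at $0$ and encloses only $p_0=1$, once and counterclockwise, and let $\gamma_j=p_j\gamma_0$; the $\gamma_j$ generate $\pi_1(\mathbb C\setminus\{p_0,\dots,p_{n-1}\},0)$. Let $M_j=M_j(t,{\bf x})(\lambda)$ be the monodromy along $\gamma_j$ of the solution of $d\Phi=\Phi\,\eta_t^{\bf x}$, $\Phi(0)=\mathrm{Id}$, i.e. the value at the end point of $\gamma_j$ of the continuation of $\Phi$ along $\gamma_j$. For $t\neq0$ put $\widetilde M=\frac1t\log M_0$, where $\log(1+N)=\sum_{k\ge1}\frac{(-1)^{k+1}}{k}N^k$, and let $f^*(\lambda)=\overline{f(1/\overline\lambda)}$. Consider the system $$(\ast)\quad\left\{\begin{array}{l} \mathcal F:=\frac1{2\pi i}\bigl(\widetilde M_{11}+\widetilde M_{11}^*\bigr)=0 \text{ on } |\lambda|=1,\\[2pt] \mathcal G:=\frac1{2\pi i}\bigl(\widetilde M_{21}+\widetilde M_{12}^*\bigr)=0\text{ on } |\lambda|=1,\\[2pt] \mathcal H_1:=\frac1{2\pi i}\widetilde M_{12}(\lambda=1)=0,\\[2pt] \mathcal H_2:=\frac1{2\pi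 i}\widetilde M_{12}(\lambda=-1)=0,\\[2pt] \mathcal K:=(a^0)^2+b^0c^0=1.\end{array}\right.$$ Let ${\bf x}_0=(1,\lambda,\frac{\lambda^2-1}2,-2)$, and for $\delta>0$ let $U_\delta$ be the set of ${\bf x}=(r,a,b,c)$ with $|r-1|<\delta$, $\|a-\lambda\|_\rho<\delta$, $\|b-\frac{\lambda^2-1}{2}\|_\rho<\delta$, $\|c+2\|_\rho<\delta$. Then there is $\delta_0>0$ such that for every $\delta\in(0,\delta_0]$ there is $\varepsilon>0$ such that for all $t\in(0,\varepsilon)$: (1) there is exactly one ${\bf x}(t)\in U_\delta$ that solves $(\ast)$; (2) for ${\bf x}\in U_\delta$, the system $(\ast)$ holds if and only if $\eta_t^{\bf x}$ solves the monodromy problem in the following sense: for all $0\le j\le n-1$, $M_j(\lambda)\in SU(2)$ for all $|\lambda|=1$ and $M_j(1)$, $M_j(-1)$ are diagonal, and the constant Fourier coefficient of $\det A_0$ is $-1$. In particular $\eta_t^{{\bf x}(t)}$ solves the monodromy problem, and ${\bf x}(t)\to{\bf x}_0$ as $t\to0$. -/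

import Mathlib

noncomputable section

namespace DPW

open Complex

/-- The space of loops `f = ∑_{k ≥ 0} f_k μ^k` in the Wiener algebra of the annulus
`1/ρ < |μ| < ρ` that have no negative Fourier modes and satisfy `conj (f (conj μ)) = f μ`,
i.e. whose coefficients are real.  A loop is recorded by its Fourier coefficients `f_k`, `k ≥ 0`;
the condition is `∑ |f_k| ρ^k < ∞`. -/
def WienerPos (ρ : ℝ) : Submodule ℝ (ℕ → ℝ) where
  carrier := {f | Summable fun k => |f k| * |ρ| ^ k}
  zero_mem' := by simp
  add_mem' := by
    intro f g hf hg
    refine Summable.of_nonneg_of_le (fun k => by positivity) (fun k => ?_) (hf.add hg)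
    rw [← add_mul]
    exact mul_le_mul_of_nonneg_right (abs_add_le _ _) (by positivity)
  smul_mem' := by
    intro c f hf
    simpa [abs_mul, mul_assoc] using hf.mul_left |c|

/-- The norm `‖f‖_ρ = ∑ |f_k| ρ^k`. -/
def wienerNorm {ρ : ℝ} (f : WienerPos ρ) : ℝ := ∑' k, |f.1 k| * |ρ| ^ k

/-- The value `f(μ) = ∑ f_k μ^k` of a loop. -/
def ev {ρ : ℝ} (f : WienerPos ρ) (μ : ℂ) : ℂ := ∑' k, (f.1 k : ℂ) * μ ^ k

theorem mem_wienerPos_of_finite (ρ : ℝ) (f : ℕ → ℝ) (N : ℕ) (h : ∀ k, N ≤ k → f k = 0) :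
    f ∈ WienerPos ρ := by
  refine summable_of_ne_finset_zero (s := Finset.range N) (fun k hk => ?_)
  simp [h k (by simpa using hk)]

/-- The parameter vector `x = (r, a, b, c)`. -/
structure Param (ρ : ℝ) where
  r : ℝ
  a : WienerPos ρ
  b : WienerPos ρ
  c : WienerPos ρ

/-- The central value `r = 1`, `a = μ`, `b = (μ² - 1)/2`, `c = -2`. -/
def x₀ (ρ : ℝ) : Param ρ where
  r := 1
  a := ⟨fun k => if k = 1 then 1 else 0,
    mem_wienerPos_of_finite ρ _ 2 fun k hk => if_neg (by omega)⟩
  b := ⟨fun k => if k = 0 then -1 / 2 else if k = 2 then 1 / 2 else 0,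
    mem_wienerPos_of_finite ρ _ 3 fun k hk => by
      rw [if_neg (by omega), if_neg (by omega)]⟩
  c := ⟨fun k => if k = 0 then -2 else 0,
    mem_wienerPos_of_finite ρ _ 1 fun k hk => if_neg (by omega)⟩

/-- The open ball of radius `δ` around `x₀` in `ℝ × (W^{≥ 0}_ℝ)³`. -/
def nbhd (ρ δ : ℝ) : Set (Param ρ) :=
  {x | |x.r - (x₀ ρ).r| < δ ∧ wienerNorm (x.a - (x₀ ρ).a) < δ ∧
    wienerNorm (x.b - (x₀ ρ).b) < δ ∧ wienerNorm (x.c - (x₀ ρ).c) < δ}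

/-- The number `n = 2m + 2` of finite punctures. -/
def nn (m : ℕ) : ℕ := 2 * m + 2

/-- The punctures `p_j = exp (2πij/n)`. -/
def p (m j : ℕ) : ℂ := exp (2 * Real.pi * I * j / nn m)

/-- `D = diag (exp (iπm/n), exp (-iπm/n))`. -/
def D (m : ℕ) : Matrix (Fin 2) (Fin 2) ℂ :=
  !![exp (I * Real.pi * m / nn m), 0; 0, exp (-(I * Real.pi * m / nn m))]

/-- The residue matrices: `A_0 = (a, μ⁻¹ b; μ c, -a)` and `A_{j+1}(μ) = D⁻¹ A_j(-μ) D`. -/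
def A (m : ℕ) {ρ : ℝ} (x : Param ρ) : ℕ → ℂ → Matrix (Fin 2) (Fin 2) ℂ
  | 0 => fun μ => !![ev x.a μ, μ⁻¹ * ev x.b μ; μ * ev x.c μ, -ev x.a μ]
  | j + 1 => fun μ => (D m)⁻¹ * A m x j (-μ) * D m

/-- The potential `η_t^x(z, μ)`, i.e. the coefficient of `dz`. -/
def η (m : ℕ) {ρ : ℝ} (t : ℝ) (x : Param ρ) (z μ : ℂ) : Matrix (Fin 2) (Fin 2) ℂ :=
  !![0, 0; m * x.r * z ^ (m - 1), 0] +
    (t : ℂ) • ∑ j ∈ Finset.range (nn m), (z - p m j)⁻¹ • A m x j μ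

/-- The loop `γ_j : [0,1] → ℂ \ {p_0, …, p_{n-1}}` based at `0`.  It runs in the closed sector of
half-angle `π/n` around the ray through `p_j`, meets this ray only in `0` and `2 p_j`, and so
encloses, once and counterclockwise, the puncture `p_j` and no other.
These loops generate the fundamental group of the punctured plane with base point `0`; moreover
`γ_{j+1} = exp (2πi/n) γ_j`, and complex conjugation reverses `γ_0`. -/
def γ (m j : ℕ) (s : ℝ) : ℂ :=
  p m j * (2 * Real.sin (Real.pi * s)) * exp (I * Real.pi * (2 * s - 1) / nn m)

/-- `X` is the solution of `dΦ = Φ η`, `Φ = Id` at the base point `0`, continued along `γ_j`. -/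
def IsTransport (m : ℕ) {ρ : ℝ} (t : ℝ) (x : Param ρ) (j : ℕ) (μ : ℂ)
    (X : ℝ → Matrix (Fin 2) (Fin 2) ℂ) : Prop :=
  X 0 = 1 ∧ ∀ s ∈ Set.Icc (0 : ℝ) 1, ∀ i k : Fin 2,
    HasDerivWithinAt (fun u => X u i k)
      ((X s * (deriv (γ m j) s • η m t x (γ m j s) μ)) i k) (Set.Icc 0 1) s

open Classical in
/-- The monodromy `M_j(t)(μ)` along `γ_j` of the solution `Φ_t` of `dΦ = Φ η_t`, `Φ(0) = Id`: the
end value of the continuation along `γ_j`.  (The continuation exists and is unique on `[0,1]`, the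
equation being linear with continuous coefficients.) -/
def Mon (m : ℕ) {ρ : ℝ} (t : ℝ) (x : Param ρ) (j : ℕ) (μ : ℂ) : Matrix (Fin 2) (Fin 2) ℂ :=
  if h : ∃ X, IsTransport m t x j μ X then h.choose 1 else 0

/-- The logarithm of a matrix near the identity,
`log (1 + N) = N - N²/2 + N³/3 - …`. -/
def matLog (M : Matrix (Fin 2) (Fin 2) ℂ) : Matrix (Fin 2) (Fin 2) ℂ :=
  ∑' k : ℕ, ((-1) ^ k / (k + 1) : ℂ) • (M - 1) ^ (k + 1)

/-- `M̃(t) = (1/t) log M_0(t)`. -/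
def Mt (m : ℕ) {ρ : ℝ} (t : ℝ) (x : Param ρ) (μ : ℂ) : Matrix (Fin 2) (Fin 2) ℂ :=
  (1 / t : ℂ) • matLog (Mon m t x 0 μ)

/-- The involution `f*(μ) = conj (f (1 / conj μ))`. -/
def loopStar (f : ℂ → ℂ) (μ : ℂ) : ℂ :=
  (starRingEnd ℂ) (f (1 / (starRingEnd ℂ) μ))

def F (m : ℕ) {ρ : ℝ} (t : ℝ) (x : Param ρ) (μ : ℂ) : ℂ :=
  1 / (2 * Real.pi * I) * (Mt m t x μ 0 0 + loopStar (fun ν => Mt m t x ν 0 0) μ)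

def G (m : ℕ) {ρ : ℝ} (t : ℝ) (x : Param ρ) (μ : ℂ) : ℂ :=
  1 / (2 * Real.pi * I) * (Mt m t x μ 1 0 + loopStar (fun ν => Mt m t x ν 0 1) μ)

def H₁ (m : ℕ) {ρ : ℝ} (t : ℝ) (x : Param ρ) : ℂ :=
  1 / (2 * Real.pi * I) * Mt m t x 1 0 1

def H₂ (m : ℕ) {ρ : ℝ} (t : ℝ) (x : Param ρ) : ℂ :=
  1 / (2 * Real.pi * I) * Mt m t x (-1) 0 1

/-- `K(x) = (a⁰)² + b⁰ c⁰`, the constant Fourier coefficient of `-det A_0`. -/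
def K {ρ : ℝ} (x : Param ρ) : ℝ := x.a.1 0 ^ 2 + x.b.1 0 * x.c.1 0

/-- The system `F = 0`, `G = 0` (as loops on the unit circle), `H₁ = 0`, `H₂ = 0`, `K = 1`. -/
def IFTSystem (m : ℕ) {ρ : ℝ} (t : ℝ) (x : Param ρ) : Prop :=
  (∀ μ : ℂ, ‖μ‖ = 1 → F m t x μ = 0) ∧ (∀ μ : ℂ, ‖μ‖ = 1 → G m t x μ = 0) ∧
    H₁ m t x = 0 ∧ H₂ m t x = 0 ∧ K x = 1

/-- The potential `η_t^x` solves the monodromy problem: along every generator `γ_j` of the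
fundamental group the monodromy is in `SU(2)` for `μ` on the unit circle and diagonal for
`μ = ±1`; and `det A_0` is normalised to have constant Fourier coefficient `-1`. -/
def SolvesMonodromyProblem (m : ℕ) {ρ : ℝ} (t : ℝ) (x : Param ρ) : Prop :=
  (∀ j < nn m, ∀ μ : ℂ, ‖μ‖ = 1 → Mon m t x j μ ∈ Matrix.specialUnitaryGroup (Fin 2) ℂ) ∧
    (∀ j < nn m, (Mon m t x j 1).IsDiag ∧ (Mon m t x j (-1)).IsDiag) ∧
    Real.circleAverage (fun μ => (A m x 0 μ).det) 0 1 = -1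

end DPW

end

/-!
The shear `Φ₀ = (1, 0; r z^m, 1)` solves the equation at `t = 0` and is `Id` at both ends of `γ_0`.
Hence `M_0` is the end value of the solution of `dX = t X Φ₀ (∑ A_j dz / (z - p_j)) Φ₀⁻¹`, an
equation whose coefficient is of order `t`.  It is solved in the Banach algebra of `2 × 2` matrices
over the Wiener algebra, so that evaluation at a point `|λ| = 1` commutes with everything.  By the
residue theorem `M̃ / (2πi)` tends, for `t → 0`, to the conjugate of `A_0` by the shear at `z = 1`,
and the difference has a Lipschitz constant in `x` that tends to `0` with `t`.

The symmetry under `(z, λ) ↦ (conj z, conj λ)` makes the Laurent coefficients of `M̃ / (2πi)` real.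
So the system `(∗)` consists of real linear equations on the coefficients of `M̃ / (2πi)`, and one
on `𝒦 - 1`.  The linearisation at `x₀` of its limit for `t → 0` has an explicit bounded inverse `L`.
As `L` vanishes exactly on the solutions of the linear equations, `(∗)` says that `L` of the pair
`(M̃ / (2πi), 𝒦 - 1)` is zero.  This is a map from the parameter space to itself which differs from
the identity by a contraction near `x₀`, so it has exactly one zero there.

For the monodromy problem, `M_0` has determinant `1` and is close to `1`, so it is unitary if and
only if its logarithm is skew-Hermitian, and diagonal if and only if its logarithm is.  The rotation
symmetry `M_{j+1}(λ) = D⁻¹ M_j(-λ) D` transfers the conditions to the other loops.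
-/

noncomputable section

namespace DPW

open Complex Set
open scoped ComplexConjugate

/-! ### Weighted `ℓ¹` spaces and their convolution algebras -/

/-- The weighted `ℓ¹` space of families `f : ι → 𝕜` with `∑ ‖f i‖ w i < ∞`.  It is encoded by the
unweighted `ℓ¹` family `i ↦ f i * w i`; the values `f i` are read off with `WeightedL1.coef`. -/
def WeightedL1 (𝕜 : Type*) [NormedAddCommGroup 𝕜] {ι : Type*} (_w : ι → ℝ) : Type _ :=
  lp (fun _ : ι => 𝕜) 1

/-- A positive weight, so that a weighted `ℓ¹` family is determined by its coefficients. -/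
class IsPositiveWeight {ι : Type*} (w : ι → ℝ) : Prop where
  pos : ∀ i, 0 < w i

/-- A positive submultiplicative weight, which makes the weighted `ℓ¹` space a Banach algebra for
convolution (the Beurling algebra of the weight). -/
class IsBeurlingWeight {ι : Type*} [Add ι] (w : ι → ℝ) : Prop extends IsPositiveWeight w where
  add_le : ∀ i j, w (i + j) ≤ w i * w j

namespace WeightedL1

section Module

variable {𝕜 ι : Type*} [RCLike 𝕜] {w : ι → ℝ}

instance : NormedAddCommGroup (WeightedL1 𝕜 w) :=
  inferInstanceAs (NormedAddCommGroup (lp (fun _ : ι => 𝕜) 1))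

instance : NormedSpace 𝕜 (WeightedL1 𝕜 w) :=
  inferInstanceAs (NormedSpace 𝕜 (lp (fun _ : ι => 𝕜) 1))

instance : CompleteSpace (WeightedL1 𝕜 w) :=
  inferInstanceAs (CompleteSpace (lp (fun _ : ι => 𝕜) 1))

/-- The coefficient `f i` of a weighted `ℓ¹` family. -/
def coef (i : ι) : WeightedL1 𝕜 w →L[𝕜] 𝕜 :=
  (w i : 𝕜)⁻¹ • (lp.evalCLM 𝕜 (fun _ : ι => 𝕜) 1 i : lp (fun _ : ι => 𝕜) 1 →L[𝕜] 𝕜)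

variable [hw : IsPositiveWeight w]

variable (𝕜 w) in
theorem weight_ne_zero (i : ι) : (w i : 𝕜) ≠ 0 := RCLike.ofReal_ne_zero.2 (hw.pos i).ne'

theorem norm_weight (i : ι) : ‖(w i : 𝕜)‖ = w i := by
  rw [RCLike.norm_ofReal, abs_of_pos (hw.pos i)]

theorem coef_mul_weight (i : ι) (f : WeightedL1 𝕜 w) :
    coef i f * w i = (show lp (fun _ : ι => 𝕜) 1 from f) i :=
  (mul_right_comm _ _ _).trans
    ((congrArg (· * _) (inv_mul_cancel₀ (weight_ne_zero 𝕜 w i))).trans (one_mul _))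

theorem norm_coef_mul_weight (i : ι) (f : WeightedL1 𝕜 w) :
    ‖coef i f‖ * w i = ‖(show lp (fun _ : ι => 𝕜) 1 from f) i‖ := by
  rw [← coef_mul_weight, norm_mul, norm_weight]

theorem summable_norm_coef_mul_weight (f : WeightedL1 𝕜 w) :
    Summable fun i => ‖coef i f‖ * w i := by
  simpa [norm_coef_mul_weight] using (lp.memℓp (show lp (fun _ : ι => 𝕜) 1 from f)).summable

theorem norm_eq_tsum (f : WeightedL1 𝕜 w) : ‖f‖ = ∑' i, ‖coef i f‖ * w i := by
  simp only [norm_coef_mul_weight]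
  exact (lp.norm_eq_tsum_rpow (by simp) (show lp (fun _ : ι => 𝕜) 1 from f)).trans (by simp)

@[ext]
theorem ext {f g : WeightedL1 𝕜 w} (h : ∀ i, coef i f = coef i g) : f = g :=
  lp.ext (E := fun _ : ι => 𝕜) <| funext fun i => by
    rw [← coef_mul_weight i f, ← coef_mul_weight i g, h i]

/-- The weighted `ℓ¹` family with given coefficients. -/
def ofCoef (c : ι → 𝕜) (hc : Summable fun i => ‖c i‖ * w i) : WeightedL1 𝕜 w :=
  (⟨fun i => c i * w i, memℓp_gen (by simpa [abs_of_pos (hw.pos _)] using hc)⟩ :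
    lp (fun _ : ι => 𝕜) 1)

@[simp]
theorem coef_ofCoef (c : ι → 𝕜) (hc : Summable fun i => ‖c i‖ * w i) (i : ι) :
    coef i (ofCoef c hc) = c i :=
  mul_right_cancel₀ (weight_ne_zero 𝕜 w i) (coef_mul_weight i _)

section Mono

variable [DecidableEq ι]

variable (𝕜 w) in
/-- The family with the single coefficient `1`, at the index `i`; in a convolution algebra it is
the monomial with exponent `i`. -/
def mono (i : ι) : WeightedL1 𝕜 w :=
  (lp.single 1 i (w i : 𝕜) : lp (fun _ : ι => 𝕜) 1)

theorem coef_mono (i j : ι) : coef i (mono 𝕜 w j) = if i = j then 1 else 0 := by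
  refine mul_right_cancel₀ (weight_ne_zero 𝕜 w i) ((coef_mul_weight i _).trans ?_)
  rcases eq_or_ne i j with rfl | h
  · simp [mono]
  · simp [mono, h]

theorem norm_mono (i : ι) : ‖mono 𝕜 w i‖ = w i :=
  (lp.norm_single one_pos i _).trans (norm_weight i)

theorem hasSum_coef_smul_mono (f : WeightedL1 𝕜 w) :
    HasSum (fun i => coef i f • mono 𝕜 w i) f := by
  have h := lp.hasSum_single (E := fun _ : ι => 𝕜) ENNReal.one_ne_top f
  refine h.congr_fun fun i => ?_
  rw [← coef_mul_weight i f, ← smul_eq_mul, lp.single_smul]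
  rfl

theorem clm_ext {F : Type*} [AddCommMonoid F] [Module 𝕜 F] [TopologicalSpace F] [T2Space F]
    {f g : WeightedL1 𝕜 w →L[𝕜] F}
    (h : ∀ i, f (mono 𝕜 w i) = g (mono 𝕜 w i)) : f = g := by
  ext x
  refine (f.hasSum (hasSum_coef_smul_mono x)).unique ?_
  simpa [map_smul, h] using g.hasSum (hasSum_coef_smul_mono x)

end Mono

section Lift

variable {F : Type*} [NormedAddCommGroup F] [NormedSpace 𝕜 F]

omit hw in
theorem norm_coef_smul_le {v : ι → F} {C : ℝ} (hv : ∀ i, ‖v i‖ ≤ C * w i) (f : WeightedL1 𝕜 w)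
    (i : ι) : ‖coef i f • v i‖ ≤ C * (‖coef i f‖ * w i) := by
  rw [norm_smul, mul_left_comm]
  exact mul_le_mul_of_nonneg_left (hv i) (norm_nonneg _)

theorem summable_norm_coef_smul {v : ι → F} {C : ℝ} (hv : ∀ i, ‖v i‖ ≤ C * w i)
    (f : WeightedL1 𝕜 w) : Summable fun i => ‖coef i f • v i‖ :=
  .of_nonneg_of_le (fun _ => norm_nonneg _) (norm_coef_smul_le hv f)
    ((summable_norm_coef_mul_weight f).mul_left C)

variable [CompleteSpace F]

/-- The continuous linear extension `f ↦ ∑ f i • v i` of the assignment `mono i ↦ v i`. -/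
def lift (v : ι → F) (C : ℝ) (hv : ∀ i, ‖v i‖ ≤ C * w i) : WeightedL1 𝕜 w →L[𝕜] F :=
  LinearMap.mkContinuous
    { toFun := fun f => ∑' i, coef i f • v i
      map_add' := fun f g => by
        simp only [map_add, add_smul]
        exact (summable_norm_coef_smul hv f).of_norm.tsum_add (summable_norm_coef_smul hv g).of_norm
      map_smul' := fun c f => by
        simp only [map_smul, smul_assoc, RingHom.id_apply]
        exact (summable_norm_coef_smul hv f).of_norm.tsum_const_smul c } C fun f => by
    rw [norm_eq_tsum, ← tsum_mul_left]
    exact tsum_of_norm_bounded ((summable_norm_coef_mul_weight f).mul_left C).hasSum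
      (norm_coef_smul_le hv f)

theorem hasSum_lift (v : ι → F) (C : ℝ) (hv : ∀ i, ‖v i‖ ≤ C * w i) (f : WeightedL1 𝕜 w) :
    HasSum (fun i => coef i f • v i) (lift v C hv f) :=
  (summable_norm_coef_smul hv f).of_norm.hasSum

theorem norm_lift_le (v : ι → F) {C : ℝ} (hC : 0 ≤ C) (hv : ∀ i, ‖v i‖ ≤ C * w i) :
    ‖(lift v C hv : WeightedL1 𝕜 w →L[𝕜] F)‖ ≤ C :=
  LinearMap.mkContinuous_norm_le _ hC _

@[simp]
theorem lift_mono [DecidableEq ι] (v : ι → F) (C : ℝ) (hv : ∀ i, ‖v i‖ ≤ C * w i) (i : ι) :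
    lift v C hv (mono 𝕜 w i) = v i := by
  refine (hasSum_lift v C hv _).unique ((hasSum_ite_eq i (v i)).congr_fun fun j => ?_)
  simp only [coef_mono, ite_smul, one_smul, zero_smul]
  grind

end Lift

end Module

section Algebra

variable {𝕜 ι : Type*} [RCLike 𝕜] [DecidableEq ι] {w : ι → ℝ}

section Mul

variable [AddCommMonoid ι] [hw : IsBeurlingWeight w]

variable (𝕜 w) in
/-- Convolution on a weighted `ℓ¹` space, as a bounded bilinear map. -/
def mulCLM : WeightedL1 𝕜 w →L[𝕜] WeightedL1 𝕜 w →L[𝕜] WeightedL1 𝕜 w :=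
  lift (fun i => lift (fun j => mono 𝕜 w (i + j)) (w i)
    fun j => (norm_mono _).trans_le (hw.add_le i j)) 1
    fun i => (norm_lift_le _ (hw.pos i).le _).trans_eq (one_mul _).symm

theorem mulCLM_mono_mono (i j : ι) :
    mulCLM 𝕜 w (mono 𝕜 w i) (mono 𝕜 w j) = mono 𝕜 w (i + j) := by
  rw [mulCLM, lift_mono, lift_mono]

theorem mulCLM_comm (f g : WeightedL1 𝕜 w) : mulCLM 𝕜 w f g = mulCLM 𝕜 w g f := by
  have h : mulCLM 𝕜 w = (mulCLM 𝕜 w).flip := clm_ext fun i => clm_ext fun j => by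
    rw [ContinuousLinearMap.flip_apply, mulCLM_mono_mono, mulCLM_mono_mono, add_comm]
  exact congrArg (fun B => B f g) h

theorem mulCLM_assoc (f g h : WeightedL1 𝕜 w) :
    mulCLM 𝕜 w (mulCLM 𝕜 w f g) h = mulCLM 𝕜 w f (mulCLM 𝕜 w g h) := by
  have hassoc : (ContinuousLinearMap.compL 𝕜 _ _ (WeightedL1 𝕜 w →L[𝕜] WeightedL1 𝕜 w)
        (mulCLM 𝕜 w)) ∘L mulCLM 𝕜 w =
      ((ContinuousLinearMap.compL 𝕜 (WeightedL1 𝕜 w) (WeightedL1 𝕜 w →L[𝕜] WeightedL1 𝕜 w)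
        (WeightedL1 𝕜 w →L[𝕜] WeightedL1 𝕜 w)).flip (mulCLM 𝕜 w)) ∘L
        (ContinuousLinearMap.compL 𝕜 _ _ _ ∘L mulCLM 𝕜 w) :=
    clm_ext fun i => clm_ext fun j => clm_ext fun k => by
      simp only [ContinuousLinearMap.comp_apply, ContinuousLinearMap.compL_apply,
        ContinuousLinearMap.flip_apply, mulCLM_mono_mono, add_assoc]
  exact congrArg (fun B => B f g h) hassoc

theorem mulCLM_mono_zero (f : WeightedL1 𝕜 w) : mulCLM 𝕜 w (mono 𝕜 w 0) f = f := by
  have h : mulCLM 𝕜 w (mono 𝕜 w 0) = .id 𝕜 _ := clm_ext fun i => by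
    rw [mulCLM_mono_mono, zero_add, ContinuousLinearMap.id_apply]
  exact congrArg (fun B => B f) h

theorem norm_mulCLM_le (f g : WeightedL1 𝕜 w) : ‖mulCLM 𝕜 w f g‖ ≤ ‖f‖ * ‖g‖ :=
  ((mulCLM 𝕜 w).le_of_opNorm₂_le_of_le (norm_lift_le _ zero_le_one _) le_rfl le_rfl).trans_eq
    (by rw [one_mul])

instance : NormedCommRing (WeightedL1 𝕜 w) where
  __ := (inferInstance : NormedAddCommGroup (WeightedL1 𝕜 w))
  mul f g := mulCLM 𝕜 w f g
  one := mono 𝕜 w 0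
  left_distrib f g h := (mulCLM 𝕜 w f).map_add g h
  right_distrib := (mulCLM 𝕜 w).map_add₂
  zero_mul := (mulCLM 𝕜 w).map_zero₂
  mul_zero f := (mulCLM 𝕜 w f).map_zero
  mul_assoc := mulCLM_assoc
  one_mul := mulCLM_mono_zero
  mul_one f := (mulCLM_comm f _).trans (mulCLM_mono_zero f)
  mul_comm := mulCLM_comm
  norm_mul_le := norm_mulCLM_le

instance : NormedAlgebra 𝕜 (WeightedL1 𝕜 w) where
  toAlgebra := Algebra.ofModule (fun c f g => (mulCLM 𝕜 w).map_smul₂ c f g)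
    (fun c f g => (mulCLM 𝕜 w f).map_smul c g)
  norm_smul_le := norm_smul_le

theorem lift_mul {B : Type*} [NormedRing B] [NormedAlgebra 𝕜 B] [CompleteSpace B] {v : ι → B}
    {C : ℝ} {hv : ∀ i, ‖v i‖ ≤ C * w i} (hmul : ∀ i j, v (i + j) = v i * v j)
    (f g : WeightedL1 𝕜 w) : lift v C hv (f * g) = lift v C hv f * lift v C hv g := by
  have h : ContinuousLinearMap.compL 𝕜 _ _ B (lift v C hv) ∘L mulCLM 𝕜 w =
      (ContinuousLinearMap.mul 𝕜 B).bilinearComp (lift v C hv) (lift v C hv) :=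
    clm_ext fun i => clm_ext fun j => by
      simp only [ContinuousLinearMap.comp_apply, ContinuousLinearMap.compL_apply,
        mulCLM_mono_mono, lift_mono, ContinuousLinearMap.bilinearComp_apply,
        ContinuousLinearMap.mul_apply', hmul]
  exact congrArg (fun T => T f g) h

variable {B : Type*} [NormedRing B] [NormedAlgebra 𝕜 B] [CompleteSpace B]

/-- The continuous algebra homomorphism extending a multiplicative assignment `mono i ↦ v i`. -/
def liftAlgHom (v : ι → B) (C : ℝ) (hv : ∀ i, ‖v i‖ ≤ C * w i) (hone : v 0 = 1)
    (hmul : ∀ i j, v (i + j) = v i * v j) : WeightedL1 𝕜 w →A[𝕜] B where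
  toAlgHom := AlgHom.ofLinearMap (lift v C hv : WeightedL1 𝕜 w →L[𝕜] B).toLinearMap
    ((lift_mono v C hv 0).trans hone) (lift_mul hmul)
  cont := (lift v C hv).continuous

end Mul

theorem coef_mono_mul [AddCommGroup ι] [IsBeurlingWeight w] (i j : ι) (f : WeightedL1 𝕜 w) :
    coef i (mono 𝕜 w j * f) = coef (i - j) f := by
  have h : coef i ∘L mulCLM 𝕜 w (mono 𝕜 w j) = coef (i - j) := clm_ext fun k => by
    rw [ContinuousLinearMap.comp_apply, mulCLM_mono_mono, coef_mono, coef_mono]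
    simp only [sub_eq_iff_eq_add']
  exact congrArg (fun T => T f) h

end Algebra

end WeightedL1

/-! ### Laurent series in the Wiener algebra of an annulus -/

/-- The weight `ρ ^ |k|` on Laurent coefficients, which makes a series converge absolutely on the
closed annulus `ρ⁻¹ ≤ |μ| ≤ ρ`. -/
def laurentWeight (ρ : ℝ) (k : ℤ) : ℝ := ρ ^ k.natAbs

/-- The weight `ρ ^ k` on Taylor coefficients. -/
def taylorWeight (ρ : ℝ) (k : ℕ) : ℝ := ρ ^ k

/-- The Wiener algebra of complex Laurent series on the annulus `ρ⁻¹ ≤ |μ| ≤ ρ`. -/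
abbrev Laurent (ρ : ℝ) := WeightedL1 ℂ (laurentWeight ρ)

/-- The space `𝒲^{≥ 0}_ℝ` of real power series, as a Banach space. -/
abbrev Taylor (ρ : ℝ) := WeightedL1 ℝ (taylorWeight ρ)

open WeightedL1

section Laurent

variable {ρ : ℝ} [hρ : Fact (1 ≤ ρ)]

theorem rho_pos : 0 < ρ := zero_lt_one.trans_le hρ.out

instance : IsBeurlingWeight (laurentWeight ρ) where
  pos _ := pow_pos rho_pos _
  add_le j k := by
    rw [laurentWeight, laurentWeight, laurentWeight, ← pow_add]
    exact pow_le_pow_right₀ hρ.out (Int.natAbs_add_le j k)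

instance : IsPositiveWeight (taylorWeight ρ) where
  pos _ := pow_pos rho_pos _

theorem one_le_laurentWeight (k : ℤ) : 1 ≤ laurentWeight ρ k := one_le_pow₀ hρ.out

namespace Laurent

/-- The monomial `μ ^ k`. -/
abbrev mono (k : ℤ) : Laurent ρ := WeightedL1.mono ℂ (laurentWeight ρ) k

theorem summable_norm_coef (f : Laurent ρ) : Summable fun k => ‖coef k f‖ :=
  .of_nonneg_of_le (fun _ => norm_nonneg _)
    (fun k => le_mul_of_one_le_right (norm_nonneg _) (one_le_laurentWeight k))
    (summable_norm_coef_mul_weight f)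

theorem norm_zpow_le_laurentWeight {μ : ℂ} (hμ : ‖μ‖ = 1) (k : ℤ) :
    ‖μ ^ k‖ ≤ 1 * laurentWeight ρ k := by
  rw [norm_zpow, hμ, one_zpow, one_mul]
  exact one_le_laurentWeight k

section Eval

variable {μ : ℂ} (hμ : ‖μ‖ = 1)

/-- Evaluation at a point of the unit circle. -/
def eval : Laurent ρ →A[ℂ] ℂ :=
  liftAlgHom (fun k => μ ^ k) 1 (norm_zpow_le_laurentWeight hμ) (zpow_zero μ) fun j k =>
    zpow_add₀ (norm_ne_zero_iff.1 (hμ ▸ one_ne_zero)) j k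

theorem hasSum_eval (f : Laurent ρ) : HasSum (fun k => coef k f * μ ^ k) (eval hμ f) :=
  hasSum_lift (fun k => μ ^ k) 1 (norm_zpow_le_laurentWeight hμ) f

theorem norm_eval_le (f : Laurent ρ) : ‖eval hμ f‖ ≤ ‖f‖ :=
  (ContinuousLinearMap.le_of_opNorm_le _
    (norm_lift_le (fun k => μ ^ k) zero_le_one (norm_zpow_le_laurentWeight hμ)) f).trans_eq
    (one_mul _)

@[simp]
theorem eval_mono (k : ℤ) : eval hμ (mono k : Laurent ρ) = μ ^ k :=
  lift_mono (fun k => μ ^ k) 1 (norm_zpow_le_laurentWeight hμ) k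

end Eval

/-- The substitution `μ ↦ -μ`. -/
def negSubst : Laurent ρ →L[ℂ] Laurent ρ :=
  lift (fun k => ((-1 : ℂ) ^ k) • mono k) 1 fun k => by
    rw [norm_smul, norm_mono, norm_zpow, norm_neg, norm_one, one_zpow]

theorem eval_negSubst {μ : ℂ} (hμ : ‖μ‖ = 1) (hneg : ‖-μ‖ = 1) (f : Laurent ρ) :
    eval hμ (negSubst f) = eval hneg f := by
  have h : (eval (ρ := ρ) hμ).toContinuousLinearMap ∘L negSubst =
      (eval (ρ := ρ) hneg).toContinuousLinearMap := clm_ext fun k => by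
    simp [negSubst, ← mul_zpow]
  exact congrArg (fun T => T f) h

/-- The substitution `μ ↦ μ⁻¹`. -/
def rev : Laurent ρ →L[ℂ] Laurent ρ :=
  lift (fun k => mono (-k)) 1 fun k => by
    rw [norm_mono, one_mul, laurentWeight, laurentWeight, Int.natAbs_neg]

theorem coef_rev (k : ℤ) (f : Laurent ρ) : coef k (rev f) = coef (-k) f := by
  have h : coef k ∘L rev (ρ := ρ) = coef (-k) := clm_ext fun j => by
    rw [ContinuousLinearMap.comp_apply, rev, lift_mono, coef_mono, coef_mono]
    simp only [neg_eq_iff_eq_neg]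
  exact congrArg (fun T => T f) h

end Laurent

end Laurent

theorem eq_zero_of_hasSum_zpow_eq_zero {c : ℤ → ℂ} (hc : Summable fun k => ‖c k‖)
    (hzero : ∀ μ : ℂ, ‖μ‖ = 1 → HasSum (fun k => c k * μ ^ k) 0) : c = 0 := by
  have : Fact (0 < (1 : ℝ)) := ⟨one_pos⟩
  have hsummable : Summable fun k => c k • (fourier k : C(AddCircle (1 : ℝ), ℂ)) :=
    .of_norm (hc.congr fun k => by rw [norm_smul, fourier_norm, mul_one])
  have hsum : ∑' k, c k • (fourier k : C(AddCircle (1 : ℝ), ℂ)) = 0 := by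
    ext x
    refine ((ContinuousMap.evalCLM ℂ x).hasSum hsummable.hasSum).unique ?_
    refine (hzero (fourier 1 x) (by rw [fourier_one]; exact Circle.norm_coe _)).congr_fun
      fun k => ?_
    simp [fourier_apply, AddCircle.toCircle_zsmul]
  funext n
  have hinner := ((innerSL ℂ (fourierLp (T := 1) 2 n)) ∘L
    ContinuousMap.toLp 2 (AddCircle.haarAddCircle (T := 1)) ℂ).hasSum hsummable.hasSum
  rw [hsum, map_zero] at hinner
  refine HasSum.unique ((hasSum_ite_eq n (c n)).congr_fun fun j => ?_) hinner
  have horth := orthonormal_iff_ite.1 (orthonormal_fourier (T := 1)) n j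
  rw [map_smul]
  change c j • inner ℂ (fourierLp 2 n) (fourierLp 2 j) = _
  rw [horth]
  aesop

section Laurent

variable {ρ : ℝ} [hρ : Fact (1 ≤ ρ)]

namespace Laurent

theorem eq_zero_of_eval {f : Laurent ρ} (h : ∀ (μ : ℂ) (hμ : ‖μ‖ = 1), eval hμ f = 0) :
    f = 0 := by
  have hcoef : (fun k => coef k f) = 0 :=
    eq_zero_of_hasSum_zpow_eq_zero (summable_norm_coef f) fun μ hμ => h μ hμ ▸ hasSum_eval hμ f
  ext k
  rw [map_zero]
  exact congrFun hcoef k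

/-! ### Laurent series with real coefficients -/

/-- The real part of the coefficient of `μ ^ k`. -/
def reCoef (k : ℤ) : Laurent ρ →L[ℝ] ℝ := reCLM ∘L (coef k).restrictScalars ℝ

theorem reCoef_apply (k : ℤ) (f : Laurent ρ) : reCoef k f = (coef k f).re := rfl

theorem reCoef_rev (k : ℤ) (f : Laurent ρ) : reCoef k (rev f) = reCoef (-k) f :=
  congrArg re (coef_rev k f)

theorem reCoef_mono_mul (j k : ℤ) (f : Laurent ρ) :
    reCoef k (mono j * f) = reCoef (k - j) f :=
  congrArg re (coef_mono_mul k j f)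

theorem reCoef_smul_mono (k j : ℤ) (v : ℝ) :
    reCoef k (v • mono j : Laurent ρ) = if k = j then v else 0 := by
  rw [map_smul, reCoef_apply, coef_mono]
  split_ifs <;> simp

/-- The Laurent series with real coefficients; on the unit circle they are the ones that commute
with complex conjugation. -/
def IsReal (f : Laurent ρ) : Prop := ∀ k, conj (coef k f) = coef k f

theorem IsReal.ofReal_reCoef {f : Laurent ρ} (hf : IsReal f) (k : ℤ) :
    (reCoef k f : ℂ) = coef k f :=
  conj_eq_iff_re.1 (hf k)

theorem norm_conj_eq_one {μ : ℂ} (hμ : ‖μ‖ = 1) : ‖conj μ‖ = 1 := (RCLike.norm_conj μ).trans hμ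

theorem isReal_of_conj_eval {f : Laurent ρ}
    (h : ∀ (μ : ℂ) (hμ : ‖μ‖ = 1), conj (eval (norm_conj_eq_one hμ) f) = eval hμ f) :
    IsReal f := by
  have hdiff : (fun k => conj (coef k f) - coef k f) = 0 := by
    refine eq_zero_of_hasSum_zpow_eq_zero ?_ fun μ hμ => ?_
    · refine .of_nonneg_of_le (fun _ => norm_nonneg _) (fun k => norm_sub_le _ _) ?_
      simp only [RCLike.norm_conj]
      exact (summable_norm_coef f).add (summable_norm_coef f)
    · have hconj := (hasSum_eval (norm_conj_eq_one hμ) f).map (starRingEnd ℂ) continuous_conj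
      rw [h μ hμ] at hconj
      simpa [Function.comp_def, map_mul, map_zpow₀, sub_mul] using hconj.sub (hasSum_eval hμ f)
  exact fun k => sub_eq_zero.1 (congrFun hdiff k)

theorem IsReal.conj_eval {f : Laurent ρ} (hf : IsReal f) {μ : ℂ} (hμ : ‖μ‖ = 1) :
    conj (eval hμ f) = eval hμ (rev f) := by
  refine ((hasSum_eval hμ f).map (starRingEnd ℂ) continuous_conj).unique
    (((Equiv.neg ℤ).hasSum_iff.2 (hasSum_eval hμ (rev f))).congr_fun fun k => ?_)
  simp only [Function.comp_apply, Equiv.neg_apply]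
  rw [coef_rev, neg_neg, map_mul, hf, map_zpow₀, ← Complex.inv_eq_conj hμ, inv_zpow, zpow_neg]

theorem eval_eq_conj_eval_iff {f g : Laurent ρ} (hf : IsReal f) (hg : IsReal g) :
    (∀ (μ : ℂ) (hμ : ‖μ‖ = 1), eval hμ f = conj (eval hμ g)) ↔
      ∀ k, reCoef k f = reCoef (-k) g := by
  constructor
  · intro h k
    have hzero : f - rev g = 0 := eq_zero_of_eval fun μ hμ => by
      rw [map_sub, h μ hμ, hg.conj_eval, sub_self]
    rw [← reCoef_rev, sub_eq_zero.1 hzero]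
  · intro h μ hμ
    rw [hg.conj_eval]
    congr 1
    ext k
    rw [coef_rev, ← hf.ofReal_reCoef, ← hg.ofReal_reCoef, h k]

theorem IsReal.eval_eq_zero_iff {f : Laurent ρ} (hf : IsReal f) {μ : ℂ} (hμ : ‖μ‖ = 1)
    (hconj : conj μ = μ) : eval hμ f = 0 ↔ (eval hμ f).re = 0 := by
  have hsum := (hasSum_eval hμ f).map (starRingEnd ℂ) continuous_conj
  have hreal : conj (eval hμ f) = eval hμ f := (hsum.congr_fun fun k => by
    rw [Function.comp_apply, map_mul, map_zpow₀, hconj, hf k]).unique (hasSum_eval hμ f)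
  rw [← conj_eq_iff_re.1 hreal, ofReal_eq_zero, ofReal_re]

/-- The real part of the value at `1`. -/
def valOne : Laurent ρ →L[ℝ] ℝ :=
  reCLM ∘L (eval (ρ := ρ) norm_one).toContinuousLinearMap.restrictScalars ℝ

/-- The real part of the value at `-1`. -/
def valNegOne : Laurent ρ →L[ℝ] ℝ :=
  reCLM ∘L (eval (ρ := ρ) ((norm_neg 1).trans norm_one)).toContinuousLinearMap.restrictScalars ℝ

theorem valOne_apply (f : Laurent ρ) : valOne f = (eval norm_one f).re := rfl

theorem valNegOne_apply (f : Laurent ρ) :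
    valNegOne f = (eval ((norm_neg (1 : ℂ)).trans norm_one) f).re := rfl

theorem IsReal.valOne_eq_zero_iff {f : Laurent ρ} (hf : IsReal f) :
    valOne f = 0 ↔ eval norm_one f = 0 :=
  (hf.eval_eq_zero_iff norm_one (map_one _)).symm

theorem IsReal.valNegOne_eq_zero_iff {f : Laurent ρ} (hf : IsReal f) :
    valNegOne f = 0 ↔ eval ((norm_neg (1 : ℂ)).trans norm_one) f = 0 :=
  (hf.eval_eq_zero_iff _ (by rw [map_neg, map_one])).symm

theorem valOne_mono_mul (k : ℤ) (f : Laurent ρ) : valOne (mono k * f) = valOne f := by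
  rw [valOne_apply, map_mul, eval_mono, one_zpow, one_mul, valOne_apply]

theorem valNegOne_mono_neg_one_mul (f : Laurent ρ) :
    valNegOne (mono (-1) * f) = -valNegOne f := by
  rw [valNegOne_apply, map_mul, eval_mono, valNegOne_apply]
  simp

theorem valOne_smul_mono (v : ℝ) (k : ℤ) : valOne (v • mono k : Laurent ρ) = v := by
  rw [map_smul, valOne_apply, eval_mono, one_zpow, one_re, smul_eq_mul, mul_one]

theorem valNegOne_smul_mono (v : ℝ) (k : ℤ) :
    valNegOne (v • mono k : Laurent ρ) = (-1) ^ k * v := by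
  rw [map_smul, valNegOne_apply, eval_mono, smul_eq_mul, mul_comm]
  congr 1
  rw [show ((-1 : ℂ) ^ k) = ((-1 : ℝ) ^ k : ℝ) by push_cast; rfl, ofReal_re]

end Laurent

/-! ### Power series -/

namespace Taylor

open Laurent

/-- The monomial `μ ^ n`. -/
abbrev mono (n : ℕ) : Taylor ρ := WeightedL1.mono ℝ (taylorWeight ρ) n

/-- The inclusion of power series into Laurent series. -/
def toLaurent : Taylor ρ →L[ℝ] Laurent ρ :=
  lift (fun n : ℕ => Laurent.mono (n : ℤ)) 1 fun n => by
    rw [norm_mono, one_mul, laurentWeight, Int.natAbs_natCast, taylorWeight]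

@[simp]
theorem toLaurent_mono (n : ℕ) : toLaurent (mono n : Taylor ρ) = Laurent.mono n :=
  lift_mono _ _ _ n

theorem reCoef_toLaurent (k : ℤ) (f : Taylor ρ) :
    reCoef k (toLaurent f) = if 0 ≤ k then coef k.toNat f else 0 := by
  have h : reCoef k ∘L toLaurent (ρ := ρ) = if 0 ≤ k then coef k.toNat else 0 :=
    clm_ext fun n => by
      have hcoef := reCoef_smul_mono (ρ := ρ) k n 1
      rw [one_smul] at hcoef
      rw [ContinuousLinearMap.comp_apply, toLaurent_mono, hcoef]
      split_ifs <;> simp [coef_mono] <;> omega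
  rw [← ContinuousLinearMap.comp_apply, h]
  split_ifs <;> rfl

theorem norm_ite_reCoef_mul_le (N n : ℕ) (f : Laurent ρ) :
    ‖if N ≤ n then reCoef n f else 0‖ * taylorWeight ρ n ≤
      ‖coef (n : ℤ) f‖ * laurentWeight ρ n := by
  refine mul_le_mul_of_nonneg_right ?_ (IsPositiveWeight.pos _).le
  split_ifs
  exacts [abs_re_le_norm _, norm_zero.trans_le (norm_nonneg _)]

theorem summable_norm_ite_reCoef_mul (N : ℕ) (f : Laurent ρ) :
    Summable fun n : ℕ => ‖if N ≤ n then reCoef n f else 0‖ * taylorWeight ρ n :=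
  .of_nonneg_of_le (fun _ => mul_nonneg (norm_nonneg _) (IsPositiveWeight.pos _).le)
    (fun n => norm_ite_reCoef_mul_le N n f)
    ((summable_norm_coef_mul_weight f).comp_injective Nat.cast_injective)

/-- The power series of the real parts of the coefficients of `μ ^ n`, `N ≤ n`. -/
def ofLaurent (N : ℕ) : Laurent ρ →L[ℝ] Taylor ρ :=
  LinearMap.mkContinuous
    { toFun f := ofCoef (fun n : ℕ => if N ≤ n then reCoef n f else 0)
        (summable_norm_ite_reCoef_mul N f)
      map_add' f g := by
        ext n
        simp only [map_add, coef_ofCoef]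
        split_ifs <;> simp
      map_smul' c f := by
        ext n
        simp only [map_smul, coef_ofCoef, RingHom.id_apply]
        split_ifs <;> simp } 1 fun f => by
    rw [one_mul, norm_eq_tsum f, norm_eq_tsum]
    simp only [LinearMap.coe_mk, AddHom.coe_mk, coef_ofCoef]
    refine ((summable_norm_ite_reCoef_mul N f).tsum_le_tsum
      (fun n => norm_ite_reCoef_mul_le N n f)
      ((summable_norm_coef_mul_weight f).comp_injective Nat.cast_injective)).trans ?_
    exact tsum_comp_le_tsum_of_inj (summable_norm_coef_mul_weight f)
      (fun k => mul_nonneg (norm_nonneg _) (IsPositiveWeight.pos _).le) Nat.cast_injective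

theorem coef_ofLaurent (N n : ℕ) (f : Laurent ρ) :
    coef n (ofLaurent N f) = if N ≤ n then reCoef n f else 0 :=
  coef_ofCoef _ (summable_norm_ite_reCoef_mul N f) n

end Taylor

end Laurent

/-! ### The parameter space -/

section Param

variable {ρ : ℝ} [hρ : Fact (1 ≤ ρ)]

theorem mem_wienerPos_iff {c : ℕ → ℝ} :
    c ∈ WienerPos ρ ↔ Summable fun k => ‖c k‖ * taylorWeight ρ k := by
  change (Summable fun k => |c k| * |ρ| ^ k) ↔ _
  rw [abs_of_pos rho_pos]
  rfl

/-- The identification of the loops of `WienerPos ρ` with weighted `ℓ¹` sequences. -/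
def taylorEquiv : WienerPos ρ ≃ₗ[ℝ] Taylor ρ where
  toFun f := ofCoef f.1 (mem_wienerPos_iff.1 f.2)
  map_add' f g := by ext; simp
  map_smul' c f := by ext; simp
  invFun f := ⟨fun n => coef n f, mem_wienerPos_iff.2 (summable_norm_coef_mul_weight f)⟩
  left_inv f := Subtype.ext (funext fun n => coef_ofCoef _ (mem_wienerPos_iff.1 f.2) n)
  right_inv f := by ext; simp

@[simp]
theorem coef_taylorEquiv (f : WienerPos ρ) (n : ℕ) : coef n (taylorEquiv f) = f.1 n :=
  coef_ofCoef _ (mem_wienerPos_iff.1 f.2) n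

theorem norm_taylorEquiv (f : WienerPos ρ) : ‖taylorEquiv f‖ = wienerNorm f := by
  simp only [norm_eq_tsum, coef_taylorEquiv, wienerNorm, abs_of_pos (rho_pos (ρ := ρ))]
  rfl

theorem eval_toLaurent {μ : ℂ} (hμ : ‖μ‖ = 1) (f : WienerPos ρ) :
    Laurent.eval hμ (taylorEquiv f).toLaurent = ev f μ := by
  have h : HasSum (fun n : ℕ => coef n (taylorEquiv f) • (Laurent.mono (n : ℤ) : Laurent ρ))
      (taylorEquiv f).toLaurent := hasSum_lift _ _ _ _
  have heval := h.map (Laurent.eval hμ) (Laurent.eval hμ).cont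
  rw [ev, ← heval.tsum_eq]
  refine tsum_congr fun n => ?_
  simp [← Complex.coe_smul]

/-- The Banach space of the parameters `(r, a, b, c)`. -/
abbrev ParamSpace (ρ : ℝ) := ℝ × Taylor ρ × Taylor ρ × Taylor ρ

/-- The identification of parameter vectors with points of the Banach space `ParamSpace ρ`. -/
def paramEquiv : Param ρ ≃ ParamSpace ρ where
  toFun x := (x.r, taylorEquiv x.a, taylorEquiv x.b, taylorEquiv x.c)
  invFun y := ⟨y.1, taylorEquiv.symm y.2.1, taylorEquiv.symm y.2.2.1, taylorEquiv.symm y.2.2.2⟩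
  left_inv x := by simp
  right_inv y := by simp

theorem mem_nbhd_iff (x : Param ρ) (δ : ℝ) :
    x ∈ nbhd ρ δ ↔ paramEquiv x ∈ Metric.ball (paramEquiv (x₀ ρ)) δ := by
  rw [mem_ball_iff_norm, nbhd, mem_ofPred_eq]
  simp only [paramEquiv, Equiv.coe_fn_mk, Prod.mk_sub_mk, Prod.norm_mk, max_lt_iff,
    Real.norm_eq_abs, ← map_sub, norm_taylorEquiv]

variable (ρ) in
/-- The central value `x₀` as a point of the parameter space. -/
def centre : ParamSpace ρ := paramEquiv (x₀ ρ)

theorem centre_r : (centre ρ).1 = 1 := rfl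

theorem centre_a : (centre ρ).2.1 = Taylor.mono 1 := by
  ext n
  simp [centre, paramEquiv, x₀, coef_mono]

theorem centre_b :
    (centre ρ).2.2.1 = (-1 / 2 : ℝ) • Taylor.mono 0 + (1 / 2 : ℝ) • Taylor.mono 2 := by
  ext n
  simp only [centre, paramEquiv, x₀, Equiv.coe_fn_mk, coef_taylorEquiv, map_add, map_smul,
    coef_mono]
  split_ifs <;> first | omega | norm_num

theorem centre_c : (centre ρ).2.2.2 = (-2 : ℝ) • Taylor.mono 0 := by
  ext n
  simp only [centre, paramEquiv, x₀, Equiv.coe_fn_mk, coef_taylorEquiv, map_smul, coef_mono,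
    smul_eq_mul, mul_ite, mul_one, mul_zero]

end Param

/-! ### The logarithm series in a Banach algebra -/

section Log

variable {𝔸 : Type*} [NormedRing 𝔸]

theorem norm_pow_succ_sub_pow_succ_le {N N' : 𝔸} {r : ℝ} (hN : ‖N‖ ≤ r) (hN' : ‖N'‖ ≤ r)
    (k : ℕ) : ‖N ^ (k + 1) - N' ^ (k + 1)‖ ≤ (k + 1) * r ^ k * ‖N - N'‖ := by
  have hr : 0 ≤ r := (norm_nonneg _).trans hN
  induction k with
  | zero => simp
  | succ k ih =>
    have hsplit : N ^ (k + 2) - N' ^ (k + 2)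
        = N * (N ^ (k + 1) - N' ^ (k + 1)) + (N - N') * N' ^ (k + 1) := by
      rw [mul_sub, sub_mul, ← pow_succ', ← pow_succ']
      abel
    have hpow : ‖N' ^ (k + 1)‖ ≤ r ^ (k + 1) :=
      (norm_pow_le' N' k.succ_pos).trans (pow_le_pow_left₀ (norm_nonneg _) hN' _)
    rw [hsplit]
    calc _ ≤ ‖N‖ * ‖N ^ (k + 1) - N' ^ (k + 1)‖ + ‖N - N'‖ * ‖N' ^ (k + 1)‖ :=
          (norm_add_le _ _).trans (add_le_add (norm_mul_le _ _) (norm_mul_le _ _))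
      _ ≤ r * ((k + 1) * r ^ k * ‖N - N'‖) + ‖N - N'‖ * r ^ (k + 1) := by gcongr
      _ = _ := by push_cast; ring

variable [NormedAlgebra ℂ 𝔸]

/-- The logarithm series `log (1 + N) = N - N²/2 + N³/3 - …`. -/
def logOneAdd (N : 𝔸) : 𝔸 := ∑' k : ℕ, ((-1) ^ k / (k + 1) : ℂ) • N ^ (k + 1)

theorem norm_neg_one_pow_div (k : ℕ) : ‖((-1) ^ k / (k + 1) : ℂ)‖ = 1 / (k + 1 : ℝ) := by
  rw [norm_div, norm_pow, norm_neg, norm_one, one_pow]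
  congr 1
  exact_mod_cast Complex.norm_natCast (k + 1)

theorem logOneAdd_zero : logOneAdd (0 : 𝔸) = 0 := by simp [logOneAdd]

variable [CompleteSpace 𝔸]

theorem summable_logOneAdd {N : 𝔸} (hN : ‖N‖ < 1) :
    Summable fun k : ℕ => ((-1) ^ k / (k + 1) : ℂ) • N ^ (k + 1) := by
  refine .of_norm_bounded (summable_geometric_of_lt_one (norm_nonneg N) hN) fun k => ?_
  have hpow : ‖N ^ (k + 1)‖ ≤ ‖N‖ ^ k := (norm_pow_le' N k.succ_pos).trans
    (pow_le_pow_of_le_one (norm_nonneg _) hN.le k.le_succ)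
  have hcoeff : 1 / (k + 1 : ℝ) ≤ 1 := (div_le_one (by positivity)).2 (by simp)
  rw [norm_smul, norm_neg_one_pow_div]
  exact (mul_le_mul hcoeff hpow (norm_nonneg _) zero_le_one).trans_eq (one_mul _)

theorem norm_logOneAdd_sub_le {N N' : 𝔸} {r : ℝ} (hr : r < 1) (hN : ‖N‖ ≤ r) (hN' : ‖N'‖ ≤ r) :
    ‖logOneAdd N - logOneAdd N' - (N - N')‖ ≤ r / (1 - r) * ‖N - N'‖ := by
  have hr0 : 0 ≤ r := (norm_nonneg _).trans hN
  let term (k : ℕ) : 𝔸 := ((-1) ^ k / (k + 1) : ℂ) • (N ^ (k + 1) - N' ^ (k + 1))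
  have hsum : HasSum term (logOneAdd N - logOneAdd N') :=
    ((summable_logOneAdd (hN.trans_lt hr)).hasSum.sub
      (summable_logOneAdd (hN'.trans_lt hr)).hasSum).congr_fun fun k => smul_sub _ _ _
  have htail : HasSum (fun k => term (k + 1)) (logOneAdd N - logOneAdd N' - (N - N')) := by
    simpa [term] using (hasSum_nat_add_iff' 1).2 hsum
  have hterm : ∀ k, ‖term (k + 1)‖ ≤ r ^ k * (r * ‖N - N'‖) := by
    intro k
    rw [norm_smul, norm_neg_one_pow_div]
    calc _ ≤ 1 / (((k + 1 : ℕ) : ℝ) + 1) *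
          ((((k + 1 : ℕ) : ℝ) + 1) * r ^ (k + 1) * ‖N - N'‖) := by
          gcongr
          exact norm_pow_succ_sub_pow_succ_le hN hN' (k + 1)
      _ = r ^ k * (r * ‖N - N'‖) := by field_simp; ring
  have hgeom := (hasSum_geometric_of_lt_one hr0 hr).mul_right (r * ‖N - N'‖)
  rw [← htail.tsum_eq]
  exact (tsum_of_norm_bounded hgeom hterm).trans_eq (by ring)

theorem injOn_logOneAdd : InjOn (logOneAdd : 𝔸 → 𝔸) (Metric.ball 0 (1 / 2)) := by
  intro N hN N' hN' heq
  rw [mem_ball_zero_iff] at hN hN'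
  have hr : max ‖N‖ ‖N'‖ < 1 / 2 := max_lt hN hN'
  have hle := norm_logOneAdd_sub_le (by linarith) (le_max_left ‖N‖ ‖N'‖) (le_max_right _ _)
  rw [heq, sub_self, zero_sub, norm_neg] at hle
  have hlt : max ‖N‖ ‖N'‖ / (1 - max ‖N‖ ‖N'‖) < 1 := by
    rw [div_lt_one] <;> linarith
  rw [← sub_eq_zero, ← norm_le_zero_iff]
  nlinarith [norm_nonneg (N - N')]

theorem hasStrictFDerivAt_logOneAdd :
    HasStrictFDerivAt (logOneAdd : 𝔸 → 𝔸) (ContinuousLinearMap.id ℂ 𝔸) 0 := by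
  refine .of_isLittleO (.of_bound fun c hc => ?_)
  have hr : 1 - c / (1 + c) = 1 / (1 + c) := by field_simp; ring
  have hpos : 0 < c / (1 + c) := by positivity
  filter_upwards [Metric.ball_mem_nhds (0 : 𝔸 × 𝔸) hpos] with p hp
  rw [mem_ball_zero_iff] at hp
  refine (norm_logOneAdd_sub_le (by rw [div_lt_one] <;> linarith)
    ((norm_fst_le p).trans hp.le) ((norm_snd_le p).trans hp.le)).trans_eq ?_
  rw [hr]
  field_simp

theorem map_logOneAdd {𝔹 : Type*} [NormedRing 𝔹] [NormedAlgebra ℂ 𝔹] (φ : 𝔸 →+ 𝔹)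
    (hφ : Continuous φ) {N : 𝔸} (hN : ‖N‖ < 1)
    (hterm : ∀ k : ℕ, φ (((-1) ^ k / (k + 1) : ℂ) • N ^ (k + 1))
      = ((-1) ^ k / (k + 1) : ℂ) • φ N ^ (k + 1)) :
    φ (logOneAdd N) = logOneAdd (φ N) := by
  rw [logOneAdd, logOneAdd, ← ((summable_logOneAdd hN).hasSum.map φ hφ).tsum_eq]
  exact tsum_congr hterm

theorem logOneAdd_units_conj (u : 𝔸ˣ) {N : 𝔸} (hN : ‖N‖ < 1) :
    logOneAdd (u * N * u⁻¹ : 𝔸) = u * logOneAdd N * u⁻¹ := by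
  let conjHom : 𝔸 →+ 𝔸 := (AddMonoidHom.mulRight (↑u⁻¹ : 𝔸)).comp (AddMonoidHom.mulLeft (u : 𝔸))
  have hcont : Continuous conjHom := (continuous_const_mul (u : 𝔸)).mul continuous_const
  refine (map_logOneAdd conjHom hcont hN fun k => ?_).symm
  change u * (_ • _) * (↑u⁻¹ : 𝔸) = _ • (u * N * (↑u⁻¹ : 𝔸)) ^ (k + 1)
  rw [Units.conj_pow, mul_smul_comm, smul_mul_assoc]

end Log

/-! ### The linear equation `Y' = Y B` -/

section Ode

/-- The Banach algebra of continuous functions on `[0,1]` with values in `𝔸`, for the coefficients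
and the solutions of linear differential equations. It is a type synonym because instance search
on spaces of operators on `C(unitInterval, 𝔸)` is too slow. -/
def PathAlg (𝔸 : Type*) [NormedRing 𝔸] : Type _ := C(unitInterval, 𝔸)

variable {𝔸 : Type*} [NormedRing 𝔸]

namespace PathAlg

instance : NormedRing (PathAlg 𝔸) := inferInstanceAs (NormedRing C(unitInterval, 𝔸))

instance : FunLike (PathAlg 𝔸) unitInterval 𝔸 :=
  inferInstanceAs (FunLike C(unitInterval, 𝔸) unitInterval 𝔸)

instance : ContinuousMapClass (PathAlg 𝔸) unitInterval 𝔸 :=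
  inferInstanceAs (ContinuousMapClass C(unitInterval, 𝔸) unitInterval 𝔸)

instance [NormedAlgebra ℂ 𝔸] : NormedAlgebra ℂ (PathAlg 𝔸) :=
  inferInstanceAs (NormedAlgebra ℂ C(unitInterval, 𝔸))

instance [CompleteSpace 𝔸] : CompleteSpace (PathAlg 𝔸) :=
  inferInstanceAs (CompleteSpace C(unitInterval, 𝔸))

@[ext]
theorem ext {f g : PathAlg 𝔸} (h : ∀ s, f s = g s) : f = g := DFunLike.ext _ _ h

theorem norm_apply_le (f : PathAlg 𝔸) (s : unitInterval) : ‖f s‖ ≤ ‖f‖ :=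
  ContinuousMap.norm_coe_le_norm f s

theorem norm_le {f : PathAlg 𝔸} {C : ℝ} (hC : 0 ≤ C) (h : ∀ s, ‖f s‖ ≤ C) : ‖f‖ ≤ C :=
  (ContinuousMap.norm_le f hC).2 h

variable (𝔸) in
/-- Evaluation at a point of `[0,1]`. -/
def evalAt [NormedAlgebra ℂ 𝔸] (s : unitInterval) : PathAlg 𝔸 →L[ℂ] 𝔸 :=
  ContinuousMap.evalCLM ℂ s

theorem continuous_IccExtend (f : PathAlg 𝔸) : Continuous (IccExtend zero_le_one f) :=
  (map_continuous f).Icc_extend'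

end PathAlg

variable [NormedAlgebra ℂ 𝔸]

/-- The Volterra operator `f ↦ ∫₀ˢ f`. -/
def volterra : PathAlg 𝔸 →L[ℂ] PathAlg 𝔸 :=
  LinearMap.mkContinuous
    { toFun f := ContinuousMap.mk (fun s => ∫ u in (0 : ℝ)..s, IccExtend zero_le_one f u)
        ((intervalIntegral.continuous_primitive
          (fun a b => (f.continuous_IccExtend).intervalIntegrable a b) 0).comp
          continuous_subtype_val)
      map_add' f g := by
        ext s
        exact intervalIntegral.integral_add ((f.continuous_IccExtend).intervalIntegrable _ _)
          ((g.continuous_IccExtend).intervalIntegrable _ _)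
      map_smul' c f := by
        ext s
        exact intervalIntegral.integral_smul c _ } 1 fun f => by
    rw [one_mul]
    refine PathAlg.norm_le (norm_nonneg f) fun s => ?_
    refine (intervalIntegral.norm_integral_le_of_norm_le_const (C := ‖f‖)
      fun u _ => f.norm_apply_le _).trans ?_
    rw [sub_zero, abs_of_nonneg s.2.1]
    exact mul_le_of_le_one_right (norm_nonneg _) s.2.2

theorem norm_volterra_le : ‖(volterra : PathAlg 𝔸 →L[ℂ] PathAlg 𝔸)‖ ≤ 1 :=
  LinearMap.mkContinuous_norm_le _ zero_le_one _

/-- The operator `f ↦ ∫₀ˢ f B`, as a function of `B`. -/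
def volterraMul : PathAlg 𝔸 →L[ℂ] PathAlg 𝔸 →L[ℂ] PathAlg 𝔸 :=
  (ContinuousLinearMap.compL ℂ _ _ _ volterra) ∘L (ContinuousLinearMap.mul ℂ (PathAlg 𝔸)).flip

theorem volterraMul_apply (B f : PathAlg 𝔸) : volterraMul B f = volterra (f * B) := rfl

theorem norm_volterraMul_le (B : PathAlg 𝔸) : ‖volterraMul B‖ ≤ ‖B‖ := by
  refine ContinuousLinearMap.opNorm_le_bound _ (norm_nonneg _) fun f => ?_
  calc ‖volterra (f * B)‖ ≤ 1 * (‖f‖ * ‖B‖) :=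
        (volterra.le_of_opNorm_le norm_volterra_le _).trans (by gcongr; exact norm_mul_le _ _)
    _ = ‖B‖ * ‖f‖ := by ring

/-- The solution of `Y' = Y B`, `Y 0 = 1` for a small continuous coefficient `B`. -/
def odeSol (B : PathAlg 𝔸) : PathAlg 𝔸 := Ring.inverse (1 - volterraMul B) 1

/-- The end value of the solution of `Y' = Y B`, `Y 0 = 1`. -/
def odeEnd (B : PathAlg 𝔸) : 𝔸 := odeSol B 1

/-- The integral over `[0,1]`. -/
def totalInt : PathAlg 𝔸 →L[ℂ] 𝔸 := PathAlg.evalAt 𝔸 1 ∘L volterra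

theorem odeEnd_zero : odeEnd (0 : PathAlg 𝔸) = 1 := by
  rw [odeEnd, odeSol, map_zero, sub_zero, Ring.inverse_one]
  rfl

/-- The solution of `Y' = Y B`, `Y 0 = 1`, extended to the line. -/
def odeFun (B : PathAlg 𝔸) (s : ℝ) : 𝔸 :=
  1 + ∫ u in (0 : ℝ)..s, IccExtend zero_le_one (odeSol B * B) u

theorem odeFun_zero (B : PathAlg 𝔸) : odeFun B 0 = 1 := by simp [odeFun]

/-- The logarithm of the end value of the solution of `Y' = Y B`, `Y 0 = 1`. -/
def odeLog (B : PathAlg 𝔸) : 𝔸 := logOneAdd (odeEnd B - 1)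

theorem odeLog_zero : odeLog (0 : PathAlg 𝔸) = 0 := by
  rw [odeLog, odeEnd_zero, sub_self, logOneAdd_zero]

variable [CompleteSpace 𝔸]

theorem odeSol_eq {B : PathAlg 𝔸} (hB : ‖B‖ < 1) :
    odeSol B = 1 + volterra (odeSol B * B) := by
  have hunit : IsUnit (1 - volterraMul B) :=
    isUnit_one_sub_of_norm_lt_one ((norm_volterraMul_le B).trans_lt hB)
  have hcancel : odeSol B - volterra (odeSol B * B) = 1 :=
    congrArg (fun T : PathAlg 𝔸 →L[ℂ] PathAlg 𝔸 => T 1) (Ring.mul_inverse_cancel _ hunit)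
  exact sub_eq_iff_eq_add.1 hcancel

theorem odeFun_eq {B : PathAlg 𝔸} (hB : ‖B‖ < 1) (s : unitInterval) :
    odeFun B s = odeSol B s := by
  conv_rhs => rw [odeSol_eq hB]
  rfl

theorem odeFun_one {B : PathAlg 𝔸} (hB : ‖B‖ < 1) : odeFun B 1 = odeEnd B := odeFun_eq hB 1

theorem hasDerivAt_odeFun {B : PathAlg 𝔸} (hB : ‖B‖ < 1) (s : unitInterval) :
    HasDerivAt (odeFun B) (odeFun B s * B s) s := by
  have hcont := (odeSol B * B).continuous_IccExtend
  refine ((intervalIntegral.integral_hasDerivAt_right (hcont.intervalIntegrable 0 s)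
    hcont.stronglyMeasurable.stronglyMeasurableAtFilter hcont.continuousAt).const_add
    (1 : 𝔸)).congr_deriv ?_
  rw [odeFun_eq hB, IccExtend_val]
  rfl

theorem hasStrictFDerivAt_odeEnd :
    HasStrictFDerivAt (odeEnd : PathAlg 𝔸 → 𝔸) totalInt 0 := by
  have hop : HasStrictFDerivAt (fun B : PathAlg 𝔸 => 1 - volterraMul B) (-volterraMul) 0 :=
    (volterraMul (𝔸 := 𝔸)).hasStrictFDerivAt.const_sub 1
  have hinv := hasStrictFDerivAt_ringInverse (𝕜 := ℂ) (1 : (PathAlg 𝔸 →L[ℂ] PathAlg 𝔸)ˣ)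
  have hone : ((1 : (PathAlg 𝔸 →L[ℂ] PathAlg 𝔸)ˣ) : PathAlg 𝔸 →L[ℂ] PathAlg 𝔸) =
      1 - volterraMul (0 : PathAlg 𝔸) := by simp
  rw [hone] at hinv
  refine ((PathAlg.evalAt 𝔸 1 ∘L ContinuousLinearMap.apply ℂ (PathAlg 𝔸)
    (1 : PathAlg 𝔸)).hasStrictFDerivAt.comp (0 : PathAlg 𝔸)
    (hinv.comp (0 : PathAlg 𝔸) hop)).congr_fderiv ?_
  ext B
  simp [totalInt, volterraMul_apply, ContinuousLinearMap.mulLeftRight_apply]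

theorem hasStrictFDerivAt_odeLog :
    HasStrictFDerivAt (odeLog : PathAlg 𝔸 → 𝔸) totalInt 0 := by
  have hlog : HasStrictFDerivAt (logOneAdd : 𝔸 → 𝔸) (ContinuousLinearMap.id ℂ 𝔸)
      (odeEnd (0 : PathAlg 𝔸) - 1) := by
    rw [odeEnd_zero, sub_self]
    exact hasStrictFDerivAt_logOneAdd
  exact (hlog.comp (0 : PathAlg 𝔸) ((hasStrictFDerivAt_odeEnd (𝔸 := 𝔸)).sub_const 1)).congr_fderiv
    (ContinuousLinearMap.id_comp _)

theorem exists_odeLog_approx {c κ : ℝ} (hc : 0 < c) (hκ : 0 < κ) :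
    ∃ r > 0, r ≤ 1 ∧ ∀ B B' : PathAlg 𝔸, ‖B‖ < r → ‖B'‖ < r →
      ‖odeEnd B - 1‖ < κ ∧ ‖odeLog B - odeLog B' - totalInt (B - B')‖ ≤ c * ‖B - B'‖ := by
  have hend : ∀ᶠ B : PathAlg 𝔸 in nhds 0, ‖odeEnd B - 1‖ < κ := by
    filter_upwards [Metric.tendsto_nhds.1 (hasStrictFDerivAt_odeEnd (𝔸 := 𝔸)).continuousAt κ hκ]
      with B hB
    rwa [odeEnd_zero, dist_eq_norm] at hB
  obtain ⟨r₁, hr₁, hlog⟩ :=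
    Metric.eventually_nhds_iff.1 ((hasStrictFDerivAt_odeLog (𝔸 := 𝔸)).isLittleO.def hc)
  obtain ⟨r₂, hr₂, hend⟩ := Metric.eventually_nhds_iff.1 hend
  refine ⟨min 1 (min r₁ r₂), by positivity, min_le_left _ _, fun B B' hB hB' => ?_⟩
  simp only [lt_min_iff] at hB hB'
  refine ⟨hend (by simpa using hB.2.2), hlog (y := (B, B')) ?_⟩
  rw [Prod.dist_eq, max_lt_iff]
  exact ⟨by simpa using hB.2.1, by simpa using hB'.2.1⟩

end Ode

/-! ### Two by two matrices near the identity -/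

section MatrixLog

open Matrix
open scoped Matrix.Norms.Operator

section MatrixNorm

variable {ι R : Type*} [Fintype ι] [SeminormedAddCommGroup R]

theorem norm_entry_le (A : Matrix ι ι R) (i j : ι) : ‖A i j‖ ≤ ‖A‖ := by
  rw [linfty_opNorm_def]
  have hrow : ‖A i j‖₊ ≤ ∑ k, ‖A i k‖₊ :=
    Finset.single_le_sum (f := fun k => ‖A i k‖₊) (fun _ _ => zero_le) (Finset.mem_univ j)
  exact_mod_cast hrow.trans
    (Finset.le_sup (f := fun i => ∑ k, ‖A i k‖₊) (Finset.mem_univ i))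

theorem norm_le_of_entry_le {A : Matrix ι ι R} {c : ℝ} (hc : 0 ≤ c) (h : ∀ i j, ‖A i j‖ ≤ c) :
    ‖A‖ ≤ Fintype.card ι * c := by
  lift c to NNReal using hc
  rw [linfty_opNorm_def]
  have hrow : (Finset.univ.sup fun i => ∑ k, ‖A i k‖₊) ≤ Fintype.card ι * c :=
    Finset.sup_le fun i _ => (Finset.sum_le_card_nsmul _ _ c fun k _ => h i k).trans_eq (by simp)
  exact_mod_cast hrow

end MatrixNorm

theorem matLog_eq (M : Matrix (Fin 2) (Fin 2) ℂ) : matLog M = logOneAdd (M - 1) := rfl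

section Conjugation

variable {ι : Type*} [Fintype ι] [DecidableEq ι] {N : Matrix ι ι ℂ}

theorem logOneAdd_conjTranspose (hN : ‖N‖ < 1) : logOneAdd Nᴴ = (logOneAdd N)ᴴ := by
  refine (map_logOneAdd (conjTransposeAddEquiv ι ι ℂ).toAddMonoidHom
    continuous_id.matrix_conjTranspose hN fun k => ?_).symm
  change (_ • _)ᴴ = _ • (Nᴴ) ^ (k + 1)
  rw [conjTranspose_smul, conjTranspose_pow]
  simp

theorem logOneAdd_map_conj (hN : ‖N‖ < 1) : logOneAdd (N.map conj) = (logOneAdd N).map conj := by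
  refine (map_logOneAdd ((starRingEnd ℂ).mapMatrix : Matrix ι ι ℂ →+* _).toAddMonoidHom
    (continuous_id.matrix_map Complex.continuous_conj) hN fun k => ?_).symm
  change (starRingEnd ℂ).mapMatrix _ = _ • ((starRingEnd ℂ).mapMatrix N) ^ (k + 1)
  rw [← map_pow]
  ext i j
  simp

end Conjugation

section TwoByTwo

/-- The adjugate of a two by two matrix, as an additive map. -/
def adjugateAddHom : Matrix (Fin 2) (Fin 2) ℂ →+ Matrix (Fin 2) (Fin 2) ℂ where
  toFun := adjugate
  map_zero' := adjugate_zero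
  map_add' A B := by
    ext i j
    fin_cases i <;> fin_cases j <;> simp [adjugate_fin_two, add_comm]

variable {M M' N : Matrix (Fin 2) (Fin 2) ℂ}

theorem adjugate_one_add (N : Matrix (Fin 2) (Fin 2) ℂ) : adjugate (1 + N) = 1 + adjugate N :=
  (map_add adjugateAddHom 1 N).trans (congrArg (· + adjugate N) adjugate_one)

theorem logOneAdd_adjugate (hN : ‖N‖ < 1) : logOneAdd (adjugate N) = adjugate (logOneAdd N) := by
  refine (map_logOneAdd adjugateAddHom continuous_id.matrix_adjugate hN fun k => ?_).symm
  change adjugate _ = _ • adjugate N ^ (k + 1)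
  rw [adjugate_smul, adjugate_pow, Fintype.card_fin, pow_one]

theorem norm_conjTranspose_le (N : Matrix (Fin 2) (Fin 2) ℂ) : ‖Nᴴ‖ ≤ 2 * ‖N‖ :=
  norm_le_of_entry_le (norm_nonneg N) fun i j => by
    rw [conjTranspose_apply, norm_star]
    exact norm_entry_le N j i

theorem norm_adjugate_le (N : Matrix (Fin 2) (Fin 2) ℂ) : ‖adjugate N‖ ≤ 2 * ‖N‖ :=
  norm_le_of_entry_le (norm_nonneg N) fun i j => by
    have hentry := norm_entry_le N
    rw [adjugate_fin_two]
    fin_cases i <;> fin_cases j <;> simpa using hentry _ _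

theorem exists_eigenvalues (N : Matrix (Fin 2) (Fin 2) ℂ) :
    ∃ α β : ℂ, α + β = N.trace ∧ α * β = N.det ∧ ‖α‖ ≤ ‖N‖ ∧ ‖β‖ ≤ ‖N‖ := by
  have hcard : N.charpoly.roots.card = 2 := by
    rw [← (IsAlgClosed.splits N.charpoly).natDegree_eq_card_roots, charpoly_natDegree_eq_dim,
      Fintype.card_fin]
  obtain ⟨α, β, hroots⟩ := Multiset.card_eq_two.1 hcard
  have hnorm : ∀ z ∈ N.charpoly.roots, ‖z‖ ≤ ‖N‖ := fun z hz =>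
    spectrum.norm_le_norm_of_mem
      (mem_spectrum_iff_isRoot_charpoly.2 (Polynomial.isRoot_of_mem_roots hz))
  refine ⟨α, β, ?_, ?_, hnorm α (by simp [hroots]), hnorm β (by simp [hroots])⟩
  · simp [trace_eq_sum_roots_charpoly, hroots]
  · simp [det_eq_prod_roots_charpoly, hroots]

theorem trace_pow_succ_eq {α β : ℂ} (htrace : α + β = N.trace) (hdet : α * β = N.det) (k : ℕ) :
    (N ^ (k + 1)).trace = α ^ (k + 1) + β ^ (k + 1) := by
  have hcayley : N * N = (α + β) • N - (α * β) • (1 : Matrix (Fin 2) (Fin 2) ℂ) := by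
    rw [htrace, hdet, trace_fin_two, det_fin_two]
    ext i j
    fin_cases i <;> fin_cases j <;> simp [mul_apply, Fin.sum_univ_two] <;> ring
  induction k using Nat.twoStepInduction with
  | zero => simp [htrace]
  | one =>
    rw [one_add_one_eq_two, pow_two, hcayley, trace_sub, trace_smul, trace_smul,
      trace_one, ← htrace, Fintype.card_fin]
    simp only [smul_eq_mul]
    push_cast
    ring
  | more k ih ih' =>
    rw [pow_succ, pow_succ, mul_assoc, hcayley, mul_sub, Matrix.mul_smul, Matrix.mul_smul,
      ← pow_succ, mul_one, trace_sub, trace_smul, trace_smul, ih, ih']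
    simp only [smul_eq_mul]
    ring

theorem hasSum_log_one_add {α : ℂ} (hα : ‖α‖ < 1) :
    HasSum (fun k : ℕ => ((-1) ^ k / (k + 1) : ℂ) * α ^ (k + 1)) (Complex.log (1 + α)) := by
  have htail := (hasSum_nat_add_iff' 1).2 (Complex.hasSum_taylorSeries_log hα)
  rw [Finset.sum_range_one, Nat.cast_zero, div_zero, sub_zero] at htail
  refine htail.congr_fun fun k => ?_
  push_cast
  ring

theorem exp_trace_logOneAdd (hN : ‖N‖ < 1) : exp (logOneAdd N).trace = (1 + N).det := by
  obtain ⟨α, β, htrace, hdet, hα, hβ⟩ := exists_eigenvalues N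
  have hsum : HasSum (fun k : ℕ => ((-1) ^ k / (k + 1) : ℂ) * (N ^ (k + 1)).trace)
      (logOneAdd N).trace :=
    ((summable_logOneAdd hN).hasSum.map (traceAddMonoidHom (Fin 2) ℂ)
      continuous_id.matrix_trace).congr_fun fun k =>
        (trace_smul ((-1) ^ k / (k + 1) : ℂ) (N ^ (k + 1))).symm
  have hlog : (logOneAdd N).trace = log (1 + α) + log (1 + β) := by
    refine hsum.unique (((hasSum_log_one_add (hα.trans_lt hN)).add
      (hasSum_log_one_add (hβ.trans_lt hN))).congr_fun fun k => ?_)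
    rw [trace_pow_succ_eq htrace hdet, mul_add]
  have hne : ∀ z : ℂ, ‖z‖ ≤ ‖N‖ → 1 + z ≠ 0 := fun z hz hzero => by
    rw [eq_neg_of_add_eq_zero_right hzero, norm_neg, norm_one] at hz
    exact hz.not_gt hN
  rw [hlog, exp_add, exp_log (hne α hα), exp_log (hne β hβ)]
  rw [trace_fin_two] at htrace
  rw [det_fin_two] at hdet ⊢
  simp only [Matrix.add_apply, one_apply_eq, ne_eq, zero_ne_one, one_ne_zero, not_false_eq_true,
    one_apply_ne, zero_add]
  linear_combination htrace + hdet

theorem trace_logOneAdd_eq_zero (hN : ‖N‖ ≤ 1 / 2) (hdet : (1 + N).det = 1) :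
    (logOneAdd N).trace = 0 := by
  have hsmall : ‖logOneAdd N‖ ≤ 1 := by
    have hlip := norm_logOneAdd_sub_le (by norm_num) hN (norm_zero.trans_le (by norm_num))
    rw [logOneAdd_zero, sub_zero, sub_zero] at hlip
    linarith [norm_le_norm_add_norm_sub' (logOneAdd N) N]
  have htrace : ‖(logOneAdd N).trace‖ ≤ 2 := by
    rw [trace_fin_two]
    linarith [norm_add_le (logOneAdd N 0 0) (logOneAdd N 1 1), norm_entry_le (logOneAdd N) 0 0,
      norm_entry_le (logOneAdd N) 1 1]
  have hexp := exp_trace_logOneAdd (hN.trans_lt (by norm_num))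
  rw [hdet, exp_eq_one_iff] at hexp
  obtain ⟨n, hn⟩ := hexp
  have hlt : |(n : ℝ)| < 1 := by
    rw [hn] at htrace
    simp only [norm_mul, norm_intCast, norm_ofNat, norm_I, norm_real, mul_one, Real.norm_eq_abs,
      abs_of_pos Real.pi_pos] at htrace
    nlinarith [Real.pi_gt_three, abs_nonneg (n : ℝ)]
  have hn0 : n = 0 := Int.abs_lt_one_iff.1 (by exact_mod_cast hlt)
  rw [hn, hn0, Int.cast_zero, zero_mul]

theorem logOneAdd_adjugate_eq_neg (hN : ‖N‖ ≤ 1 / 2) (hdet : (1 + N).det = 1) :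
    logOneAdd (adjugate N) = -logOneAdd N := by
  have htrace := trace_logOneAdd_eq_zero hN hdet
  rw [trace_fin_two] at htrace
  rw [logOneAdd_adjugate (hN.trans_lt (by norm_num)), adjugate_fin_two]
  ext i j
  fin_cases i <;> fin_cases j <;> simp
  · linear_combination htrace
  · linear_combination htrace

theorem mem_specialUnitaryGroup_iff_conjTranspose_eq (hdet : M.det = 1) :
    M ∈ specialUnitaryGroup (Fin 2) ℂ ↔ Mᴴ = adjugate M := by
  rw [mem_specialUnitaryGroup_iff, mem_unitaryGroup_iff', star_eq_conjTranspose]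
  constructor
  · rintro ⟨hunitary, -⟩
    calc Mᴴ = Mᴴ * (M * adjugate M) := by rw [mul_adjugate, hdet, one_smul, mul_one]
      _ = adjugate M := by rw [← mul_assoc, hunitary, one_mul]
  · intro h
    exact ⟨by rw [h, adjugate_mul, hdet, one_smul], hdet⟩

theorem mem_specialUnitaryGroup_iff_matLog (hM : ‖M - 1‖ < 1 / 4) (hdet : M.det = 1) :
    M ∈ specialUnitaryGroup (Fin 2) ℂ ↔ (matLog M)ᴴ = -matLog M := by
  obtain ⟨N, rfl⟩ : ∃ N, M = 1 + N := ⟨M - 1, by simp⟩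
  rw [add_sub_cancel_left] at hM
  rw [mem_specialUnitaryGroup_iff_conjTranspose_eq hdet, adjugate_one_add, conjTranspose_add,
    conjTranspose_one, add_right_inj, matLog_eq, add_sub_cancel_left,
    ← logOneAdd_conjTranspose (hM.trans (by norm_num)),
    ← logOneAdd_adjugate_eq_neg (by linarith) hdet]
  refine (injOn_logOneAdd.eq_iff ?_ ?_).symm <;> rw [mem_ball_zero_iff]
  · linarith [norm_conjTranspose_le N]
  · linarith [norm_adjugate_le N]

/-- The matrix `diag (1, -1)`: a matrix is diagonal if and only if it commutes with it. -/
def signDiag : (Matrix (Fin 2) (Fin 2) ℂ)ˣ where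
  val := !![1, 0; 0, -1]
  inv := !![1, 0; 0, -1]
  val_inv := by simp [one_fin_two]
  inv_val := by simp [one_fin_two]

theorem signDiag_conj (A : Matrix (Fin 2) (Fin 2) ℂ) :
    (signDiag : Matrix (Fin 2) (Fin 2) ℂ) * A * (↑signDiag⁻¹ : Matrix (Fin 2) (Fin 2) ℂ) =
      !![A 0 0, -A 0 1; -A 1 0, A 1 1] := by
  change !![1, 0; 0, -1] * A * !![1, 0; 0, -1] = _
  ext i j
  simp only [mul_apply, Fin.sum_univ_two]
  fin_cases i <;> fin_cases j <;> simp

theorem norm_signDiag_conj_le (A : Matrix (Fin 2) (Fin 2) ℂ) :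
    ‖(signDiag : Matrix (Fin 2) (Fin 2) ℂ) * A * (↑signDiag⁻¹ : Matrix (Fin 2) (Fin 2) ℂ)‖ ≤
      2 * ‖A‖ := by
  rw [signDiag_conj]
  refine norm_le_of_entry_le (norm_nonneg _) fun i j => ?_
  have hentry := norm_entry_le A
  fin_cases i <;> fin_cases j <;> simpa using hentry _ _

theorem signDiag_conj_eq_self_iff (A : Matrix (Fin 2) (Fin 2) ℂ) :
    (signDiag : Matrix (Fin 2) (Fin 2) ℂ) * A * (↑signDiag⁻¹ : Matrix (Fin 2) (Fin 2) ℂ) = A ↔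
      A 0 1 = 0 ∧ A 1 0 = 0 := by
  rw [signDiag_conj, ← Matrix.ext_iff]
  simp [Fin.forall_fin_two, neg_eq_self]

theorem isDiag_fin_two_iff {R : Type*} [Zero R] (A : Matrix (Fin 2) (Fin 2) R) :
    A.IsDiag ↔ A 0 1 = 0 ∧ A 1 0 = 0 := by
  simp [IsDiag, Pairwise, Fin.forall_fin_two]

theorem isDiag_iff_matLog (hM : ‖M - 1‖ < 1 / 4) :
    M.IsDiag ↔ matLog M 0 1 = 0 ∧ matLog M 1 0 = 0 := by
  have hdiag : M.IsDiag ↔ (M - 1) 0 1 = 0 ∧ (M - 1) 1 0 = 0 := by simp [isDiag_fin_two_iff]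
  rw [hdiag, ← signDiag_conj_eq_self_iff, ← signDiag_conj_eq_self_iff, matLog_eq,
    ← logOneAdd_units_conj _ (hM.trans (by norm_num))]
  refine (injOn_logOneAdd.eq_iff ?_ ?_).symm <;> rw [mem_ball_zero_iff]
  · linarith [norm_signDiag_conj_le (M - 1)]
  · linarith

theorem map_conj_matLog (hM : ‖M - 1‖ < 1 / 4) (hM' : ‖M' - 1‖ < 1 / 4) (hdet : M.det = 1)
    (h : M'.map conj = adjugate M) : (matLog M').map conj = -matLog M := by
  obtain ⟨N, rfl⟩ : ∃ N, M = 1 + N := ⟨M - 1, by simp⟩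
  obtain ⟨N', rfl⟩ : ∃ N', M' = 1 + N' := ⟨M' - 1, by simp⟩
  rw [add_sub_cancel_left] at hM hM'
  have hone : (1 + N').map conj = 1 + N'.map conj := by
    rw [Matrix.map_add _ (map_add _), Matrix.map_one _ (map_zero _) (map_one _)]
  rw [hone, adjugate_one_add, add_right_inj] at h
  rw [matLog_eq, matLog_eq, add_sub_cancel_left, add_sub_cancel_left,
    ← logOneAdd_map_conj (hM'.trans (by norm_num)), h,
    ← logOneAdd_adjugate_eq_neg (by linarith) hdet]

end TwoByTwo

end MatrixLog

section LinearODE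

open Matrix

variable {B X Z : ℝ → Matrix (Fin 2) (Fin 2) ℂ}

/-- `X` solves `X' = X B` on `[0, 1]`, entry by entry. -/
def IsSol (B X : ℝ → Matrix (Fin 2) (Fin 2) ℂ) : Prop :=
  ∀ s ∈ Icc (0 : ℝ) 1, ∀ i k : Fin 2,
    HasDerivWithinAt (fun u => X u i k) ((X s * B s) i k) (Icc 0 1) s

theorem IsSol.hasDerivWithinAt_mul_adjugate (hX : IsSol B X) (hZ : IsSol B Z) {s : ℝ}
    (hs : s ∈ Icc (0 : ℝ) 1) (htrace : (B s).trace = 0) (i k : Fin 2) :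
    HasDerivWithinAt (fun u => (Z u * adjugate (X u)) i k) 0 (Icc 0 1) s := by
  rw [trace_fin_two] at htrace
  have hZi := hZ s hs i
  have hXs := hX s hs
  simp only [mul_apply, Fin.sum_univ_two] at hZi hXs
  simp only [adjugate_fin_two, mul_apply, Fin.sum_univ_two]
  fin_cases k
  · simp only [Fin.zero_eta, of_apply, cons_val', cons_val_zero, cons_val_one, cons_val_fin_one]
    refine (((hZi 0).mul (hXs 1 1)).add ((hZi 1).mul (hXs 1 0).neg)).congr_deriv ?_
    simp only [Pi.neg_apply]
    linear_combination (Z s i 0 * X s 1 1 - Z s i 1 * X s 1 0) * htrace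
  · simp only [Fin.mk_one, of_apply, cons_val', cons_val_zero, cons_val_one, cons_val_fin_one]
    refine (((hZi 0).mul (hXs 0 1).neg).add ((hZi 1).mul (hXs 0 0))).congr_deriv ?_
    simp only [Pi.neg_apply]
    linear_combination (Z s i 1 * X s 0 0 - Z s i 0 * X s 0 1) * htrace

theorem IsSol.mul_adjugate_eq (hX : IsSol B X) (hZ : IsSol B Z)
    (htrace : ∀ s ∈ Icc (0 : ℝ) 1, (B s).trace = 0) :
    Z 1 * adjugate (X 1) = Z 0 * adjugate (X 0) := by
  have hderiv := fun s hs => hX.hasDerivWithinAt_mul_adjugate hZ hs (htrace s hs)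
  ext i k
  refine constant_of_derivWithin_zero (f := fun u => (Z u * adjugate (X u)) i k)
    (fun s hs => (hderiv s hs i k).differentiableWithinAt) (fun s hs => ?_) 1
    (right_mem_Icc.2 zero_le_one)
  have hs' := Ico_subset_Icc_self hs
  exact (hderiv s hs' i k).derivWithin (uniqueDiffOn_Icc zero_lt_one s hs')

theorem IsSol.det_eq_one (hX : IsSol B X) (htrace : ∀ s ∈ Icc (0 : ℝ) 1, (B s).trace = 0)
    (hX0 : X 0 = 1) : (X 1).det = 1 := by
  have h := hX.mul_adjugate_eq hX htrace
  rw [hX0, adjugate_one, mul_one, mul_adjugate] at h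
  simpa using congrFun₂ h 0 0

theorem IsSol.eq_of_eq (hX : IsSol B X) (hZ : IsSol B Z)
    (htrace : ∀ s ∈ Icc (0 : ℝ) 1, (B s).trace = 0) (hX0 : X 0 = 1) (hZ0 : Z 0 = 1) :
    Z 1 = X 1 := by
  have h := hX.mul_adjugate_eq hZ htrace
  rw [hX0, hZ0, adjugate_one, mul_one] at h
  calc Z 1 = Z 1 * (adjugate (X 1) * X 1) := by
        rw [adjugate_mul, hX.det_eq_one htrace hX0, one_smul, mul_one]
    _ = X 1 := by rw [← mul_assoc, h, one_mul]

theorem IsSol.conj_matrix (hX : IsSol B X) {P Q : Matrix (Fin 2) (Fin 2) ℂ} (hPQ : P * Q = 1) :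
    IsSol (fun s => Q * B s * P) (fun s => Q * X s * P) := by
  intro s hs i k
  have hcancel : Q * X s * P * (Q * B s * P) = Q * (X s * B s) * P := by
    simp only [mul_assoc]
    rw [← mul_assoc P Q, hPQ, one_mul]
  rw [hcancel]
  simp only [Matrix.mul_apply (M := Q), Matrix.mul_apply (N := P)]
  exact .fun_sum fun l _ => (HasDerivWithinAt.fun_sum fun l' _ =>
    (hX s hs l' l).const_mul (Q i l')).mul_const (P l k)

theorem IsSol.map_conj_reverse (hX : IsSol B X) :
    IsSol (fun s => -(B (1 - s)).map conj) (fun s => (X (1 - s)).map conj) := by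
  intro s hs i k
  have hs' : 1 - s ∈ Icc (0 : ℝ) 1 := ⟨by linarith [hs.2], by linarith [hs.1]⟩
  have hreflect : HasDerivWithinAt (fun u : ℝ => 1 - u) (-1) (Icc 0 1) s := by
    simpa using ((hasDerivAt_id s).const_sub 1).hasDerivWithinAt
  refine ((hX (1 - s) hs' i k).star.scomp s hreflect
    fun u hu => ⟨by linarith [hu.2], by linarith [hu.1]⟩).congr_deriv ?_
  rw [mul_neg, ← Matrix.map_mul, neg_one_smul]
  rfl

end LinearODE

theorem integral_logDeriv_eq_log_sub_log {f f' : ℝ → ℂ} {a b : ℝ} {c : ℂ}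
    (hderiv : ∀ s ∈ uIcc a b, HasDerivAt f (f' s) s)
    (hint : IntervalIntegrable (fun s => f' s / f s) MeasureTheory.volume a b)
    (hslit : ∀ s ∈ uIcc a b, c * f s ∈ slitPlane) :
    ∫ s in a..b, f' s / f s = log (c * f b) - log (c * f a) := by
  refine intervalIntegral.integral_eq_sub_of_hasDerivAt (f := fun s => log (c * f s))
    (fun s hs => ?_) hint
  refine (((hderiv s hs).const_mul c).clog_real (hslit s hs)).congr_deriv ?_
  exact mul_div_mul_left _ _ (left_ne_zero_of_mul (slitPlane_ne_zero (hslit s hs)))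

theorem nn_pos (m : ℕ) : (0 : ℝ) < nn m := by
  rw [nn]
  positivity

theorem nn_ne_zero (m : ℕ) : (nn m : ℂ) ≠ 0 := mod_cast (nn_pos m).ne'

theorem two_le_nn (m : ℕ) : (2 : ℝ) ≤ nn m := by
  rw [nn]
  exact_mod_cast Nat.le_add_left 2 (2 * m)

theorem p_zero (m : ℕ) : p m 0 = 1 := by simp [p]

theorem p_succ (m j : ℕ) : p m (j + 1) = p m 1 * p m j := by
  rw [p, p, p, ← exp_add]
  congr 1
  push_cast
  ring

theorem p_ne_zero (m j : ℕ) : p m j ≠ 0 := exp_ne_zero _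

theorem p_nn (m : ℕ) : p m (nn m) = 1 := by
  rw [p, mul_div_assoc, div_self (nn_ne_zero m), mul_one, exp_two_pi_mul_I]

theorem γ_eq (m j : ℕ) (s : ℝ) : γ m j s = p m j * γ m 0 s := by
  rw [γ, γ, p_zero]
  ring

theorem γ_succ (m j : ℕ) (s : ℝ) : γ m (j + 1) s = p m 1 * γ m j s := by
  rw [γ_eq, γ_eq m j, p_succ, mul_assoc]

theorem γ_at_zero (m j : ℕ) : γ m j 0 = 0 := by simp [γ]

theorem γ_at_one (m j : ℕ) : γ m j 1 = 0 := by simp [γ]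

theorem γ_at_half (m : ℕ) : γ m 0 (1 / 2) = 2 := by
  simp [γ, p_zero, ← div_eq_mul_inv]

theorem contDiff_γ (m j : ℕ) : ContDiff ℝ 1 (γ m j) := by
  unfold γ
  have hcoe : ContDiff ℝ 1 fun s : ℝ => (s : ℂ) := ofRealCLM.contDiff
  have hsin : ContDiff ℝ 1 fun s : ℝ => ((Real.sin (Real.pi * s) : ℝ) : ℂ) :=
    ofRealCLM.contDiff.comp (Real.contDiff_sin.comp (contDiff_const.mul contDiff_id))
  have hexponent : ContDiff ℝ 1 fun s : ℝ => I * Real.pi * (2 * (s : ℂ) - 1) / nn m :=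
    (contDiff_const.mul ((contDiff_const.mul hcoe).sub contDiff_const)).div_const _
  exact (contDiff_const.mul (contDiff_const.mul hsin)).mul hexponent.cexp

theorem hasDerivAt_γ (m j : ℕ) (s : ℝ) : HasDerivAt (γ m j) (deriv (γ m j) s) s :=
  ((contDiff_γ m j).differentiable one_ne_zero).differentiableAt.hasDerivAt

theorem continuous_γ (m j : ℕ) : Continuous (γ m j) := (contDiff_γ m j).continuous

theorem continuous_deriv_γ (m j : ℕ) : Continuous (deriv (γ m j)) :=
  (contDiff_γ m j).continuous_deriv le_rfl

theorem deriv_γ_succ (m j : ℕ) (s : ℝ) : deriv (γ m (j + 1)) s = p m 1 * deriv (γ m j) s := by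
  rw [funext (γ_succ m j)]
  exact ((hasDerivAt_γ m j s).const_mul _).deriv

theorem conj_γ (m : ℕ) (s : ℝ) : conj (γ m 0 s) = γ m 0 (1 - s) := by
  rw [γ, γ, p_zero, mul_one_sub, Real.sin_pi_sub, map_mul, map_mul, map_mul, ← exp_conj, map_div₀,
    map_mul, map_mul, conj_I]
  simp only [map_one, map_ofNat, conj_ofReal, map_sub, map_mul, map_natCast]
  congr 2
  push_cast
  ring

theorem conj_deriv_γ (m : ℕ) (s : ℝ) : conj (deriv (γ m 0) s) = -deriv (γ m 0) (1 - s) := by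
  have hconj : HasDerivAt (fun u => conj (γ m 0 u)) (conj (deriv (γ m 0) s)) s :=
    (hasDerivAt_γ m 0 s).star
  have hreverse : HasDerivAt (fun u : ℝ => γ m 0 (1 - u)) (-deriv (γ m 0) (1 - s)) s := by
    simpa [Function.comp_def] using
      (hasDerivAt_γ m 0 (1 - s)).scomp s ((hasDerivAt_id s).const_sub 1)
  simp only [conj_γ] at hconj
  exact hconj.unique hreverse

theorem γ_div_p_eq (m j : ℕ) (s : ℝ) : γ m 0 s / p m j =
    (2 * Real.sin (Real.pi * s) : ℝ) *
      exp ((Real.pi / nn m * (2 * s - 1 - 2 * j) : ℝ) * I) := by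
  rw [γ, p_zero, p, one_mul, div_eq_mul_inv, ← exp_neg, mul_assoc, ← exp_add]
  push_cast
  congr 2
  have := nn_ne_zero m
  field_simp
  ring

theorem re_γ_div_p (m j : ℕ) (s : ℝ) : (γ m 0 s / p m j).re =
    2 * Real.sin (Real.pi * s) * Real.cos (Real.pi / nn m * (2 * s - 1 - 2 * j)) := by
  rw [γ_div_p_eq, re_ofReal_mul, exp_ofReal_mul_I_re]

theorem im_γ_div_p (m j : ℕ) (s : ℝ) : (γ m 0 s / p m j).im =
    2 * Real.sin (Real.pi * s) * Real.sin (Real.pi / nn m * (2 * s - 1 - 2 * j)) := by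
  rw [γ_div_p_eq, im_ofReal_mul, exp_ofReal_mul_I_im]

theorem im_γ (m : ℕ) (s : ℝ) : (γ m 0 s).im =
    2 * Real.sin (Real.pi * s) * Real.sin (Real.pi / nn m * (2 * s - 1)) := by
  simpa [p_zero] using im_γ_div_p m 0 s

theorem sin_pi_mul_nonneg {s : ℝ} (hs : s ∈ Icc (0 : ℝ) 1) : 0 ≤ Real.sin (Real.pi * s) :=
  Real.sin_nonneg_of_nonneg_of_le_pi (mul_nonneg Real.pi_pos.le hs.1)
    (mul_le_of_le_one_right Real.pi_pos.le hs.2)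

-- The argument of `γ₀ / p_j` stays in `(-2π, 0)`, so on the real axis it can only be `-π`.
theorem one_sub_γ_div_p_mem_slitPlane {m j : ℕ} (hj : j ≠ 0) (hjn : j < nn m) {s : ℝ}
    (hs : s ∈ Icc (0 : ℝ) 1) : 1 - γ m 0 s / p m j ∈ slitPlane := by
  rw [mem_slitPlane_iff]
  by_contra! h
  obtain ⟨hre, him⟩ := h
  rw [sub_re, one_re, re_γ_div_p] at hre
  rw [sub_im, one_im, zero_sub, neg_eq_zero, im_γ_div_p] at him
  set θ : ℝ := Real.pi / nn m * (2 * s - 1 - 2 * j)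
  rcases mul_eq_zero.1 him with hsin | hsin
  · rw [hsin] at hre
    linarith
  have hn := nn_pos m
  have hj_ge : (1 : ℝ) ≤ j := mod_cast Nat.one_le_iff_ne_zero.2 hj
  have hj_le : (j : ℝ) + 1 ≤ nn m := mod_cast hjn
  have hθ_neg : θ < 0 := mul_neg_of_pos_of_neg (div_pos Real.pi_pos hn) (by linarith [hs.2])
  have hθ_gt : -(2 * Real.pi) < θ := by
    calc -(2 * Real.pi) = Real.pi / nn m * -(2 * nn m) := by field_simp
      _ < θ := mul_lt_mul_of_pos_left (by linarith [hs.1]) (div_pos Real.pi_pos hn)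
  have hθ : θ + Real.pi = 0 := by
    refine (Real.sin_eq_zero_iff_of_lt_of_lt (by linarith) (by linarith)).1 ?_
    rw [Real.sin_add_pi, hsin, neg_zero]
  rw [eq_neg_of_add_eq_zero_left hθ, Real.cos_neg, Real.cos_pi] at hre
  linarith [sin_pi_mul_nonneg hs]

theorem pi_div_nn_mul_mem_Icc (m : ℕ) {s : ℝ} (hs : s ∈ Icc (0 : ℝ) 1) :
    Real.pi / nn m * (2 * s - 1) ∈ Icc (-(Real.pi / 2)) (Real.pi / 2) := by
  rw [mem_Icc, ← abs_le, abs_mul, abs_of_pos (div_pos Real.pi_pos (nn_pos m)),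
    ← mul_one (Real.pi / 2)]
  have habs : |2 * s - 1| ≤ 1 := abs_le.2 ⟨by linarith [hs.1], by linarith [hs.2]⟩
  refine mul_le_mul ?_ habs (abs_nonneg _) Real.pi_div_two_pos.le
  exact div_le_div_of_nonneg_left Real.pi_pos.le two_pos (two_le_nn m)

theorem γ_eq_zero_or_two {m : ℕ} {s : ℝ} (hs : s ∈ Icc (0 : ℝ) 1) (him : (γ m 0 s).im = 0) :
    γ m 0 s = 0 ∨ γ m 0 s = 2 := by
  rw [im_γ] at him
  rcases mul_eq_zero.1 him with hsin | hsin
  · left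
    have : Real.sin (Real.pi * s) = 0 := by linarith
    simp [γ, this]
  · right
    obtain ⟨hθ_ge, hθ_le⟩ := pi_div_nn_mul_mem_Icc m hs
    have hθ := (Real.sin_eq_zero_iff_of_lt_of_lt (by linarith [Real.pi_pos])
      (by linarith [Real.pi_pos])).1 hsin
    have hs_half : 2 * s - 1 = 0 :=
      (mul_eq_zero.1 hθ).resolve_left (div_pos Real.pi_pos (nn_pos m)).ne'
    rw [show s = 1 / 2 by linarith, γ_at_half]

theorem im_γ_nonpos {m : ℕ} {s : ℝ} (hs : s ∈ Icc (0 : ℝ) (1 / 2)) : (γ m 0 s).im ≤ 0 := by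
  have hs' : s ∈ Icc (0 : ℝ) 1 := ⟨hs.1, hs.2.trans (by norm_num)⟩
  rw [im_γ]
  refine mul_nonpos_of_nonneg_of_nonpos (mul_nonneg two_pos.le (sin_pi_mul_nonneg hs')) ?_
  refine Real.sin_nonpos_of_nonpos_of_neg_pi_le ?_ ?_
  · exact mul_nonpos_of_nonneg_of_nonpos (div_pos Real.pi_pos (nn_pos m)).le (by linarith [hs.2])
  · linarith [(pi_div_nn_mul_mem_Icc m hs').1, Real.pi_pos]

theorem γ_sub_p_ne_zero {m j : ℕ} (hj : j < nn m) {s : ℝ} (hs : s ∈ Icc (0 : ℝ) 1) :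
    γ m 0 s - p m j ≠ 0 := by
  intro h
  rw [sub_eq_zero] at h
  rcases eq_or_ne j 0 with rfl | hj0
  · rw [p_zero] at h
    rcases γ_eq_zero_or_two hs (by rw [h, one_im]) with h' | h' <;> rw [h'] at h <;> norm_num at h
  · have hslit := one_sub_γ_div_p_mem_slitPlane hj0 hj hs
    rw [h, div_self (p_ne_zero m j), sub_self] at hslit
    exact zero_notMem_slitPlane hslit

theorem I_mul_γ_sub_one_mem_slitPlane {m : ℕ} {s : ℝ} (hs : s ∈ Icc (0 : ℝ) (1 / 2)) :
    I * (γ m 0 s - 1) ∈ slitPlane := by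
  rw [mem_slitPlane_iff]
  by_contra! h
  obtain ⟨hre, him⟩ := h
  rw [I_mul_re, sub_im, one_im, sub_zero] at hre
  rw [I_mul_im, sub_re, one_re] at him
  rcases γ_eq_zero_or_two ⟨hs.1, hs.2.trans (by norm_num)⟩
    (le_antisymm (im_γ_nonpos hs) (by linarith)) with h | h <;> rw [h] at him <;> norm_num at him

theorem neg_I_mul_γ_sub_one_mem_slitPlane {m : ℕ} {s : ℝ} (hs : s ∈ Icc (1 / 2 : ℝ) 1) :
    -I * (γ m 0 s - 1) ∈ slitPlane := by
  have hreflect : -I * (γ m 0 s - 1) = conj (I * (γ m 0 (1 - s) - 1)) := by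
    rw [map_mul, conj_I, map_sub, conj_γ, sub_sub_cancel, map_one]
  have hmem : I * (γ m 0 (1 - s) - 1) ∈ slitPlane :=
    I_mul_γ_sub_one_mem_slitPlane ⟨by linarith [hs.2], by linarith [hs.1]⟩
  rw [mem_slitPlane_iff] at hmem ⊢
  rwa [hreflect, conj_re, conj_im, neg_ne_zero]

/-- The pull-back of the form `z ^ k dz / (z - p_j)` along `γ_0`. -/
def loopKernel (m j k : ℕ) (s : ℝ) : ℂ :=
  deriv (γ m 0) s * (γ m 0 s ^ k / (γ m 0 s - p m j))

theorem continuousOn_loopKernel {m j : ℕ} (hj : j < nn m) (k : ℕ) :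
    ContinuousOn (loopKernel m j k) (Icc 0 1) :=
  (continuous_deriv_γ m 0).continuousOn.mul
    (((continuous_γ m 0).pow k).continuousOn.div
      ((continuous_γ m 0).sub continuous_const).continuousOn fun _ hs => γ_sub_p_ne_zero hj hs)

theorem intervalIntegrable_loopKernel {m j : ℕ} (hj : j < nn m) (k : ℕ) {a b : ℝ}
    (hab : uIcc a b ⊆ Icc 0 1) :
    IntervalIntegrable (loopKernel m j k) MeasureTheory.volume a b :=
  ((continuousOn_loopKernel hj k).mono hab).intervalIntegrable

theorem integral_loopKernel_eq_log_sub_log {m j : ℕ} (hj : j < nn m) {a b : ℝ}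
    (hab : uIcc a b ⊆ Icc 0 1) {c : ℂ}
    (hslit : ∀ s ∈ uIcc a b, c * (γ m 0 s - p m j) ∈ slitPlane) :
    ∫ s in a..b, loopKernel m j 0 s =
      log (c * (γ m 0 b - p m j)) - log (c * (γ m 0 a - p m j)) := by
  have hkernel : loopKernel m j 0 = fun s => deriv (γ m 0) s / (γ m 0 s - p m j) := by
    funext s
    rw [loopKernel, pow_zero, mul_one_div]
  rw [← integral_logDeriv_eq_log_sub_log (fun s _ => (hasDerivAt_γ m 0 s).sub_const _)
    (hkernel ▸ intervalIntegrable_loopKernel hj 0 hab) hslit, hkernel]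

-- The loop is cut at `z = 2`; on each half `log (± i (z - 1))` is a primitive.
theorem integral_loopKernel_zero_zero (m : ℕ) :
    ∫ s in (0 : ℝ)..1, loopKernel m 0 0 s = 2 * Real.pi * I := by
  have hn : 0 < nn m := Nat.succ_pos _
  have hleft : uIcc (0 : ℝ) (1 / 2) = Icc 0 (1 / 2) := uIcc_of_le (by norm_num)
  have hright : uIcc (1 / 2 : ℝ) 1 = Icc (1 / 2) 1 := uIcc_of_le (by norm_num)
  have hleft_sub : uIcc (0 : ℝ) (1 / 2) ⊆ Icc 0 1 :=
    hleft ▸ Icc_subset_Icc le_rfl (by norm_num)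
  have hright_sub : uIcc (1 / 2 : ℝ) 1 ⊆ Icc 0 1 :=
    hright ▸ Icc_subset_Icc (by norm_num) le_rfl
  rw [← intervalIntegral.integral_add_adjacent_intervals
      (intervalIntegrable_loopKernel hn 0 hleft_sub)
      (intervalIntegrable_loopKernel hn 0 hright_sub),
    integral_loopKernel_eq_log_sub_log (c := I) hn hleft_sub fun s hs => by
      rw [p_zero]
      exact I_mul_γ_sub_one_mem_slitPlane (hleft ▸ hs),
    integral_loopKernel_eq_log_sub_log (c := -I) hn hright_sub fun s hs => by
      rw [p_zero]
      exact neg_I_mul_γ_sub_one_mem_slitPlane (hright ▸ hs),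
    γ_at_zero, γ_at_half, γ_at_one, p_zero]
  norm_num [log_I, log_neg_I]
  ring

theorem integral_loopKernel_zero_of_ne {m j : ℕ} (hj : j ≠ 0) (hjn : j < nn m) :
    ∫ s in (0 : ℝ)..1, loopKernel m j 0 s = 0 := by
  have hunit : uIcc (0 : ℝ) 1 = Icc 0 1 := uIcc_of_le zero_le_one
  rw [integral_loopKernel_eq_log_sub_log (c := -(p m j)⁻¹) hjn hunit.subset fun s hs => ?_,
    γ_at_zero, γ_at_one, sub_self]
  have hdiv : -(p m j)⁻¹ * (γ m 0 s - p m j) = 1 - γ m 0 s / p m j := by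
    have := p_ne_zero m j
    field_simp
    ring
  exact hdiv ▸ one_sub_γ_div_p_mem_slitPlane hj hjn (hunit ▸ hs)

theorem integral_deriv_γ_mul_γ_pow (m k : ℕ) :
    ∫ s in (0 : ℝ)..1, deriv (γ m 0) s * γ m 0 s ^ k = 0 := by
  have hprimitive : ∀ s ∈ uIcc (0 : ℝ) 1, HasDerivAt (fun u => γ m 0 u ^ (k + 1) / (k + 1))
      (deriv (γ m 0) s * γ m 0 s ^ k) s := fun s _ => by
    refine (((hasDerivAt_γ m 0 s).pow (k + 1)).div_const ((k : ℂ) + 1)).congr_deriv ?_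
    have : (k : ℂ) + 1 ≠ 0 := Nat.cast_add_one_ne_zero k
    push_cast
    field_simp
  rw [intervalIntegral.integral_eq_sub_of_hasDerivAt hprimitive, γ_at_zero, γ_at_one, sub_self]
  exact ((continuous_deriv_γ m 0).mul ((continuous_γ m 0).pow k)).intervalIntegrable _ _

theorem loopKernel_succ {m j : ℕ} (hj : j < nn m) (k : ℕ) {s : ℝ} (hs : s ∈ Icc (0 : ℝ) 1) :
    loopKernel m j (k + 1) s =
      deriv (γ m 0) s * γ m 0 s ^ k + p m j * loopKernel m j k s := by
  have := γ_sub_p_ne_zero hj hs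
  rw [loopKernel, loopKernel]
  field_simp
  ring

theorem integral_loopKernel {m j : ℕ} (hj : j < nn m) (k : ℕ) :
    ∫ s in (0 : ℝ)..1, loopKernel m j k s = if j = 0 then 2 * Real.pi * I else 0 := by
  have hunit : uIcc (0 : ℝ) 1 = Icc 0 1 := uIcc_of_le zero_le_one
  induction k with
  | zero =>
    split_ifs with hj0
    · exact hj0 ▸ integral_loopKernel_zero_zero m
    · exact integral_loopKernel_zero_of_ne hj0 hj
  | succ k ih =>
    rw [intervalIntegral.integral_congr fun s hs => loopKernel_succ hj k (hunit ▸ hs),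
      intervalIntegral.integral_add, integral_deriv_γ_mul_γ_pow,
      intervalIntegral.integral_const_mul, ih, zero_add]
    · split_ifs with hj0
      · rw [hj0, p_zero, one_mul]
      · rw [mul_zero]
    · exact ((continuous_deriv_γ m 0).mul ((continuous_γ m 0).pow k)).intervalIntegrable _ _
    · exact (intervalIntegrable_loopKernel hj k hunit.subset).const_mul _

section Symmetries

open Matrix

theorem conj_pow_eq_pow_sub {ζ : ℂ} {n j : ℕ} (hζ : ζ ^ n = 1) (hj : j ≤ n) :
    conj (ζ ^ j) = ζ ^ (n - j) := by
  rcases Nat.eq_zero_or_pos n with rfl | hn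
  · rw [Nat.le_zero.1 hj, pow_zero, map_one]
  · have hnorm : ‖ζ ^ j‖ = 1 := by
      rw [norm_pow, norm_eq_one_of_pow_eq_one hζ hn.ne', one_pow]
    rw [← inv_eq_conj hnorm]
    refine inv_eq_of_mul_eq_one_right ?_
    rw [← pow_add, Nat.add_sub_cancel' hj, hζ]

theorem sum_range_reflect_of_eq {M : Type*} [AddCancelCommMonoid M] {g : ℕ → M} {n : ℕ}
    (hg : g n = g 0) : ∑ j ∈ Finset.range n, g (n - j) = ∑ j ∈ Finset.range n, g j := by
  have hflip := Finset.sum_flip g (n := n)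
  rwa [Finset.sum_range_succ, Finset.sum_range_succ, Nat.sub_self, hg, add_left_inj] at hflip

theorem sum_range_succ_eq_of_eq {M : Type*} [AddCancelCommMonoid M] {g : ℕ → M} {n : ℕ}
    (hg : g n = g 0) : ∑ j ∈ Finset.range n, g (j + 1) = ∑ j ∈ Finset.range n, g j := by
  have hshift := (Finset.sum_range_succ' g n).symm.trans (Finset.sum_range_succ g n)
  rwa [hg, add_left_inj] at hshift

theorem p_eq_pow (m j : ℕ) : p m j = p m 1 ^ j := by
  rw [p, p, ← exp_nat_mul]
  congr 1
  push_cast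
  ring

theorem p_pow_nn (m j : ℕ) : p m j ^ nn m = 1 := by
  rw [p_eq_pow, pow_right_comm, ← p_eq_pow, p_nn, one_pow]

theorem neg_one_pow_nn (m : ℕ) : (-1 : ℂ) ^ nn m = 1 :=
  Even.neg_one_pow ((even_two_mul m).add even_two)

theorem conj_p (m : ℕ) {j : ℕ} (hj : j ≤ nn m) : conj (p m j) = p m (nn m - j) := by
  rw [p_eq_pow, conj_pow_eq_pow_sub (p_pow_nn m 1) hj, ← p_eq_pow]

theorem det_D (m : ℕ) : (D m).det = 1 := by
  rw [D, det_fin_two_of, ← exp_add, add_neg_cancel, exp_zero, mul_zero, sub_zero]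

theorem D_mul_inv (m : ℕ) : D m * (D m)⁻¹ = 1 :=
  mul_nonsing_inv _ (det_D m ▸ isUnit_one)

theorem D_inv_mul (m : ℕ) : (D m)⁻¹ * D m = 1 :=
  nonsing_inv_mul _ (det_D m ▸ isUnit_one)

theorem D_inv (m : ℕ) : (D m)⁻¹ =
    !![exp (-(I * Real.pi * m / nn m)), 0; 0, exp (I * Real.pi * m / nn m)] := by
  rw [Matrix.inv_def, det_D, Ring.inverse_one, one_smul, D, adjugate_fin_two_of, neg_zero]

/-- The factors by which conjugation with `D` multiplies the entries of a matrix: writing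
`D = diag (d, d⁻¹)`, the off-diagonal ones are `d ^ (-2)` and `d ^ 2 = p_m`. -/
def conjWeight (m : ℕ) : Matrix (Fin 2) (Fin 2) ℂ :=
  !![1, (p m m)⁻¹; p m m, 1]

theorem D_inv_mul_mul_D_apply (m : ℕ) (M : Matrix (Fin 2) (Fin 2) ℂ) (i k : Fin 2) :
    ((D m)⁻¹ * M * D m) i k = conjWeight m i k * M i k := by
  have hp : p m m = exp (I * Real.pi * m / nn m) * exp (I * Real.pi * m / nn m) := by
    rw [p, ← exp_add]
    congr 1
    ring
  have hexp := exp_ne_zero (I * Real.pi * m / nn m)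
  rw [conjWeight, hp, D_inv, D, exp_neg, mul_apply, Fin.sum_univ_two, mul_apply, mul_apply,
    Fin.sum_univ_two, Fin.sum_univ_two]
  fin_cases i <;> fin_cases k <;> simp <;> field_simp

theorem conjWeight_pow_nn (m : ℕ) (i k : Fin 2) : conjWeight m i k ^ nn m = 1 := by
  fin_cases i <;> fin_cases k <;> simp [conjWeight, p_pow_nn]

variable {m : ℕ} {ρ t : ℝ} {x : Param ρ}

theorem A_succ (j : ℕ) (μ : ℂ) : A m x (j + 1) μ = (D m)⁻¹ * A m x j (-μ) * D m := rfl

theorem A_apply (j : ℕ) (μ : ℂ) (i k : Fin 2) :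
    A m x j μ i k = conjWeight m i k ^ j * A m x 0 ((-1) ^ j * μ) i k := by
  induction j generalizing μ with
  | zero => simp
  | succ j ih =>
    rw [A_succ, D_inv_mul_mul_D_apply, ih, pow_succ', mul_assoc, pow_succ, mul_neg, mul_neg_one,
      neg_mul]

theorem trace_A (j : ℕ) (μ : ℂ) : (A m x j μ).trace = 0 := by
  rw [trace_fin_two, A_apply, A_apply (x := x) j μ 1 1]
  simp [conjWeight, A]

theorem A_nn (μ : ℂ) : A m x (nn m) μ = A m x 0 μ := by
  ext i k
  rw [A_apply, conjWeight_pow_nn, neg_one_pow_nn, one_mul, one_mul]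

theorem trace_η (z μ : ℂ) : (η m t x z μ).trace = 0 := by
  rw [η, trace_add, trace_smul, trace_sum]
  simp [trace_fin_two_of, trace_A]

theorem smul_sum_residues_rotate (z μ : ℂ) :
    p m 1 • ∑ j ∈ Finset.range (nn m), (p m 1 * z - p m j)⁻¹ • A m x j μ =
      ∑ j ∈ Finset.range (nn m), (z - p m j)⁻¹ • A m x (j + 1) μ := by
  rw [← sum_range_succ_eq_of_eq (by rw [p_nn, A_nn, p_zero]), Finset.smul_sum]
  refine Finset.sum_congr rfl fun j _ => ?_
  rw [p_succ m j, ← mul_sub, mul_inv, smul_smul, mul_inv_cancel_left₀ (p_ne_zero m 1)]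

theorem smul_leading_term_rotate (r : ℝ) (z : ℂ) :
    p m 1 • !![0, 0; m * r * (p m 1 * z) ^ (m - 1), 0] =
      (D m)⁻¹ * !![0, 0; m * r * z ^ (m - 1), 0] * D m := by
  ext i k
  rw [D_inv_mul_mul_D_apply, conjWeight, p_eq_pow m m]
  cases m <;> fin_cases i <;> fin_cases k <;> simp
  ring

theorem η_rotate (z μ : ℂ) :
    p m 1 • η m t x (p m 1 * z) μ = (D m)⁻¹ * η m t x z (-μ) * D m := by
  rw [η, η, smul_add, smul_leading_term_rotate, smul_comm, smul_sum_residues_rotate, mul_add,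
    add_mul, Matrix.mul_smul, Matrix.smul_mul, Finset.mul_sum, Finset.sum_mul]
  simp only [Matrix.mul_smul, Matrix.smul_mul, A_succ]

theorem conj_ev (f : WienerPos ρ) (μ : ℂ) : conj (ev f μ) = ev f (conj μ) := by
  rw [ev, ev, conj_tsum]
  simp

theorem map_conj_A_zero (μ : ℂ) : (A m x 0 μ).map conj = A m x 0 (conj μ) := by
  ext i k
  fin_cases i <;> fin_cases k <;> simp [A, conj_ev]

theorem map_conj_A {j : ℕ} (hj : j ≤ nn m) (μ : ℂ) :
    (A m x j μ).map conj = A m x (nn m - j) (conj μ) := by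
  ext i k
  have hzero := congrFun₂ (map_conj_A_zero (m := m) (x := x) ((-1) ^ j * μ)) i k
  rw [map_apply, map_mul, conj_pow_eq_pow_sub (neg_one_pow_nn m) hj] at hzero
  rw [map_apply, A_apply, map_mul, conj_pow_eq_pow_sub (conjWeight_pow_nn m i k) hj, hzero,
    A_apply (nn m - j)]

theorem map_conj_η (z μ : ℂ) : (η m t x z μ).map conj = η m t x (conj z) (conj μ) := by
  have hreflect := sum_range_reflect_of_eq (n := nn m)
    (g := fun j => (conj z - p m j)⁻¹ • A m x j (conj μ)) (by rw [p_nn, A_nn, p_zero])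
  rw [η, η, ← hreflect, Matrix.map_add _ (map_add _)]
  congr 1
  · ext i k
    fin_cases i <;> fin_cases k <;> simp
  · ext i k
    simp only [map_apply, Matrix.smul_apply, Matrix.sum_apply, smul_eq_mul, map_mul, map_sum,
      conj_ofReal]
    congr 1
    refine Finset.sum_congr rfl fun j hj => ?_
    have hj' := (Finset.mem_range.1 hj).le
    rw [map_inv₀, map_sub, conj_p m hj', ← map_conj_A hj', map_apply]

variable {j : ℕ} {μ : ℂ} {X Y : ℝ → Matrix (Fin 2) (Fin 2) ℂ}

theorem trace_pullback (s : ℝ) : (deriv (γ m j) s • η m t x (γ m j s) μ).trace = 0 := by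
  rw [trace_smul, trace_η, smul_zero]

theorem IsTransport.isSol (h : IsTransport m t x j μ X) :
    IsSol (fun s => deriv (γ m j) s • η m t x (γ m j s) μ) X := h.2

theorem IsTransport.mon_eq (h : IsTransport m t x j μ X) : Mon m t x j μ = X 1 := by
  have hex : ∃ X, IsTransport m t x j μ X := ⟨X, h⟩
  rw [Mon, dif_pos hex]
  exact h.isSol.eq_of_eq hex.choose_spec.isSol (fun s _ => trace_pullback s) h.1 hex.choose_spec.1

theorem IsTransport.det_mon (h : IsTransport m t x j μ X) : (Mon m t x j μ).det = 1 := by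
  rw [h.mon_eq]
  exact h.isSol.det_eq_one (fun s _ => trace_pullback s) h.1

theorem IsTransport.rotate (h : IsTransport m t x j (-μ) X) :
    IsTransport m t x (j + 1) μ fun s => (D m)⁻¹ * X s * D m := by
  refine ⟨by simp only [h.1, mul_one, D_inv_mul], ?_⟩
  have hpullback : ∀ s, deriv (γ m (j + 1)) s • η m t x (γ m (j + 1) s) μ =
      (D m)⁻¹ * (deriv (γ m j) s • η m t x (γ m j s) (-μ)) * D m := fun s => by
    rw [deriv_γ_succ, γ_succ, mul_comm (p m 1), mul_smul, η_rotate, Matrix.mul_smul,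
      Matrix.smul_mul]
  have hsol := h.isSol.conj_matrix (D_mul_inv m)
  simp only [← hpullback] at hsol
  exact hsol

section Rotation

variable (htransport : ∀ μ : ℂ, ‖μ‖ = 1 → ∃ X, IsTransport m t x 0 μ X)
include htransport

theorem exists_isTransport (j : ℕ) (hμ : ‖μ‖ = 1) : ∃ X, IsTransport m t x j μ X := by
  induction j generalizing μ with
  | zero => exact htransport μ hμ
  | succ j ih =>
    obtain ⟨X, hX⟩ := ih (μ := -μ) (by rwa [norm_neg])
    exact ⟨_, hX.rotate⟩

theorem mon_succ (j : ℕ) (hμ : ‖μ‖ = 1) :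
    Mon m t x (j + 1) μ = (D m)⁻¹ * Mon m t x j (-μ) * D m := by
  obtain ⟨X, hX⟩ := exists_isTransport htransport j (μ := -μ) (by rwa [norm_neg])
  rw [hX.mon_eq, hX.rotate.mon_eq]

end Rotation

theorem map_conj_mon (hX : IsTransport m t x 0 (conj μ) X) (hY : IsTransport m t x 0 μ Y) :
    (Mon m t x 0 (conj μ)).map conj = adjugate (Mon m t x 0 μ) := by
  have hreverse := hX.isSol.map_conj_reverse
  have hpullback : ∀ s, -(deriv (γ m 0) (1 - s) • η m t x (γ m 0 (1 - s)) (conj μ)).map conj =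
      deriv (γ m 0) s • η m t x (γ m 0 s) μ := fun s => by
    rw [Matrix.map_smul' conj _ _ (map_mul conj), map_conj_η, conj_deriv_γ, conj_γ,
      sub_sub_cancel, conj_conj, neg_smul, neg_neg]
  simp only [hpullback] at hreverse
  have h := hY.isSol.mul_adjugate_eq hreverse fun s _ => trace_pullback s
  rw [sub_self, sub_zero, hX.1, hY.1, adjugate_one, mul_one,
    Matrix.map_one _ (map_zero _) (map_one _), one_mul] at h
  rw [hX.mon_eq, hY.mon_eq, h]

end Symmetries

/-! ### Two by two matrices of Laurent series -/

open Matrix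
open scoped Matrix.Norms.Operator

/-- The Banach algebra of two by two matrices of Laurent series. -/
abbrev LaurentMat (ρ : ℝ) := Matrix (Fin 2) (Fin 2) (Laurent ρ)

section PathSmul

variable {𝔸 : Type*} [NormedRing 𝔸] [NormedAlgebra ℂ 𝔸]

/-- The path `s ↦ κ s • a`. -/
def pathSmul (κ : C(unitInterval, ℂ)) : 𝔸 →L[ℂ] PathAlg 𝔸 :=
  LinearMap.mkContinuous
    { toFun a := ContinuousMap.mk (fun s => κ s • a) (κ.continuous.smul continuous_const)
      map_add' a b := by
        ext s
        exact smul_add _ _ _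
      map_smul' c a := by
        ext s
        exact smul_comm _ _ _ } ‖κ‖ fun a => by
    refine PathAlg.norm_le (by positivity) fun s => (norm_smul_le _ _).trans ?_
    gcongr
    exact κ.norm_coe_le_norm s

theorem pathSmul_combination_apply {κ : ℕ → C(unitInterval, ℂ)} {s : unitInterval} {g : ℂ}
    (hκ : ∀ k, κ k s = κ 0 s * g ^ k) (m : ℕ) (u : ℂ) (a b c : 𝔸) :
    (pathSmul (κ 0) a + u • pathSmul (κ m) b - u ^ 2 • pathSmul (κ (2 * m)) c) s =
      κ 0 s • (a + (u * g ^ m) • b - (u * g ^ m) ^ 2 • c) := by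
  change κ 0 s • a + u • κ m s • b - u ^ 2 • κ (2 * m) s • c = _
  rw [hκ m, hκ (2 * m)]
  module

theorem totalInt_pathSmul [CompleteSpace 𝔸] (κ : C(unitInterval, ℂ)) (a : 𝔸) :
    totalInt (pathSmul κ a) = (∫ u in (0 : ℝ)..1, IccExtend zero_le_one κ u) • a :=
  intervalIntegral.integral_smul_const _ _

theorem totalInt_pathSmul_combination [CompleteSpace 𝔸] {κ : ℕ → C(unitInterval, ℂ)} {v : ℂ}
    (hκ : ∀ k, ∫ u in (0 : ℝ)..1, IccExtend zero_le_one (κ k) u = v) (m : ℕ) (u : ℂ)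
    (a b c : 𝔸) :
    totalInt (pathSmul (κ 0) a + u • pathSmul (κ m) b - u ^ 2 • pathSmul (κ (2 * m)) c) =
      v • (a + u • b - u ^ 2 • c) := by
  simp only [map_sub, map_add, map_smul, totalInt_pathSmul, hκ]
  module

end PathSmul

section Shear

variable {R : Type*} [CommRing R]

/-- The shear `Φ₀ = (1, 0; u, 1)`: for `u = r z ^ m` it solves `dΦ = Φ η_0`, `Φ(0) = Id`. -/
def shear (u : R) : Matrix (Fin 2) (Fin 2) R := !![1, 0; u, 1]

theorem shear_zero : shear (0 : R) = 1 := one_fin_two.symm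

variable (R) in
/-- The nilpotent matrix of which the shears are the exponentials. -/
def nilp : Matrix (Fin 2) (Fin 2) R := !![0, 0; 1, 0]

variable [Algebra ℂ R]

/-- The conjugate `Φ₀ M Φ₀⁻¹` of `M` by the shear `Φ₀` with parameter `u`. -/
def shearConj (u : ℂ) (M : Matrix (Fin 2) (Fin 2) R) : Matrix (Fin 2) (Fin 2) R :=
  M + u • (nilp R * M - M * nilp R) - u ^ 2 • (nilp R * M * nilp R)

theorem shearConj_mul_shear (u : ℂ) (M : Matrix (Fin 2) (Fin 2) ℂ) :
    shearConj u M * shear u = shear u * M := by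
  rw [eta_fin_two M]
  ext i k
  fin_cases i <;> fin_cases k <;>
    simp [shearConj, shear, nilp, mul_apply, Fin.sum_univ_two] <;> ring

end Shear

section LaurentMat

variable {ρ : ℝ} [hρ : Fact (1 ≤ ρ)]

instance : @CompleteSpace (LaurentMat ρ) PseudoMetricSpace.toUniformSpace :=
  inferInstanceAs (CompleteSpace (Fin 2 → Fin 2 → Laurent ρ))

/-- The entry of a matrix as a continuous linear map. -/
def entryCLM (i k : Fin 2) : LaurentMat ρ →L[ℝ] Laurent ρ :=
  ⟨entryLinearMap ℝ (Laurent ρ) i k, continuous_id.matrix_elem i k⟩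

section Eval

variable {μ : ℂ} (hμ : ‖μ‖ = 1)

/-- Evaluation of the entries at a point of the unit circle. -/
def evalMat : LaurentMat ρ →A[ℂ] Matrix (Fin 2) (Fin 2) ℂ where
  toAlgHom := (Laurent.eval (ρ := ρ) hμ).toAlgHom.mapMatrix
  cont := continuous_id.matrix_map (Laurent.eval hμ).cont

theorem evalMat_apply (M : LaurentMat ρ) (i k : Fin 2) :
    evalMat hμ M i k = Laurent.eval hμ (M i k) := rfl

theorem norm_evalMat_le (M : LaurentMat ρ) : ‖evalMat hμ M‖ ≤ ‖M‖ := by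
  simp only [linfty_opNorm_def, NNReal.coe_le_coe]
  exact Finset.sup_mono_fun fun i _ => Finset.sum_le_sum fun k _ =>
    Laurent.norm_eval_le hμ (M i k)

theorem evalMat_logOneAdd {N : LaurentMat ρ} (hN : ‖N‖ < 1) :
    evalMat hμ (logOneAdd N) = logOneAdd (evalMat hμ N) :=
  map_logOneAdd (evalMat (ρ := ρ) hμ).toAlgHom.toRingHom.toAddMonoidHom (evalMat hμ).cont hN
    fun k => by
      change evalMat hμ (_ • _) = _ • evalMat hμ N ^ (k + 1)
      rw [map_smul, map_pow]

theorem evalMat_nilp : evalMat hμ (nilp (Laurent ρ)) = nilp ℂ := by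
  ext i k
  rw [evalMat_apply]
  fin_cases i <;> fin_cases k <;> simp [nilp]

theorem evalMat_shearConj (u : ℂ) (M : LaurentMat ρ) :
    evalMat hμ (shearConj u M) = shearConj u (evalMat hμ M) := by
  simp only [shearConj, map_sub, map_add, map_smul, map_mul, evalMat_nilp]

end Eval

/-! ### The residues as matrices of Laurent series -/

/-- The residue `A_0` as a function of the parameter. -/
def residueZero : ParamSpace ρ →L[ℝ] LaurentMat ρ where
  toFun y := !![y.2.1.toLaurent, Laurent.mono (-1) * y.2.2.1.toLaurent;
    Laurent.mono 1 * y.2.2.2.toLaurent, -y.2.1.toLaurent]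
  map_add' y z := by
    ext1 i k
    fin_cases i <;> fin_cases k <;> simp [mul_add, add_comm]
  map_smul' c y := by
    ext1 i k
    fin_cases i <;> fin_cases k
    · simp
    · simp
    · simp
    · exact (congrArg Neg.neg (map_smul _ c _)).trans (smul_neg c y.2.1.toLaurent).symm
  cont := continuous_matrix fun i k => by
    fin_cases i <;> fin_cases k <;>
      simp only [Fin.zero_eta, Fin.mk_one, of_apply, cons_val', cons_val_zero, cons_val_one,
        cons_val_fin_one] <;> fun_prop

/-- The map which takes `M(μ)` to `D⁻¹ M(-μ) D`. -/
def twist (m : ℕ) : LaurentMat ρ →L[ℂ] LaurentMat ρ where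
  toFun M := of fun i k => conjWeight m i k • (M i k).negSubst
  map_add' M N := by
    ext1 i k
    simp
  map_smul' c M := by
    ext1 i k
    simp [smul_comm c]
  cont := continuous_matrix fun i k => by
    simp only [of_apply]
    fun_prop

theorem twist_apply (m : ℕ) (M : LaurentMat ρ) (i k : Fin 2) :
    twist m M i k = conjWeight m i k • (M i k).negSubst := rfl

/-- The residue `A_j` as a function of the parameter. -/
def residue (m : ℕ) : ℕ → ParamSpace ρ →L[ℝ] LaurentMat ρ
  | 0 => residueZero
  | j + 1 => (twist m).restrictScalars ℝ ∘L residue m j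

theorem evalMat_residueZero {μ : ℂ} (hμ : ‖μ‖ = 1) (m : ℕ) (x : Param ρ) :
    evalMat hμ (residueZero (paramEquiv x)) = A m x 0 μ := by
  ext i k
  rw [evalMat_apply, A]
  fin_cases i <;> fin_cases k <;> simp [residueZero, paramEquiv, eval_toLaurent, Laurent.eval_mono]

theorem evalMat_residue (m : ℕ) (x : Param ρ) (j : ℕ) {μ : ℂ} (hμ : ‖μ‖ = 1) :
    evalMat hμ (residue m j (paramEquiv x)) = A m x j μ := by
  induction j generalizing μ with
  | zero => exact evalMat_residueZero hμ m x
  | succ j ih =>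
    have hneg : ‖-μ‖ = 1 := by rwa [norm_neg]
    ext i k
    rw [A_succ, ← ih hneg, D_inv_mul_mul_D_apply, evalMat_apply, evalMat_apply, residue,
      ContinuousLinearMap.comp_apply, ContinuousLinearMap.coe_restrictScalars', twist_apply,
      map_smul, Laurent.eval_negSubst hμ hneg, smul_eq_mul]

end LaurentMat

/-! ### The potential after a gauge transformation -/

section Gauge

variable {B C : ℝ → Matrix (Fin 2) (Fin 2) ℂ} {Y G G' : ℝ → Matrix (Fin 2) (Fin 2) ℂ}

theorem IsSol.mul_gauge (hY : IsSol B Y)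
    (hG : ∀ s i k, HasDerivAt (fun u => G u i k) (G' s i k) s)
    (hgauge : ∀ s ∈ Icc (0 : ℝ) 1, B s * G s + G' s = G s * C s) :
    IsSol C fun s => Y s * G s := by
  intro s hs i k
  have hYs := hY s hs i
  have hGs := fun l => (hG s l k).hasDerivWithinAt (s := Icc 0 1)
  have h : (Y s * (B s * G s + G' s)) i k = (Y s * (G s * C s)) i k := by rw [hgauge s hs]
  change HasDerivWithinAt (fun u => (Y u * G u) i k) ((Y s * G s * C s) i k) (Icc 0 1) s
  simp only [mul_apply, Matrix.add_apply, Fin.sum_univ_two] at hYs h ⊢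
  refine (((hYs 0).mul (hGs 0)).add ((hYs 1).mul (hGs 1))).congr_deriv ?_
  linear_combination h

end Gauge

section Gauged

variable {ρ : ℝ} [hρ : Fact (1 ≤ ρ)] {μ : ℂ} (hμ : ‖μ‖ = 1)

theorem isSol_evalMat {B : PathAlg (LaurentMat ρ)} (hB : ‖B‖ < 1) :
    IsSol (fun s => evalMat hμ (IccExtend zero_le_one B s)) fun s => evalMat hμ (odeFun B s) := by
  intro s hs i k
  have hentry : HasDerivAt (fun u => odeFun B u i k) ((odeFun B s * B ⟨s, hs⟩) i k) s :=
    (entryCLM (ρ := ρ) i k).hasFDerivAt.comp_hasDerivAt s (hasDerivAt_odeFun hB ⟨s, hs⟩)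
  beta_reduce
  rw [IccExtend_of_mem _ _ hs, ← map_mul]
  exact (((Laurent.eval (ρ := ρ) hμ).toContinuousLinearMap.restrictScalars
    ℝ).hasFDerivAt.comp_hasDerivAt s hentry).hasDerivWithinAt

/-- The function `loopKernel m j k` on `[0,1]`. -/
def kernelPath (m : ℕ) (j : Fin (nn m)) (k : ℕ) : C(unitInterval, ℂ) :=
  ⟨fun s => loopKernel m j k s, (continuousOn_loopKernel j.2 k).domRestrict⟩

theorem integral_kernelPath (m : ℕ) (j : Fin (nn m)) (k : ℕ) :
    ∫ u in (0 : ℝ)..1, IccExtend zero_le_one (kernelPath m j k) u =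
      if (j : ℕ) = 0 then 2 * Real.pi * I else 0 := by
  rw [← integral_loopKernel j.2 k]
  refine intervalIntegral.integral_congr fun u hu => ?_
  rw [uIcc_of_le zero_le_one] at hu
  exact IccExtend_of_mem _ _ hu

/-- The pull-back by `γ_0` of the potential `Φ₀ (∑ A_j dz / (z - p_j)) Φ₀⁻¹`, where `Φ₀` is the
shear with parameter `r z ^ m`. -/
def gauged (m : ℕ) (y : ParamSpace ρ) : PathAlg (LaurentMat ρ) :=
  ∑ j : Fin (nn m), (pathSmul (kernelPath m j 0) (residue m j y)
    + (y.1 : ℂ) • pathSmul (kernelPath m j m)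
      (nilp (Laurent ρ) * residue m j y - residue m j y * nilp (Laurent ρ))
    - (y.1 : ℂ) ^ 2 • pathSmul (kernelPath m j (2 * m))
      (nilp (Laurent ρ) * residue m j y * nilp (Laurent ρ)))

theorem gauged_apply (m : ℕ) (y : ParamSpace ρ) (s : unitInterval) :
    gauged m y s =
      ∑ j : Fin (nn m), loopKernel m j 0 s • shearConj (y.1 * γ m 0 s ^ m) (residue m j y) := by
  refine (map_sum (PathAlg.evalAt (LaurentMat ρ) s) _ _).trans
    (Finset.sum_congr rfl fun j _ => ?_)
  exact pathSmul_combination_apply (κ := kernelPath m j) (fun k => by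
    change loopKernel m j k s = loopKernel m j 0 s * γ m 0 s ^ k
    rw [loopKernel, loopKernel]
    ring) _ _ _ _ _

theorem contDiff_gauged (m : ℕ) : ContDiff ℝ 1 (gauged (ρ := ρ) m) := by
  have hr : ContDiff ℝ 1 fun y : ParamSpace ρ => (y.1 : ℂ) := ofRealCLM.contDiff.comp contDiff_fst
  have hpath : ∀ κ : C(unitInterval, ℂ),
      ContDiff ℝ 1 fun M : LaurentMat ρ => pathSmul κ M := fun κ =>
    ((pathSmul (𝔸 := LaurentMat ρ) κ).restrictScalars ℝ).contDiff
  refine ContDiff.sum fun j _ => ?_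
  have hA : ContDiff ℝ 1 fun y : ParamSpace ρ => residue m j y := (residue m j).contDiff
  exact (((hpath _).comp hA).add (hr.smul ((hpath _).comp
    ((contDiff_const.mul hA).sub (hA.mul contDiff_const))))).sub
    ((hr.pow 2).smul ((hpath _).comp ((contDiff_const.mul hA).mul contDiff_const)))

/-- The limit for `t → 0` of `M̃ / (2πi)`. -/
def central (y : ParamSpace ρ) : LaurentMat ρ := shearConj y.1 (residueZero y)

theorem totalInt_gauged (m : ℕ) (y : ParamSpace ρ) :
    totalInt (gauged m y) = (2 * Real.pi * I : ℂ) • central y := by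
  rw [gauged, map_sum, Finset.sum_eq_single (⟨0, Nat.succ_pos _⟩ : Fin (nn m))]
  · exact totalInt_pathSmul_combination
      (fun k => (integral_kernelPath m _ k).trans (if_pos rfl)) _ _ _ _ _
  · intro j _ hj
    have hj' : (j : ℕ) ≠ 0 := fun h => hj (Fin.ext h)
    exact (totalInt_pathSmul_combination
      (fun k => (integral_kernelPath m _ k).trans (if_neg hj')) _ _ _ _ _).trans
      (zero_smul ℂ (_ : LaurentMat ρ))
  · exact fun h => absurd (Finset.mem_univ _) h

theorem hasDerivAt_shear_γ (m : ℕ) (r s : ℝ) (i k : Fin 2) :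
    HasDerivAt (fun u => shear (r * γ m 0 u ^ m) i k)
      ((shear (r * γ m 0 s ^ m) * (deriv (γ m 0) s •
        !![0, 0; m * r * γ m 0 s ^ (m - 1), 0]) : Matrix (Fin 2) (Fin 2) ℂ) i k) s := by
  have hpow := ((hasDerivAt_γ m 0 s).pow m).const_mul (r : ℂ)
  have hmul : (shear (r * γ m 0 s ^ m) * (deriv (γ m 0) s •
      !![0, 0; m * r * γ m 0 s ^ (m - 1), 0]) : Matrix (Fin 2) (Fin 2) ℂ) =
      !![0, 0; deriv (γ m 0) s * (m * r * γ m 0 s ^ (m - 1)), 0] := by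
    ext i k
    fin_cases i <;> fin_cases k <;> simp [shear, mul_apply, Fin.sum_univ_two]
  rw [hmul]
  fin_cases i <;> fin_cases k
  · exact hasDerivAt_const s 1
  · exact hasDerivAt_const s 0
  · exact hpow.congr_deriv (by
      change _ = deriv (γ m 0) s * (m * r * γ m 0 s ^ (m - 1))
      ring)
  · exact hasDerivAt_const s 1

theorem evalMat_gauged_mul_shear (m : ℕ) (x : Param ρ) (s : unitInterval) :
    evalMat hμ (gauged m (paramEquiv x) s) * shear (x.r * γ m 0 s ^ m) =
      shear (x.r * γ m 0 s ^ m) * (deriv (γ m 0) s •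
        ∑ j ∈ Finset.range (nn m), (γ m 0 s - p m j)⁻¹ • A m x j μ) := by
  rw [gauged_apply, map_sum, Finset.sum_mul, Finset.sum_range, Finset.smul_sum, Finset.mul_sum]
  refine Finset.sum_congr rfl fun j _ => ?_
  rw [map_smul, evalMat_shearConj, evalMat_residue, Matrix.smul_mul, smul_smul, Matrix.mul_smul,
    loopKernel, pow_zero, one_div]
  exact congrArg _ (shearConj_mul_shear _ _)

theorem isTransport_evalMat {m : ℕ} (hm : 1 ≤ m) {t : ℝ} {x : Param ρ}
    (hB : ‖(t : ℂ) • gauged m (paramEquiv x)‖ < 1) :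
    IsTransport m t x 0 μ fun s =>
      evalMat hμ (odeFun ((t : ℂ) • gauged m (paramEquiv x)) s) * shear (x.r * γ m 0 s ^ m) := by
  refine ⟨?_, (isSol_evalMat hμ hB).mul_gauge (hasDerivAt_shear_γ m x.r) fun s hs => ?_⟩
  · simp only [odeFun_zero, map_one, one_mul, γ_at_zero, zero_pow (Nat.one_le_iff_ne_zero.1 hm),
      mul_zero, shear_zero]
  · have hpath : IccExtend zero_le_one ((t : ℂ) • gauged m (paramEquiv x)) s =
        (t : ℂ) • gauged m (paramEquiv x) ⟨s, hs⟩ := IccExtend_of_mem _ _ hs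
    rw [hpath, map_smul, Matrix.smul_mul, evalMat_gauged_mul_shear, ← Matrix.mul_smul, ← mul_add,
      smul_comm (t : ℂ), ← smul_add, add_comm, η]

theorem mon_zero_eq {m : ℕ} (hm : 1 ≤ m) {t : ℝ} {x : Param ρ}
    (hB : ‖(t : ℂ) • gauged m (paramEquiv x)‖ < 1) :
    Mon m t x 0 μ = evalMat hμ (odeEnd ((t : ℂ) • gauged m (paramEquiv x))) := by
  rw [(isTransport_evalMat hμ hm hB).mon_eq, odeFun_one hB, γ_at_one,
    zero_pow (Nat.one_le_iff_ne_zero.1 hm), mul_zero, shear_zero, mul_one]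

end Gauged

/-! ### The inverse of the linearised system -/

section System

variable {ρ : ℝ} [hρ : Fact (1 ≤ ρ)]

namespace Taylor

/-- The coefficient of `λ ^ k` for an integer `k`. -/
def intCoef (k : ℤ) : Taylor ρ →L[ℝ] ℝ := Laurent.reCoef (ρ := ρ) k ∘L toLaurent (ρ := ρ)

theorem intCoef_apply (k : ℤ) (f : Taylor ρ) : intCoef k f = Laurent.reCoef k f.toLaurent := rfl

theorem intCoef_of_neg {k : ℤ} (hk : k < 0) (f : Taylor ρ) : intCoef k f = 0 := by
  rw [intCoef_apply, reCoef_toLaurent, if_neg hk.not_ge]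

theorem intCoef_natCast (n : ℕ) (f : Taylor ρ) : intCoef n f = coef n f := by
  rw [intCoef_apply, reCoef_toLaurent, if_pos (Int.natCast_nonneg n), Int.toNat_natCast]

theorem ext_intCoef {f g : Taylor ρ} (h : ∀ k, 0 ≤ k → intCoef k f = intCoef k g) : f = g := by
  ext n
  rw [← intCoef_natCast, ← intCoef_natCast, h _ (Int.natCast_nonneg n)]

theorem intCoef_mono (k : ℤ) (n : ℕ) :
    intCoef k (mono n : Taylor ρ) = if k = n then 1 else 0 := by
  rw [intCoef_apply, toLaurent_mono, ← one_smul ℝ (Laurent.mono n : Laurent ρ),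
    Laurent.reCoef_smul_mono]

theorem intCoef_ofLaurent (k : ℤ) (N : ℕ) (f : Laurent ρ) :
    intCoef k (ofLaurent N f) = if N ≤ k then Laurent.reCoef k f else 0 := by
  rw [intCoef_apply, reCoef_toLaurent]
  rcases lt_or_ge k 0 with hk | hk
  · rw [if_neg hk.not_ge, if_neg (by omega)]
  · rw [if_pos hk, coef_ofLaurent, Int.toNat_of_nonneg hk]
    simp only [Int.le_toNat hk]

end Taylor

open Laurent Taylor

variable (ρ) in
/-- The pairs of a matrix `M̃ / (2πi)` and a number `𝒦 - 1`, from which the equations of the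
system are formed. -/
abbrev SystemData := LaurentMat ρ × ℝ

/-- An entry of the matrix component. -/
def entry (i k : Fin 2) : SystemData ρ →L[ℝ] Laurent ρ :=
  entryCLM (ρ := ρ) i k ∘L .fst ℝ (LaurentMat ρ) ℝ

theorem entry_mk (i k : Fin 2) (M : LaurentMat ρ) (s : ℝ) : entry i k (M, s) = M i k := rfl

/-- The Fourier coefficients of `ℱ`. -/
def coefF (k : ℤ) : SystemData ρ →L[ℝ] ℝ :=
  (reCoef (ρ := ρ) k - reCoef (ρ := ρ) (-k)) ∘L entry (ρ := ρ) 0 0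

/-- The Fourier coefficients of `𝒢`. -/
def coefG (k : ℤ) : SystemData ρ →L[ℝ] ℝ :=
  reCoef (ρ := ρ) k ∘L entry (ρ := ρ) 1 0 - reCoef (ρ := ρ) (-k) ∘L entry (ρ := ρ) 0 1

theorem coefF_apply (k : ℤ) (w : SystemData ρ) :
    coefF k w = reCoef k (entry 0 0 w) - reCoef (-k) (entry 0 0 w) := rfl

theorem coefG_apply (k : ℤ) (w : SystemData ρ) :
    coefG k w = reCoef k (entry 1 0 w) - reCoef (-k) (entry 0 1 w) := rfl

theorem coefF_neg (k : ℤ) (w : SystemData ρ) : coefF (-k) w = -coefF k w := by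
  rw [coefF_apply, coefF_apply, neg_neg, neg_sub]

theorem coefF_eq_zero_of_pos {w : SystemData ρ} (h : ∀ k, 0 < k → coefF k w = 0) (k : ℤ) :
    coefF k w = 0 := by
  rcases lt_trichotomy k 0 with hk | rfl | hk
  · rw [← neg_neg k, coefF_neg, h _ (neg_pos.2 hk), neg_zero]
  · exact self_eq_neg.mp (coefF_neg 0 w)
  · exact h k hk

/-- The equations of the system, in terms of Fourier coefficients. -/
structure IsSolution (w : SystemData ρ) : Prop where
  coefF_eq_zero : ∀ k, coefF k w = 0
  coefG_eq_zero : ∀ k, coefG k w = 0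
  valOne_eq_zero : valOne (entry 0 1 w) = 0
  valNegOne_eq_zero : valNegOne (entry 0 1 w) = 0
  snd_eq_zero : w.2 = 0

variable (ρ) in
/-- The real linear operator `f(λ) ↦ f(1/λ)`. -/
def revReal : Laurent ρ →L[ℝ] Laurent ρ := rev.restrictScalars ℝ

/-- The terms of order at least three of the component `b` of `linInv`. -/
def bTail : SystemData ρ →L[ℝ] Taylor ρ :=
  ofLaurent (ρ := ρ) 3 ∘L (mulCLM ℂ (laurentWeight ρ) (Laurent.mono 1)).restrictScalars ℝ ∘L
    (entry (ρ := ρ) 0 1 - revReal ρ ∘L entry (ρ := ρ) 1 0)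

/-- The terms of order at least two of the component `a` of `linInv`. -/
def aTail : SystemData ρ →L[ℝ] Taylor ρ :=
  ofLaurent (ρ := ρ) 2 ∘L (entry (ρ := ρ) 0 0 - revReal ρ ∘L entry (ρ := ρ) 0 0
    - revReal ρ ∘L entry (ρ := ρ) 1 0 + entry (ρ := ρ) 0 1)

/-- The terms of order at least one of the component `c` of `linInv`. -/
def cTail : SystemData ρ →L[ℝ] Taylor ρ :=
  ofLaurent (ρ := ρ) 1 ∘L (mulCLM ℂ (laurentWeight ρ) (Laurent.mono (-1))).restrictScalars ℝ ∘L
    (entry (ρ := ρ) 1 0 - revReal ρ ∘L entry (ρ := ρ) 0 1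
      - (2 : ℝ) • (entry (ρ := ρ) 0 0 - revReal ρ ∘L entry (ρ := ρ) 0 0)
      + revReal ρ ∘L entry (ρ := ρ) 1 0 - entry (ρ := ρ) 0 1)

/-- The sum `b_0 + b_2` of coefficients of the component `b` of `linInv`. -/
def bEven : SystemData ρ →L[ℝ] ℝ :=
  (1 / 2 : ℝ) • (valOne (ρ := ρ) ∘L (entry (ρ := ρ) 0 1 - toLaurent (ρ := ρ) ∘L bTail (ρ := ρ))
    - valNegOne (ρ := ρ) ∘L (entry (ρ := ρ) 0 1 + toLaurent (ρ := ρ) ∘L bTail (ρ := ρ)))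

/-- The coefficient `b_1` of the component `b` of `linInv`. -/
def bOne : SystemData ρ →L[ℝ] ℝ :=
  (1 / 2 : ℝ) • (valOne (ρ := ρ) ∘L (entry (ρ := ρ) 0 1 - toLaurent (ρ := ρ) ∘L bTail (ρ := ρ))
    + valNegOne (ρ := ρ) ∘L (entry (ρ := ρ) 0 1 + toLaurent (ρ := ρ) ∘L bTail (ρ := ρ)))

/-- The component `r` of `linInv`. -/
def rVal : SystemData ρ →L[ℝ] ℝ := coefG (ρ := ρ) (-1) + bEven (ρ := ρ)

/-- The coefficient `b_0` of the component `b` of `linInv`. -/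
def bZero : SystemData ρ →L[ℝ] ℝ :=
  (1 / 8 : ℝ) • ((2 : ℝ) • coefF (ρ := ρ) 1 + bEven + (3 : ℝ) • rVal
    - (2 : ℝ) • ContinuousLinearMap.snd ℝ (LaurentMat ρ) ℝ - coefG 1)

/-- The inverse of the linearisation of the system at the central value, obtained by solving the
triangular system of equations for the coefficients. -/
def linInv : SystemData ρ →L[ℝ] ParamSpace ρ :=
  rVal.prod <|
    (aTail + (bOne (ρ := ρ) + (1 / 2 : ℝ) • coefG 0).smulRight (Taylor.mono 0)
      + (coefF (ρ := ρ) 1 + bEven - (2 : ℝ) • bZero + rVal).smulRight (Taylor.mono 1)).prod <|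
    (bTail + (bZero (ρ := ρ)).smulRight (Taylor.mono 0)
      + (bOne (ρ := ρ)).smulRight (Taylor.mono 1)
      + (bEven (ρ := ρ) - bZero).smulRight (Taylor.mono 2)).prod
    (cTail + ((-2 : ℝ) • ContinuousLinearMap.snd ℝ (LaurentMat ρ) ℝ
      - (4 : ℝ) • bZero).smulRight (Taylor.mono 0))

theorem intCoef_bTail (k : ℤ) (w : SystemData ρ) :
    intCoef k (bTail w) = if 3 ≤ k then -coefG (1 - k) w else 0 := by
  have h : bTail w = ofLaurent 3 (Laurent.mono 1 * (entry 0 1 w - rev (entry 1 0 w))) := rfl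
  rw [h, intCoef_ofLaurent, reCoef_mono_mul, map_sub, reCoef_rev, coefG_apply, neg_sub (reCoef _ _),
    neg_sub (1 : ℤ), neg_sub k]
  rfl

theorem intCoef_aTail (k : ℤ) (w : SystemData ρ) :
    intCoef k (aTail w) = if 2 ≤ k then coefF k w - coefG (-k) w else 0 := by
  have h : aTail w = ofLaurent 2 (entry 0 0 w - rev (entry 0 0 w) - rev (entry 1 0 w)
    + entry 0 1 w) := rfl
  rw [h, intCoef_ofLaurent, map_add, map_sub, map_sub, reCoef_rev, reCoef_rev, coefG_apply,
    coefF_apply, neg_neg]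
  exact congrArg (ite _ · 0) (by ring)

theorem intCoef_cTail (k : ℤ) (w : SystemData ρ) : intCoef k (cTail w) =
    if 1 ≤ k then coefG (k + 1) w - 2 * coefF (k + 1) w + coefG (-(k + 1)) w else 0 := by
  have h : cTail w = ofLaurent 1 (Laurent.mono (-1) * (entry 1 0 w - rev (entry 0 1 w)
    - (2 : ℝ) • (entry 0 0 w - rev (entry 0 0 w)) + rev (entry 1 0 w) - entry 0 1 w)) := rfl
  rw [h, intCoef_ofLaurent, reCoef_mono_mul, map_sub, map_add, map_sub, map_sub, map_smul, map_sub,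
    reCoef_rev, reCoef_rev, reCoef_rev, coefG_apply, coefG_apply, coefF_apply, neg_neg,
    sub_neg_eq_add, smul_eq_mul]
  exact congrArg (ite _ · 0) (by ring)

theorem bEven_apply (w : SystemData ρ) : bEven w =
    1 / 2 * (valOne (entry 0 1 w - (bTail w).toLaurent)
      - valNegOne (entry 0 1 w + (bTail w).toLaurent)) := rfl

theorem bOne_apply (w : SystemData ρ) : bOne w =
    1 / 2 * (valOne (entry 0 1 w - (bTail w).toLaurent)
      + valNegOne (entry 0 1 w + (bTail w).toLaurent)) := rfl

theorem rVal_apply (w : SystemData ρ) : rVal w = coefG (-1) w + bEven w := rfl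

theorem bZero_apply (w : SystemData ρ) :
    bZero w = 1 / 8 * (2 * coefF 1 w + bEven w + 3 * rVal w - 2 * w.2 - coefG 1 w) := rfl

theorem fst_linInv (w : SystemData ρ) : (linInv w).1 = rVal w := rfl

theorem intCoef_linInv_a (k : ℤ) (w : SystemData ρ) : intCoef k (linInv w).2.1 =
    (if 2 ≤ k then coefF k w - coefG (-k) w else 0)
      + (bOne w + 1 / 2 * coefG 0 w) * (if k = 0 then 1 else 0)
      + (coefF 1 w + bEven w - 2 * bZero w + rVal w) * (if k = 1 then 1 else 0) := by
  have h : (linInv w).2.1 = aTail w + (bOne w + 1 / 2 * coefG 0 w) • Taylor.mono 0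
    + (coefF 1 w + bEven w - 2 * bZero w + rVal w) • Taylor.mono 1 := rfl
  rw [h, map_add, map_add, map_smul, map_smul, intCoef_aTail, intCoef_mono, intCoef_mono]
  rfl

theorem intCoef_linInv_b (k : ℤ) (w : SystemData ρ) : intCoef k (linInv w).2.2.1 =
    (if 3 ≤ k then -coefG (1 - k) w else 0) + bZero w * (if k = 0 then 1 else 0)
      + bOne w * (if k = 1 then 1 else 0) + (bEven w - bZero w) * (if k = 2 then 1 else 0) := by
  have h : (linInv w).2.2.1 = bTail w + bZero w • Taylor.mono 0 + bOne w • Taylor.mono 1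
    + (bEven w - bZero w) • Taylor.mono 2 := rfl
  rw [h, map_add, map_add, map_add, map_smul, map_smul, map_smul, intCoef_bTail, intCoef_mono,
    intCoef_mono, intCoef_mono]
  rfl

theorem intCoef_linInv_c (k : ℤ) (w : SystemData ρ) : intCoef k (linInv w).2.2.2 =
    (if 1 ≤ k then coefG (k + 1) w - 2 * coefF (k + 1) w + coefG (-(k + 1)) w else 0)
      + (-2 * w.2 - 4 * bZero w) * (if k = 0 then 1 else 0) := by
  have h : (linInv w).2.2.2 = cTail w + (-2 * w.2 - 4 * bZero w) • Taylor.mono 0 := rfl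
  rw [h, map_add, map_smul, intCoef_cTail, intCoef_mono]
  rfl

theorem bTail_eq_zero {w : SystemData ρ} (h : ∀ k ≤ -2, coefG k w = 0) : bTail w = 0 :=
  ext_intCoef fun k _ => by
    rw [intCoef_bTail, map_zero]
    exact ite_eq_right_iff.2 fun hk => by rw [h _ (by omega), neg_zero]

theorem isSolution_of_linInv_eq_zero {w : SystemData ρ} (h : linInv w = 0) : IsSolution w := by
  have ha := fun k => intCoef_linInv_a k w
  have hb := fun k => intCoef_linInv_b k w
  have hc := fun k => intCoef_linInv_c k w
  have hr : rVal w = 0 := (fst_linInv w).symm.trans (congrArg Prod.fst h)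
  simp only [h, Prod.fst_zero, Prod.snd_zero, map_zero] at ha hb hc
  have hbZero : bZero w = 0 := by simpa using (hb 0).symm
  have hbOne : bOne w = 0 := by simpa using (hb 1).symm
  have hbEven : bEven w = 0 := by simpa [hbZero] using (hb 2).symm
  have hG_neg : ∀ k ≤ -2, coefG k w = 0 := fun k hk => by
    have := hb (1 - k)
    rw [if_pos (by omega), if_neg (by omega), if_neg (by omega), if_neg (by omega)] at this
    simpa using this
  have hbTail : bTail w = 0 := bTail_eq_zero hG_neg
  have hG_zero : coefG 0 w = 0 := by simpa [hbOne] using (ha 0).symm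
  have hF_one : coefF 1 w = 0 := by simpa [hbEven, hbZero, hr] using (ha 1).symm
  have hF : ∀ k, 2 ≤ k → coefF k w = 0 := fun k hk => by
    simpa [hk, show k ≠ 0 by omega, show k ≠ 1 by omega, hG_neg (-k) (by omega)] using (ha k).symm
  have hsnd : w.2 = 0 := by simpa [hbZero] using (hc 0).symm
  have hG_neg_one : coefG (-1) w = 0 := by rwa [rVal_apply, hbEven, add_zero] at hr
  have hG_one : coefG 1 w = 0 := by
    rw [bZero_apply, hF_one, hbEven, hr, hsnd] at hbZero
    linarith
  have hG : ∀ k, 2 ≤ k → coefG k w = 0 := fun k hk => by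
    have := hc (k - 1)
    rw [if_pos (by omega), if_neg (by omega), sub_add_cancel, hF k hk, hG_neg (-k) (by omega)]
      at this
    simpa using this.symm
  rw [bEven_apply, hbTail, map_zero, sub_zero, add_zero] at hbEven
  rw [bOne_apply, hbTail, map_zero, sub_zero, add_zero] at hbOne
  refine ⟨fun k => ?_, fun k => ?_, by linarith, by linarith, hsnd⟩
  · refine coefF_eq_zero_of_pos (fun j hj => ?_) k
    rcases (by omega : j = 1 ∨ 2 ≤ j) with rfl | hj
    exacts [hF_one, hF j hj]
  · rcases le_or_gt k (-2) with hk | hk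
    · exact hG_neg k hk
    rcases le_or_gt 2 k with hk' | hk'
    · exact hG k hk'
    obtain rfl | rfl | rfl : k = -1 ∨ k = 0 ∨ k = 1 := by omega
    exacts [hG_neg_one, hG_zero, hG_one]

theorem IsSolution.linInv_eq_zero {w : SystemData ρ} (h : IsSolution w) : linInv w = 0 := by
  have hbTail : bTail w = 0 := bTail_eq_zero fun k _ => h.coefG_eq_zero k
  have hbEven : bEven w = 0 := by
    rw [bEven_apply, hbTail, map_zero, add_zero, sub_zero, h.valOne_eq_zero, h.valNegOne_eq_zero,
      sub_zero, mul_zero]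
  have hbOne : bOne w = 0 := by
    rw [bOne_apply, hbTail, map_zero, add_zero, sub_zero, h.valOne_eq_zero, h.valNegOne_eq_zero,
      add_zero, mul_zero]
  have hr : rVal w = 0 := by rw [rVal_apply, h.coefG_eq_zero, hbEven, add_zero]
  have hbZero : bZero w = 0 := by
    rw [bZero_apply, hbEven, hr, h.coefF_eq_zero, h.coefG_eq_zero, h.snd_eq_zero]
    norm_num
  refine Prod.ext hr (Prod.ext ?_ (Prod.ext ?_ ?_)) <;> refine ext_intCoef fun k _ => ?_
  · rw [intCoef_linInv_a]
    simp [h.coefF_eq_zero, h.coefG_eq_zero, hbEven, hbOne, hbZero, hr]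
  · rw [intCoef_linInv_b]
    simp [h.coefG_eq_zero, hbEven, hbOne, hbZero]
  · rw [intCoef_linInv_c]
    simp [h.coefF_eq_zero, h.coefG_eq_zero, hbZero, h.snd_eq_zero]

theorem linInv_eq_zero_iff {w : SystemData ρ} : linInv w = 0 ↔ IsSolution w :=
  ⟨isSolution_of_linInv_eq_zero, IsSolution.linInv_eq_zero⟩

/-! ### The linearisation at the central value -/

section ShearConjDeriv

variable {R : Type*} [CommRing R] [Algebra ℂ R] (u : ℂ) (M : Matrix (Fin 2) (Fin 2) R)

/-- The derivative of `shearConj u M` with respect to `u`. -/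
def shearConjDeriv : Matrix (Fin 2) (Fin 2) R :=
  (nilp R * M - M * nilp R) - (2 * u) • (nilp R * M * nilp R)

theorem shearConj_zero_zero : shearConj u M 0 0 = M 0 0 - u • M 0 1 := by
  simp [shearConj, nilp, mul_apply, vecMul, dotProduct, Fin.sum_univ_two, sub_eq_add_neg]

theorem shearConj_zero_one : shearConj u M 0 1 = M 0 1 := by
  simp [shearConj, nilp, mul_apply, vecMul, dotProduct, Fin.sum_univ_two]

theorem shearConj_one_zero :
    shearConj u M 1 0 = M 1 0 + u • (M 0 0 - M 1 1) - u ^ 2 • M 0 1 := by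
  simp [shearConj, nilp, mul_apply, vecMul, dotProduct, Fin.sum_univ_two]

theorem shearConjDeriv_zero_zero : shearConjDeriv u M 0 0 = -M 0 1 := by
  simp [shearConjDeriv, nilp, mul_apply, vecMul, dotProduct, Fin.sum_univ_two]

theorem shearConjDeriv_zero_one : shearConjDeriv u M 0 1 = 0 := by
  simp [shearConjDeriv, nilp, mul_apply, vecMul, dotProduct, Fin.sum_univ_two]

theorem shearConjDeriv_one_zero :
    shearConjDeriv u M 1 0 = M 0 0 - M 1 1 - (2 * u) • M 0 1 := by
  simp [shearConjDeriv, nilp, mul_apply, vecMul, dotProduct, Fin.sum_univ_two]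

end ShearConjDeriv

theorem hasDerivAt_shearConj {u : ℝ → ℂ} {u' : ℂ} {M : ℝ → LaurentMat ρ} {M' : LaurentMat ρ}
    {s : ℝ} (hu : HasDerivAt u u' s) (hM : HasDerivAt M M' s) :
    HasDerivAt (fun s => shearConj (u s) (M s))
      (shearConj (u s) M' + u' • shearConjDeriv (u s) (M s)) s := by
  have hbracket := (hM.const_mul (nilp (Laurent ρ))).sub (hM.mul_const (nilp (Laurent ρ)))
  have hsquare := (hM.const_mul (nilp (Laurent ρ))).mul_const (nilp (Laurent ρ))
  refine ((hM.add (hu.smul hbracket)).sub ((hu.pow 2).smul hsquare)).congr_deriv ?_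
  simp only [shearConj, shearConjDeriv, Pi.pow_apply, Pi.sub_apply]
  simp only [Nat.cast_ofNat, Nat.add_one_sub_one, pow_one]
  module

theorem contDiff_central : ContDiff ℝ 1 (central (ρ := ρ)) := by
  have hr : ContDiff ℝ 1 fun y : ParamSpace ρ => (y.1 : ℂ) := ofRealCLM.contDiff.comp contDiff_fst
  have hA : ContDiff ℝ 1 (residueZero (ρ := ρ)) := residueZero.contDiff
  exact (hA.add (hr.smul ((contDiff_const.mul hA).sub (hA.mul contDiff_const)))).sub
    ((hr.pow 2).smul ((contDiff_const.mul hA).mul contDiff_const))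

theorem residueZero_apply (y : ParamSpace ρ) :
    residueZero y = !![y.2.1.toLaurent, Laurent.mono (-1) * y.2.2.1.toLaurent;
      Laurent.mono 1 * y.2.2.2.toLaurent, -y.2.1.toLaurent] := rfl

theorem reCoef_central_zero_zero (k : ℤ) (y : ParamSpace ρ) :
    reCoef k (central y 0 0) = intCoef k y.2.1 - y.1 * intCoef (k + 1) y.2.2.1 := by
  simp [central, shearConj_zero_zero, residueZero_apply, intCoef_apply, reCoef_mono_mul]

theorem central_zero_one (y : ParamSpace ρ) :
    central y 0 1 = Laurent.mono (-1) * y.2.2.1.toLaurent := by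
  simp [central, shearConj_zero_one, residueZero_apply]

theorem reCoef_central_one_zero (k : ℤ) (y : ParamSpace ρ) :
    reCoef k (central y 1 0) = intCoef (k - 1) y.2.2.2 + 2 * y.1 * intCoef k y.2.1
      - y.1 ^ 2 * intCoef (k + 1) y.2.2.1 := by
  rw [central, shearConj_one_zero, ← Complex.ofReal_pow, Complex.coe_smul, Complex.coe_smul]
  simp [residueZero_apply, intCoef_apply, reCoef_mono_mul]
  ring

/-- The left-hand side `𝒦 - 1` of the normalisation equation. -/
def normDefect (y : ParamSpace ρ) : ℝ :=
  intCoef 0 y.2.1 ^ 2 + intCoef 0 y.2.2.1 * intCoef 0 y.2.2.2 - 1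

theorem contDiff_normDefect : ContDiff ℝ 1 (normDefect (ρ := ρ)) := by
  have h := (intCoef (ρ := ρ) 0).contDiff (n := 1)
  exact (((h.comp contDiff_snd.fst).pow 2).add
    ((h.comp contDiff_snd.snd.fst).mul (h.comp contDiff_snd.snd.snd))).sub contDiff_const

theorem intCoef_centre_a (k : ℤ) : intCoef k (centre ρ).2.1 = if k = 1 then 1 else 0 := by
  rw [centre_a, intCoef_mono, Nat.cast_one]

theorem intCoef_centre_b (k : ℤ) : intCoef k (centre ρ).2.2.1 =
    -1 / 2 * (if k = 0 then 1 else 0) + 1 / 2 * (if k = 2 then 1 else 0) := by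
  rw [centre_b, map_add, map_smul, map_smul, intCoef_mono, intCoef_mono]
  rfl

theorem intCoef_centre_c (k : ℤ) :
    intCoef k (centre ρ).2.2.2 = -2 * (if k = 0 then 1 else 0) := by
  rw [centre_c, map_smul, intCoef_mono]
  rfl

/-- The limit of the system for `t → 0`. -/
def limitData (y : ParamSpace ρ) : SystemData ρ := (central y, normDefect y)

theorem contDiff_limitData : ContDiff ℝ 1 (limitData (ρ := ρ)) :=
  contDiff_central.prodMk contDiff_normDefect

theorem isSolution_limitData_centre : IsSolution (limitData (centre ρ)) where
  coefF_eq_zero k := by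
    rw [coefF_apply, limitData, entry_mk, reCoef_central_zero_zero, reCoef_central_zero_zero,
      intCoef_centre_a, intCoef_centre_b, intCoef_centre_a, intCoef_centre_b, centre_r]
    split_ifs <;> first | omega | norm_num
  coefG_eq_zero k := by
    rw [coefG_apply, limitData, entry_mk, entry_mk, reCoef_central_one_zero,
      central_zero_one, reCoef_mono_mul, ← intCoef_apply, intCoef_centre_a, intCoef_centre_b,
      intCoef_centre_b, intCoef_centre_c, centre_r]
    split_ifs <;> first | omega | norm_num
  valOne_eq_zero := by
    rw [limitData, entry_mk, central_zero_one, valOne_mono_mul, centre_b]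
    rw [map_add, map_add, map_smul toLaurent, map_smul toLaurent, toLaurent_mono, toLaurent_mono,
      valOne_smul_mono, valOne_smul_mono]
    norm_num
  valNegOne_eq_zero := by
    rw [limitData, entry_mk, central_zero_one, valNegOne_mono_neg_one_mul, centre_b]
    rw [map_add, map_add, map_smul toLaurent, map_smul toLaurent, toLaurent_mono, toLaurent_mono,
      valNegOne_smul_mono, valNegOne_smul_mono]
    norm_num
  snd_eq_zero := by
    rw [limitData, normDefect, intCoef_centre_a, intCoef_centre_b, intCoef_centre_c]
    norm_num

/-- The derivative of `limitData` at the central value in the direction `v`. -/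
def limitDeriv (v : ParamSpace ρ) : SystemData ρ :=
  (shearConj 1 (residueZero v) + (v.1 : ℂ) • shearConjDeriv 1 (residueZero (centre ρ)),
    -2 * intCoef 0 v.2.2.1 - 1 / 2 * intCoef 0 v.2.2.2)

theorem hasDerivAt_line {E F : Type*} [NormedAddCommGroup E] [NormedSpace ℝ E]
    [NormedAddCommGroup F] [NormedSpace ℝ F] (f : E →L[ℝ] F) (x v : E) :
    HasDerivAt (fun s : ℝ => f (x + s • v)) (f v) 0 := by
  have h : HasDerivAt (fun s : ℝ => x + s • v) v 0 := by
    simpa using ((hasDerivAt_id (0 : ℝ)).smul_const v).const_add x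
  exact f.hasFDerivAt.comp_hasDerivAt 0 h

theorem hasDerivAt_normDefect_line (v : ParamSpace ρ) :
    HasDerivAt (fun s : ℝ => normDefect (centre ρ + s • v))
      (-2 * intCoef 0 v.2.2.1 - 1 / 2 * intCoef 0 v.2.2.2) 0 := by
  have ha := hasDerivAt_line (intCoef (ρ := ρ) 0 ∘L .fst ℝ _ _ ∘L .snd ℝ _ _) (centre ρ) v
  have hb := hasDerivAt_line
    (intCoef (ρ := ρ) 0 ∘L .fst ℝ _ _ ∘L .snd ℝ _ _ ∘L .snd ℝ _ _) (centre ρ) v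
  have hc := hasDerivAt_line
    (intCoef (ρ := ρ) 0 ∘L .snd ℝ _ _ ∘L .snd ℝ _ _ ∘L .snd ℝ _ _) (centre ρ) v
  refine (((ha.pow 2).add (hb.mul hc)).sub_const 1).congr_deriv ?_
  have hzero : centre ρ + (0 : ℝ) • v = centre ρ :=
    (congrArg _ (zero_smul ℝ v)).trans (add_zero _)
  simp only [hzero, ContinuousLinearMap.comp_apply, ContinuousLinearMap.coe_fst',
    ContinuousLinearMap.coe_snd', intCoef_centre_a, intCoef_centre_b, intCoef_centre_c]
  norm_num
  ring

theorem hasDerivAt_limitData_line (v : ParamSpace ρ) :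
    HasDerivAt (fun s : ℝ => limitData (centre ρ + s • v)) (limitDeriv v) 0 := by
  have hr : HasDerivAt (fun s : ℝ => ((centre ρ + s • v).1 : ℂ)) v.1 0 :=
    hasDerivAt_line (ofRealCLM ∘L .fst ℝ ℝ (Taylor ρ × Taylor ρ × Taylor ρ)) (centre ρ) v
  have hcentral := hasDerivAt_shearConj hr (hasDerivAt_line (residueZero (ρ := ρ)) (centre ρ) v)
  have hzero : centre ρ + (0 : ℝ) • v = centre ρ :=
    (congrArg _ (zero_smul ℝ v)).trans (add_zero _)
  rw [hzero, centre_r, ofReal_one] at hcentral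
  exact hcentral.prodMk (hasDerivAt_normDefect_line v)

theorem reCoef_limitDeriv_zero_zero (k : ℤ) (v : ParamSpace ρ) :
    reCoef k (entry 0 0 (limitDeriv v)) = intCoef k v.2.1 - intCoef (k + 1) v.2.2.1
      - 1 / 2 * v.1 * ((if k = 1 then 1 else 0) - (if k = -1 then 1 else 0)) := by
  rw [limitDeriv, entry_mk, Matrix.add_apply, Matrix.smul_apply, shearConj_zero_zero,
    shearConjDeriv_zero_zero, Complex.coe_smul, map_add, map_smul]
  simp only [residueZero_apply, of_apply, cons_val', cons_val_zero, cons_val_one, cons_val_fin_one,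
    one_smul, map_sub, map_neg, reCoef_mono_mul, sub_neg_eq_add, ← intCoef_apply,
    intCoef_centre_b, smul_eq_mul]
  split_ifs <;> first | omega | ring

theorem entry_limitDeriv_zero_one (v : ParamSpace ρ) :
    entry 0 1 (limitDeriv v) = Laurent.mono (-1) * v.2.2.1.toLaurent := by
  simp [limitDeriv, entry_mk, shearConj_zero_one, shearConjDeriv_zero_one, residueZero_apply]

theorem reCoef_limitDeriv_one_zero (k : ℤ) (v : ParamSpace ρ) :
    reCoef k (entry 1 0 (limitDeriv v)) =
      intCoef (k - 1) v.2.2.2 + 2 * intCoef k v.2.1 - intCoef (k + 1) v.2.2.1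
        + v.1 * ((if k = 1 then 1 else 0) + (if k = -1 then 1 else 0)) := by
  rw [limitDeriv, entry_mk, Matrix.add_apply, Matrix.smul_apply, shearConj_one_zero,
    shearConjDeriv_one_zero, Complex.coe_smul, map_add, map_smul, mul_one, two_smul ℂ]
  simp only [residueZero_apply, of_apply, cons_val', cons_val_zero, cons_val_one, cons_val_fin_one,
    one_smul, one_pow, map_add, map_sub, reCoef_mono_mul, sub_neg_eq_add, ← intCoef_apply,
    intCoef_centre_a, intCoef_centre_b, smul_eq_mul]
  split_ifs <;> first | omega | ring

theorem coefF_limitDeriv (k : ℤ) (v : ParamSpace ρ) : coefF k (limitDeriv v) =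
    intCoef k v.2.1 - intCoef (k + 1) v.2.2.1 - (intCoef (-k) v.2.1 - intCoef (1 - k) v.2.2.1)
      - v.1 * ((if k = 1 then 1 else 0) - (if k = -1 then 1 else 0)) := by
  rw [coefF_apply, reCoef_limitDeriv_zero_zero, reCoef_limitDeriv_zero_zero, neg_add_eq_sub]
  split_ifs <;> first | omega | ring

theorem coefG_limitDeriv (k : ℤ) (v : ParamSpace ρ) : coefG k (limitDeriv v) =
    intCoef (k - 1) v.2.2.2 + 2 * intCoef k v.2.1 - intCoef (k + 1) v.2.2.1
      - intCoef (1 - k) v.2.2.1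
      + v.1 * ((if k = 1 then 1 else 0) + (if k = -1 then 1 else 0)) := by
  rw [coefG_apply, reCoef_limitDeriv_one_zero, entry_limitDeriv_zero_one, reCoef_mono_mul,
    ← intCoef_apply, sub_neg_eq_add, neg_add_eq_sub]
  ring

theorem bTail_limitDeriv (v : ParamSpace ρ) :
    bTail (limitDeriv v) + intCoef 0 v.2.2.1 • Taylor.mono 0 + intCoef 1 v.2.2.1 • Taylor.mono 1
      + intCoef 2 v.2.2.1 • Taylor.mono 2 = v.2.2.1 := by
  refine ext_intCoef fun k hk => ?_
  rw [map_add, map_add, map_add, map_smul, map_smul, map_smul, intCoef_bTail, intCoef_mono,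
    intCoef_mono, intCoef_mono, coefG_limitDeriv, sub_sub_cancel]
  obtain rfl | rfl | rfl | hk : k = 0 ∨ k = 1 ∨ k = 2 ∨ 3 ≤ k := by omega
  · simp
  · simp
  · simp
  · simp (disch := omega) only [if_pos, if_neg, intCoef_of_neg, Nat.cast_zero, Nat.cast_one,
      Nat.cast_ofNat, smul_zero]
    ring

theorem valOne_b (v : ParamSpace ρ) : valOne v.2.2.1.toLaurent =
    valOne (bTail (limitDeriv v)).toLaurent
      + intCoef 0 v.2.2.1 + intCoef 1 v.2.2.1 + intCoef 2 v.2.2.1 := by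
  conv_lhs => rw [← bTail_limitDeriv v]
  simp only [map_add, map_smul toLaurent, toLaurent_mono, valOne_smul_mono]

theorem valNegOne_b (v : ParamSpace ρ) : valNegOne v.2.2.1.toLaurent =
    valNegOne (bTail (limitDeriv v)).toLaurent
      + intCoef 0 v.2.2.1 - intCoef 1 v.2.2.1 + intCoef 2 v.2.2.1 := by
  conv_lhs => rw [← bTail_limitDeriv v]
  simp only [map_add, map_smul toLaurent, toLaurent_mono, valNegOne_smul_mono]
  norm_num
  ring

theorem bEven_limitDeriv (v : ParamSpace ρ) :
    bEven (limitDeriv v) = intCoef 0 v.2.2.1 + intCoef 2 v.2.2.1 := by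
  rw [bEven_apply, entry_limitDeriv_zero_one, map_sub, map_add, valOne_mono_mul,
    valNegOne_mono_neg_one_mul, valOne_b, valNegOne_b]
  ring

theorem bOne_limitDeriv (v : ParamSpace ρ) : bOne (limitDeriv v) = intCoef 1 v.2.2.1 := by
  rw [bOne_apply, entry_limitDeriv_zero_one, map_sub, map_add, valOne_mono_mul,
    valNegOne_mono_neg_one_mul, valOne_b, valNegOne_b]
  ring

theorem rVal_limitDeriv (v : ParamSpace ρ) : rVal (limitDeriv v) = v.1 := by
  rw [rVal_apply, bEven_limitDeriv, coefG_limitDeriv]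
  norm_num [intCoef_of_neg]
  ring

theorem coefF_one_limitDeriv (v : ParamSpace ρ) : coefF 1 (limitDeriv v) =
    intCoef 1 v.2.1 - intCoef 2 v.2.2.1 + intCoef 0 v.2.2.1 - v.1 := by
  rw [coefF_limitDeriv]
  simp [intCoef_of_neg, sub_add]

theorem bZero_limitDeriv (v : ParamSpace ρ) : bZero (limitDeriv v) = intCoef 0 v.2.2.1 := by
  rw [bZero_apply, bEven_limitDeriv, rVal_limitDeriv, coefF_one_limitDeriv, coefG_limitDeriv,
    limitDeriv]
  norm_num
  ring

theorem linInv_limitDeriv (v : ParamSpace ρ) : linInv (limitDeriv v) = v := by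
  refine Prod.ext (rVal_limitDeriv v) (Prod.ext ?_ (Prod.ext ?_ ?_)) <;>
    refine ext_intCoef fun k hk => ?_
  · rw [intCoef_linInv_a, bOne_limitDeriv, coefF_one_limitDeriv, bEven_limitDeriv,
      bZero_limitDeriv, rVal_limitDeriv, coefF_limitDeriv, coefG_limitDeriv, coefG_limitDeriv]
    obtain rfl | rfl | hk : k = 0 ∨ k = 1 ∨ 2 ≤ k := by omega
    · simp [intCoef_of_neg]
      ring
    · simp
      ring
    · simp (disch := omega) only [if_pos, if_neg, intCoef_of_neg]
      ring_nf
  · rw [intCoef_linInv_b, bOne_limitDeriv, bEven_limitDeriv, bZero_limitDeriv]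
    conv_rhs => rw [← bTail_limitDeriv v]
    simp [intCoef_bTail, intCoef_mono]
  · rw [intCoef_linInv_c, bZero_limitDeriv, coefF_limitDeriv, coefG_limitDeriv, coefG_limitDeriv]
    obtain rfl | hk : k = 0 ∨ 1 ≤ k := by omega
    · simp [limitDeriv]
      ring
    · simp (disch := omega) only [if_pos, if_neg, intCoef_of_neg]
      ring_nf

variable (ρ) in
/-- The limit of the system for `t → 0`, composed with the inverse of its linearisation. -/
def limitMap (y : ParamSpace ρ) : ParamSpace ρ := linInv (limitData y)

theorem limitMap_centre : limitMap ρ (centre ρ) = 0 :=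
  isSolution_limitData_centre.linInv_eq_zero

theorem hasStrictFDerivAt_limitMap :
    HasStrictFDerivAt (limitMap ρ) (ContinuousLinearMap.id ℝ (ParamSpace ρ)) (centre ρ) := by
  have hcontDiff : ContDiff ℝ 1 (limitMap ρ) := linInv.contDiff.comp contDiff_limitData
  have hstrict := hcontDiff.contDiffAt.hasStrictFDerivAt (x := centre ρ) one_ne_zero
  suffices h : fderiv ℝ (limitMap ρ) (centre ρ) = .id ℝ (ParamSpace ρ) by rwa [h] at hstrict
  refine ContinuousLinearMap.ext fun v => ?_
  have hline : HasLineDerivAt ℝ (limitMap ρ) v (centre ρ) v := by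
    have h := linInv.hasFDerivAt.comp_hasDerivAt 0 (hasDerivAt_limitData_line v)
    exact h.congr_deriv (linInv_limitDeriv v)
  exact (hstrict.hasFDerivAt.hasLineDerivAt v).unique hline

/-! ### Existence and uniqueness of the solution -/

theorem existsUnique_zero_of_approx_id {E : Type*} [NormedAddCommGroup E] [CompleteSpace E]
    {f : E → E} {x : E} {δ : ℝ} (hδ : 0 < δ)
    (hf : ∀ y ∈ Metric.ball x δ, ∀ z ∈ Metric.ball x δ,
      ‖f y - f z - (y - z)‖ ≤ 1 / 2 * ‖y - z‖)
    (hx : ‖f x‖ < δ / 4) : ∃! y, y ∈ Metric.ball x δ ∧ f y = 0 := by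
  set s := Metric.closedBall x (3 / 4 * δ) with hs
  have hsub : s ⊆ Metric.ball x δ := Metric.closedBall_subset_ball (by linarith)
  have hxs : x ∈ s := Metric.mem_closedBall_self (by linarith)
  have hdist : ∀ y ∈ Metric.ball x δ, ∀ z ∈ Metric.ball x δ,
      dist (y - f y) (z - f z) ≤ 1 / 2 * dist y z := fun y hy z hz => by
    rw [dist_eq_norm, dist_eq_norm, sub_sub_sub_comm, norm_sub_rev]
    exact hf y hy z hz
  have hmaps : MapsTo (fun y => y - f y) s s := fun y hy => by
    have hcontract := hdist y (hsub hy) x (hsub hxs)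
    have hmove : dist (x - f x) x = ‖f x‖ := by rw [dist_eq_norm, sub_sub_cancel_left, norm_neg]
    have htriangle := dist_triangle (y - f y) (x - f x) x
    rw [hs, Metric.mem_closedBall] at hy ⊢
    linarith
  have hcontracting : ContractingWith (1 / 2) (hmaps.restrict (fun y => y - f y) s s) := by
    refine ⟨by norm_num, LipschitzWith.of_dist_le_mul fun y z => ?_⟩
    rw [show ((1 / 2 : NNReal) : ℝ) = 1 / 2 by norm_num]
    exact hdist y (hsub y.2) z (hsub z.2)
  obtain ⟨y, hys, hy, -⟩ := hcontracting.exists_fixedPoint' Metric.isClosed_closedBall.isComplete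
    hmaps hxs (edist_ne_top _ _)
  have hfy : f y = 0 := sub_eq_self.1 hy
  refine ⟨y, ⟨hsub hys, hfy⟩, fun z hz => ?_⟩
  have hzy := hf z hz.1 y (hsub hys)
  rw [hz.2, hfy, sub_zero, zero_sub, norm_neg] at hzy
  have hnorm : ‖z - y‖ = 0 := by linarith [norm_nonneg (z - y)]
  exact sub_eq_zero.1 (norm_eq_zero.1 hnorm)

theorem existsUnique_zero_of_perturbation {E : Type*} [NormedAddCommGroup E]
    [NormedSpace ℝ E] [CompleteSpace E] {g : E → E} {x : E}
    (hg : HasStrictFDerivAt g (ContinuousLinearMap.id ℝ E) x) (hgx : g x = 0) :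
    ∃ δ₀ > 0, ∀ δ, 0 < δ → δ ≤ δ₀ → ∃ c > 0, ∀ f : E → E,
      (∀ y ∈ Metric.ball x δ, ∀ z ∈ Metric.ball x δ,
        ‖f y - g y - (f z - g z)‖ ≤ c * ‖y - z‖) → ‖f x - g x‖ ≤ c →
      ∃! y, y ∈ Metric.ball x δ ∧ f y = 0 := by
  obtain ⟨s, hs, happrox⟩ := hg.approximates_deriv_on_nhds (c := 1 / 4) (Or.inr (by norm_num))
  obtain ⟨δ₀, hδ₀, hball⟩ := Metric.mem_nhds_iff.1 hs
  refine ⟨δ₀, hδ₀, fun δ hδ hδδ₀ => ⟨min (1 / 4) (δ / 8), by positivity, fun f hf hfx => ?_⟩⟩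
  refine existsUnique_zero_of_approx_id hδ (fun y hy z hz => ?_) ?_
  · have hgyz := happrox y (hball (Metric.ball_subset_ball hδδ₀ hy))
      z (hball (Metric.ball_subset_ball hδδ₀ hz))
    have hquarter : ((1 / 4 : NNReal) : ℝ) = 1 / 4 := by norm_num
    rw [hquarter, ContinuousLinearMap.id_apply] at hgyz
    calc ‖f y - f z - (y - z)‖
        = ‖f y - g y - (f z - g z) + (g y - g z - (y - z))‖ := by congr 1; abel
      _ ≤ min (1 / 4) (δ / 8) * ‖y - z‖ + 1 / 4 * ‖y - z‖ :=
          (norm_add_le _ _).trans (add_le_add (hf y hy z hz) hgyz)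
      _ ≤ 1 / 4 * ‖y - z‖ + 1 / 4 * ‖y - z‖ := by gcongr; exact min_le_left _ _
      _ = 1 / 2 * ‖y - z‖ := by ring
  · rw [hgx, sub_zero] at hfx
    linarith [min_le_right (1 / 4) (δ / 8)]

variable (ρ) in
/-- The logarithm of the monodromy along `γ_0`, divided by `2πit`. -/
def monLog (m : ℕ) (t : ℝ) (y : ParamSpace ρ) : LaurentMat ρ :=
  (2 * Real.pi * I * t : ℂ)⁻¹ • odeLog ((t : ℂ) • gauged m y)

variable (ρ) in
/-- The system, composed with the inverse of its linearisation at the central value. -/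
def systemMap (m : ℕ) (t : ℝ) (y : ParamSpace ρ) : ParamSpace ρ :=
  linInv (monLog ρ m t y, normDefect y)

theorem systemMap_sub_limitMap (m : ℕ) (t : ℝ) (y : ParamSpace ρ) :
    systemMap ρ m t y - limitMap ρ y = linInv (monLog ρ m t y - central y, 0) := by
  rw [systemMap, limitMap, limitData, ← map_sub, Prod.mk_sub_mk, sub_self]

theorem norm_inv_smul_odeLog_sub_le {𝔸 : Type*} [NormedRing 𝔸] [NormedAlgebra ℂ 𝔸]
    [CompleteSpace 𝔸] {t c : ℝ} (ht : t ≠ 0) (hc : 0 ≤ c) {B B' : PathAlg 𝔸} {N N' : 𝔸}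
    (hN : totalInt B = (2 * Real.pi * I : ℂ) • N) (hN' : totalInt B' = (2 * Real.pi * I : ℂ) • N')
    (h : ‖odeLog ((t : ℂ) • B) - odeLog ((t : ℂ) • B') - totalInt ((t : ℂ) • B - (t : ℂ) • B')‖
      ≤ c * ‖(t : ℂ) • B - (t : ℂ) • B'‖) :
    ‖(2 * Real.pi * I * t : ℂ)⁻¹ • odeLog ((t : ℂ) • B) - N
      - ((2 * Real.pi * I * t : ℂ)⁻¹ • odeLog ((t : ℂ) • B') - N')‖ ≤ c * ‖B - B'‖ := by
  have hne : (2 * Real.pi * I * t : ℂ) ≠ 0 := by simp [Real.pi_ne_zero, ht]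
  have hnorm : ‖(2 * Real.pi * I * t : ℂ)‖ = 2 * Real.pi * |t| := by
    simp [abs_of_pos Real.pi_pos]
  have hint : totalInt ((t : ℂ) • B - (t : ℂ) • B') = (2 * Real.pi * I * t : ℂ) • (N - N') := by
    rw [map_sub, map_smul, map_smul, hN, hN']
    module
  have hfactor : (2 * Real.pi * I * t : ℂ)⁻¹ • odeLog ((t : ℂ) • B) - N
      - ((2 * Real.pi * I * t : ℂ)⁻¹ • odeLog ((t : ℂ) • B') - N')
      = (2 * Real.pi * I * t : ℂ)⁻¹ • (odeLog ((t : ℂ) • B) - odeLog ((t : ℂ) • B')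
        - totalInt ((t : ℂ) • B - (t : ℂ) • B')) := by
    rw [hint, smul_sub _ _ ((_ : ℂ) • _), inv_smul_smul₀ hne]
    module
  rw [hfactor, norm_smul, norm_inv, hnorm, inv_mul_le_iff₀ (by positivity)]
  have hscale : ‖(t : ℂ) • B - (t : ℂ) • B'‖ = |t| * ‖B - B'‖ := by
    rw [← smul_sub, norm_smul, Complex.norm_real, Real.norm_eq_abs]
  rw [hscale] at h
  have hpi : 1 ≤ 2 * Real.pi := by linarith [Real.pi_gt_three]
  calc _ ≤ c * (|t| * ‖B - B'‖) := h
    _ ≤ 2 * Real.pi * (c * (|t| * ‖B - B'‖)) := le_mul_of_one_le_left (by positivity) hpi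
    _ = 2 * Real.pi * |t| * (c * ‖B - B'‖) := by ring

variable (ρ) in
theorem exists_gauged_bound (m : ℕ) : ∃ δ > 0, ∃ C > 0, ∀ y ∈ Metric.ball (centre ρ) δ,
    ‖gauged m y‖ ≤ C ∧ ∀ z ∈ Metric.ball (centre ρ) δ,
      ‖gauged m y - gauged m z‖ ≤ C * ‖y - z‖ := by
  obtain ⟨K, u, hu, hlipschitz⟩ :=
    ((contDiff_gauged m).contDiffAt (x := centre ρ)).exists_lipschitzOnWith
  obtain ⟨δ, hδ, hball⟩ := Metric.mem_nhds_iff.1 hu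
  have hcentre : centre ρ ∈ Metric.ball (centre ρ) δ := Metric.mem_ball_self hδ
  set C := 1 + ‖gauged m (centre ρ)‖ + K * (1 + δ)
  refine ⟨δ, hδ, C, by positivity, fun y hy => ⟨?_, fun z hz => ?_⟩⟩
  · have hdiff := hlipschitz.norm_sub_le (hball hy) (hball hcentre)
    have hK : K * ‖y - centre ρ‖ ≤ K * δ := by gcongr; exact (mem_ball_iff_norm.1 hy).le
    linarith [norm_sub_norm_le (gauged m y) (gauged m (centre ρ)), K.2]
  · refine (hlipschitz.norm_sub_le (hball hy) (hball hz)).trans ?_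
    gcongr
    nlinarith [norm_nonneg (gauged m (centre ρ)), mul_nonneg K.2 hδ.le]

variable (ρ) in
theorem exists_monLog_sub_central_le (m : ℕ) : ∃ δ > 0, ∀ c > 0, ∃ ε > 0, ∀ t : ℝ, t ≠ 0 →
    |t| < ε → ∀ y ∈ Metric.ball (centre ρ) δ,
      (‖(t : ℂ) • gauged m y‖ < 1 ∧ ‖odeEnd ((t : ℂ) • gauged m y) - 1‖ < 1 / 4) ∧
      ‖monLog ρ m t y - central y‖ ≤ c ∧ ∀ z ∈ Metric.ball (centre ρ) δ,
        ‖monLog ρ m t y - central y - (monLog ρ m t z - central z)‖ ≤ c * ‖y - z‖ := by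
  obtain ⟨δ, hδ, C, hC, hbound⟩ := exists_gauged_bound ρ m
  refine ⟨δ, hδ, fun c hc => ?_⟩
  obtain ⟨r, hr, hr1, happrox⟩ := exists_odeLog_approx (𝔸 := LaurentMat ρ) (div_pos hc hC)
    (show (0 : ℝ) < 1 / 4 by norm_num)
  obtain ⟨ε, hε, hεr⟩ := exists_pos_mul_lt hr C
  refine ⟨ε, hε, fun t ht htε y hy => ?_⟩
  have hsmall : ∀ y ∈ Metric.ball (centre ρ) δ, ‖(t : ℂ) • gauged m y‖ < r := fun y hy => by
    rw [norm_smul, Complex.norm_real, Real.norm_eq_abs]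
    calc |t| * ‖gauged m y‖ ≤ ε * C := by gcongr; exact (hbound y hy).1
      _ < r := by rwa [mul_comm]
  have hc' : 0 ≤ c / C := by positivity
  refine ⟨⟨(hsmall y hy).trans_le hr1, (happrox _ _ (hsmall y hy) (hsmall y hy)).1⟩, ?_,
    fun z hz => ?_⟩
  · have hzero : totalInt (0 : PathAlg (LaurentMat ρ)) =
        (2 * Real.pi * I : ℂ) • (0 : LaurentMat ρ) := by
      rw [map_zero]
      module
    have h := norm_inv_smul_odeLog_sub_le ht hc' (totalInt_gauged m y) hzero
      (happrox _ _ (hsmall y hy) (by rwa [smul_zero, norm_zero])).2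
    rw [smul_zero, odeLog_zero, smul_zero, sub_zero, sub_zero, sub_zero] at h
    calc ‖monLog ρ m t y - central y‖ ≤ c / C * ‖gauged m y‖ := h
      _ ≤ c / C * C := by gcongr; exact (hbound y hy).1
      _ = c := div_mul_cancel₀ c hC.ne'
  · calc ‖monLog ρ m t y - central y - (monLog ρ m t z - central z)‖
        ≤ c / C * ‖gauged m y - gauged m z‖ :=
          norm_inv_smul_odeLog_sub_le ht hc' (totalInt_gauged m y) (totalInt_gauged m z)
            (happrox _ _ (hsmall y hy) (hsmall z hz)).2
      _ ≤ c / C * (C * ‖y - z‖) := by gcongr; exact (hbound y hy).2 z hz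
      _ = c * ‖y - z‖ := by rw [← mul_assoc, div_mul_cancel₀ c hC.ne']

variable (ρ) in
theorem exists_systemMap_sub_limitMap_le (m : ℕ) : ∃ δ > 0, ∀ c > 0, ∃ ε > 0, ∀ t : ℝ, t ≠ 0 →
    |t| < ε → ∀ y ∈ Metric.ball (centre ρ) δ,
      (‖(t : ℂ) • gauged m y‖ < 1 ∧ ‖odeEnd ((t : ℂ) • gauged m y) - 1‖ < 1 / 4) ∧
      ‖systemMap ρ m t y - limitMap ρ y‖ ≤ c ∧ ∀ z ∈ Metric.ball (centre ρ) δ,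
        ‖systemMap ρ m t y - limitMap ρ y - (systemMap ρ m t z - limitMap ρ z)‖
          ≤ c * ‖y - z‖ := by
  obtain ⟨N, hN, hlinInv⟩ := (linInv (ρ := ρ)).bound
  have hbound : ∀ {M : LaurentMat ρ} {s : ℝ}, ‖M‖ ≤ s → ‖linInv (M, 0)‖ ≤ N * s :=
    fun {M s} hM => by
      refine (hlinInv (M, 0)).trans ?_
      rw [Prod.norm_mk, norm_zero, max_eq_left (norm_nonneg M)]
      gcongr
  obtain ⟨δ, hδ, hmonLog⟩ := exists_monLog_sub_central_le ρ m
  refine ⟨δ, hδ, fun c hc => ?_⟩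
  obtain ⟨ε, hε, hlip⟩ := hmonLog (c / N) (div_pos hc hN)
  refine ⟨ε, hε, fun t ht htε y hy => ?_⟩
  obtain ⟨hsmall, hnorm, hsub⟩ := hlip t ht htε y hy
  refine ⟨hsmall, ?_, fun z hz => ?_⟩
  · rw [systemMap_sub_limitMap, ← mul_div_cancel₀ c hN.ne']
    exact hbound hnorm
  · rw [systemMap_sub_limitMap, systemMap_sub_limitMap, ← map_sub, Prod.mk_sub_mk, sub_zero]
    refine (hbound (hsub z hz)).trans_eq ?_
    rw [← mul_assoc, mul_div_cancel₀ c hN.ne']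

variable (ρ) in
theorem exists_existsUnique_zero_systemMap (m : ℕ) : ∃ δ₀ > 0, ∀ δ, 0 < δ → δ ≤ δ₀ →
    ∃ ε > 0, ∀ t : ℝ, t ≠ 0 → |t| < ε →
      (∃! y, y ∈ Metric.ball (centre ρ) δ ∧ systemMap ρ m t y = 0) ∧
      ∀ y ∈ Metric.ball (centre ρ) δ, ‖(t : ℂ) • gauged m y‖ < 1 ∧
        ‖odeEnd ((t : ℂ) • gauged m y) - 1‖ < 1 / 4 := by
  obtain ⟨δ₁, hδ₁, hunique⟩ := existsUnique_zero_of_perturbation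
    (hasStrictFDerivAt_limitMap (ρ := ρ)) limitMap_centre
  obtain ⟨δ₂, hδ₂, hperturb⟩ := exists_systemMap_sub_limitMap_le ρ m
  refine ⟨min δ₁ δ₂, lt_min hδ₁ hδ₂, fun δ hδ hδδ₀ => ?_⟩
  have hsub : Metric.ball (centre ρ) δ ⊆ Metric.ball (centre ρ) δ₂ :=
    Metric.ball_subset_ball (hδδ₀.trans (min_le_right _ _))
  obtain ⟨c, hc, hzero⟩ := hunique δ hδ (hδδ₀.trans (min_le_left _ _))
  obtain ⟨ε, hε, hbound⟩ := hperturb c hc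
  refine ⟨ε, hε, fun t ht htε => ?_⟩
  have hsystem := fun y hy => hbound t ht htε y (hsub hy)
  exact ⟨hzero (systemMap ρ m t) (fun y hy z hz => (hsystem y hy).2.2 z (hsub hz))
    (hsystem _ (Metric.mem_ball_self hδ)).2.1, fun y hy => (hsystem y hy).1⟩

end System

/-! ### The constant coefficient of the determinant -/

open Laurent Taylor

section Evaluation

variable {ρ : ℝ}

theorem ev_zero (f : WienerPos ρ) : ev f 0 = f.1 0 := by
  rw [ev, tsum_eq_single 0 fun k hk => by rw [zero_pow hk, mul_zero], pow_zero, mul_one]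

theorem norm_coef_mul_pow_le (f : WienerPos ρ) (k : ℕ) {μ : ℂ} (hμ : ‖μ‖ ≤ 1) :
    ‖(f.1 k : ℂ) * μ ^ k‖ ≤ |f.1 k| := by
  rw [norm_mul, norm_pow, norm_real, Real.norm_eq_abs]
  exact mul_le_of_le_one_right (abs_nonneg _) (pow_le_one₀ (norm_nonneg μ) hμ)

theorem det_A_zero (m : ℕ) (x : Param ρ) {μ : ℂ} (hμ : μ ≠ 0) :
    (A m x 0 μ).det = -(ev x.a μ * ev x.a μ + ev x.b μ * ev x.c μ) := by
  rw [A, det_fin_two_of]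
  field_simp
  ring

variable [hρ : Fact (1 ≤ ρ)]

theorem summable_abs_coef (f : WienerPos ρ) : Summable fun k => |f.1 k| :=
  f.2.of_nonneg_of_le (fun _ => abs_nonneg _) fun _ =>
    le_mul_of_one_le_right (abs_nonneg _) (one_le_pow₀ (hρ.out.trans (le_abs_self ρ)))

theorem diffContOnCl_ev (f : WienerPos ρ) : DiffContOnCl ℂ (ev f) (Metric.ball 0 1) := by
  refine .mk_ball
    (differentiableOn_tsum_of_summable_norm (summable_abs_coef f)
      (fun k => ((differentiable_id.pow k).const_mul _).differentiableOn) Metric.isOpen_ball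
      fun k μ hμ => norm_coef_mul_pow_le f k (mem_ball_zero_iff.1 hμ).le)
    (continuousOn_tsum (fun k => ((continuous_pow k).const_mul _).continuousOn)
      (summable_abs_coef f) fun k μ hμ => norm_coef_mul_pow_le f k (mem_closedBall_zero_iff.1 hμ))

theorem circleAverage_det_A_zero (m : ℕ) (x : Param ρ) :
    Real.circleAverage (fun μ => (A m x 0 μ).det) 0 1 = -(K x : ℂ) := by
  have hdet : EqOn (fun μ => (A m x 0 μ).det)
      (fun μ => -(ev x.a μ * ev x.a μ + ev x.b μ * ev x.c μ)) (Metric.sphere 0 |1|) :=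
    fun μ hμ => det_A_zero m x (ne_zero_of_mem_sphere (by norm_num) ⟨μ, hμ⟩)
  have hdiff : DiffContOnCl ℂ (fun μ => -(ev x.a μ * ev x.a μ + ev x.b μ * ev x.c μ))
      (Metric.ball 0 |1|) := by
    rw [abs_one]
    exact (((diffContOnCl_ev x.a).smul (diffContOnCl_ev x.a)).add
      ((diffContOnCl_ev x.b).smul (diffContOnCl_ev x.c))).neg
  rw [Real.circleAverage_congr_sphere hdet, hdiff.circleAverage, ev_zero, ev_zero, ev_zero, K]
  push_cast
  ring

theorem normDefect_paramEquiv (x : Param ρ) : normDefect (paramEquiv x) = K x - 1 := by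
  have hcoef : ∀ f : WienerPos ρ, intCoef 0 (taylorEquiv f) = f.1 0 := fun f =>
    (intCoef_natCast 0 _).trans (coef_taylorEquiv f 0)
  have hK : normDefect (paramEquiv x) = intCoef 0 (taylorEquiv x.a) ^ 2
      + intCoef 0 (taylorEquiv x.b) * intCoef 0 (taylorEquiv x.c) - 1 := rfl
  rw [hK, hcoef, hcoef, hcoef, K]

end Evaluation

/-! ### The system and the monodromy problem -/

section SpecialUnitary

theorem inv_mul_mul_mem_specialUnitaryGroup {ι : Type*} [Fintype ι] [DecidableEq ι]
    {U M : Matrix ι ι ℂ} (hU : U ∈ specialUnitaryGroup ι ℂ) (hM : M ∈ specialUnitaryGroup ι ℂ) :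
    U⁻¹ * M * U ∈ specialUnitaryGroup ι ℂ := by
  rw [inv_eq_left_inv (mem_unitaryGroup_iff'.1 hU.1)]
  exact mul_mem (mul_mem (star (⟨U, hU⟩ : specialUnitaryGroup ι ℂ)).2 hM) hU

theorem D_mem_specialUnitaryGroup (m : ℕ) : D m ∈ specialUnitaryGroup (Fin 2) ℂ := by
  have hconj : conj (I * Real.pi * m / nn m) = -(I * Real.pi * m / nn m) := by
    simp [neg_div]
  rw [mem_specialUnitaryGroup_iff_conjTranspose_eq (det_D m), D, adjugate_fin_two_of]
  ext i k
  fin_cases i <;> fin_cases k <;> simp [-map_mul, -map_div₀, ← exp_conj, hconj]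

theorem conjTranspose_eq_neg_iff_of_trace_eq_zero {N : Matrix (Fin 2) (Fin 2) ℂ}
    (hN : N.trace = 0) :
    Nᴴ = -N ↔ conj (N 0 0) = -N 0 0 ∧ conj (N 0 1) = -N 1 0 := by
  have hdiag : N 1 1 = -N 0 0 := eq_neg_of_add_eq_zero_right ((trace_fin_two N).symm.trans hN)
  refine ⟨fun h => ⟨congrFun₂ h 0 0, congrFun₂ h 1 0⟩, fun ⟨h₀, h₁⟩ => ?_⟩
  have h₁' : conj (N 1 0) = -N 0 1 := by
    rw [← conj_conj (N 0 1), h₁, map_neg, neg_neg]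
  ext i k
  fin_cases i <;> fin_cases k <;> simp [h₀, h₁, h₁', hdiag]

end SpecialUnitary

section MonodromyProblem

variable {m : ℕ} {ρ t : ℝ} {x : Param ρ} {μ : ℂ}

theorem loopStar_of_norm_eq_one (f : ℂ → ℂ) (hμ : ‖μ‖ = 1) : loopStar f μ = conj (f μ) := by
  rw [loopStar, ← Complex.inv_eq_conj hμ, one_div, inv_inv]

theorem F_eq_zero_iff (hμ : ‖μ‖ = 1) :
    F m t x μ = 0 ↔ conj (Mt m t x μ 0 0) = -Mt m t x μ 0 0 := by
  rw [F, loopStar_of_norm_eq_one _ hμ,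
    mul_eq_zero_iff_left (one_div_ne_zero two_pi_I_ne_zero), eq_neg_iff_add_eq_zero, add_comm]

theorem G_eq_zero_iff (hμ : ‖μ‖ = 1) :
    G m t x μ = 0 ↔ conj (Mt m t x μ 0 1) = -Mt m t x μ 1 0 := by
  rw [G, loopStar_of_norm_eq_one _ hμ,
    mul_eq_zero_iff_left (one_div_ne_zero two_pi_I_ne_zero), eq_neg_iff_add_eq_zero, add_comm]

theorem H₁_eq_zero_iff : H₁ m t x = 0 ↔ Mt m t x 1 0 1 = 0 :=
  mul_eq_zero_iff_left (one_div_ne_zero two_pi_I_ne_zero)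

theorem H₂_eq_zero_iff : H₂ m t x = 0 ↔ Mt m t x (-1) 0 1 = 0 :=
  mul_eq_zero_iff_left (one_div_ne_zero two_pi_I_ne_zero)

theorem matLog_mon_eq (ht : t ≠ 0) (μ : ℂ) : matLog (Mon m t x 0 μ) = (t : ℂ) • Mt m t x μ := by
  rw [Mt, smul_smul, mul_one_div_cancel (ofReal_ne_zero.2 ht), one_smul]

variable (htransport : ∀ μ : ℂ, ‖μ‖ = 1 → ∃ X, IsTransport m t x 0 μ X)
  (hnear : ∀ μ : ℂ, ‖μ‖ = 1 → ‖Mon m t x 0 μ - 1‖ < 1 / 4)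

include htransport

theorem det_mon_zero (hμ : ‖μ‖ = 1) : (Mon m t x 0 μ).det = 1 := by
  obtain ⟨X, hX⟩ := htransport μ hμ
  exact hX.det_mon

theorem mon_mem_specialUnitaryGroup
    (hzero : ∀ μ : ℂ, ‖μ‖ = 1 → Mon m t x 0 μ ∈ specialUnitaryGroup (Fin 2) ℂ) (j : ℕ)
    (hμ : ‖μ‖ = 1) : Mon m t x j μ ∈ specialUnitaryGroup (Fin 2) ℂ := by
  induction j generalizing μ with
  | zero => exact hzero μ hμ
  | succ j ih =>
    rw [mon_succ htransport j hμ]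
    exact inv_mul_mul_mem_specialUnitaryGroup (D_mem_specialUnitaryGroup m)
      (ih (by rwa [norm_neg]))

theorem isDiag_mon (hone : (Mon m t x 0 1).IsDiag) (hneg_one : (Mon m t x 0 (-1)).IsDiag)
    (j : ℕ) : (Mon m t x j 1).IsDiag ∧ (Mon m t x j (-1)).IsDiag := by
  induction j with
  | zero => exact ⟨hone, hneg_one⟩
  | succ j ih =>
    have hconj : ∀ {M : Matrix (Fin 2) (Fin 2) ℂ}, M.IsDiag → ((D m)⁻¹ * M * D m).IsDiag :=
      fun hM i k hik =>
        (D_inv_mul_mul_D_apply ..).trans (by rw [hM hik, mul_zero])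
    rw [mon_succ htransport j norm_one, mon_succ htransport j (by rw [norm_neg, norm_one]), neg_neg]
    exact ⟨hconj ih.2, hconj ih.1⟩

include hnear

theorem trace_Mt (hμ : ‖μ‖ = 1) : (Mt m t x μ).trace = 0 := by
  have hdet : (1 + (Mon m t x 0 μ - 1)).det = 1 := by
    rw [add_sub_cancel, det_mon_zero htransport hμ]
  rw [Mt, trace_smul, matLog_eq, trace_logOneAdd_eq_zero
    ((hnear μ hμ).le.trans (by norm_num)) hdet, smul_zero]

theorem conj_Mt_conj (hμ : ‖μ‖ = 1) (i k : Fin 2) :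
    conj (Mt m t x (conj μ) i k) = -Mt m t x μ i k := by
  obtain ⟨X, hX⟩ := htransport (conj μ) (norm_conj_eq_one hμ)
  obtain ⟨Y, hY⟩ := htransport μ hμ
  have hlog := congrFun₂ (map_conj_matLog (hnear μ hμ) (hnear _ (norm_conj_eq_one hμ)) hY.det_mon
    (map_conj_mon hX hY)) i k
  rw [map_apply, Matrix.neg_apply] at hlog
  rw [Mt, Mt, Matrix.smul_apply, Matrix.smul_apply, smul_eq_mul, smul_eq_mul, map_mul, hlog,
    map_div₀, map_one, conj_ofReal, mul_neg]

theorem mon_mem_specialUnitaryGroup_iff (ht : t ≠ 0) (hμ : ‖μ‖ = 1) :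
    Mon m t x 0 μ ∈ specialUnitaryGroup (Fin 2) ℂ ↔ F m t x μ = 0 ∧ G m t x μ = 0 := by
  rw [mem_specialUnitaryGroup_iff_matLog (hnear μ hμ) (det_mon_zero htransport hμ),
    F_eq_zero_iff hμ, G_eq_zero_iff hμ,
    ← conjTranspose_eq_neg_iff_of_trace_eq_zero (trace_Mt htransport hnear hμ),
    matLog_mon_eq ht, conjTranspose_smul, star_def, conj_ofReal, ← smul_neg,
    smul_right_inj (ofReal_ne_zero.2 ht)]

omit htransport in
theorem isDiag_mon_iff (ht : t ≠ 0) (hμ : ‖μ‖ = 1) (hG : G m t x μ = 0) :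
    (Mon m t x 0 μ).IsDiag ↔ Mt m t x μ 0 1 = 0 := by
  rw [isDiag_iff_matLog (hnear μ hμ), matLog_mon_eq ht, Matrix.smul_apply, Matrix.smul_apply,
    smul_eq_zero_iff_right (ofReal_ne_zero.2 ht), smul_eq_zero_iff_right (ofReal_ne_zero.2 ht)]
  refine and_iff_left_of_imp fun h => ?_
  rw [← neg_eq_zero, ← (G_eq_zero_iff hμ).1 hG, h, map_zero]

theorem iftSystem_iff_solvesMonodromyProblem [Fact (1 ≤ ρ)] (ht : t ≠ 0) :
    IFTSystem m t x ↔ SolvesMonodromyProblem m t x := by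
  have hneg : ‖(-1 : ℂ)‖ = 1 := by rw [norm_neg, norm_one]
  have hSU := fun (μ : ℂ) (hμ : ‖μ‖ = 1) =>
    mon_mem_specialUnitaryGroup_iff htransport hnear ht hμ
  have hdiag := fun (μ : ℂ) (hμ : ‖μ‖ = 1) => isDiag_mon_iff hnear ht hμ
  have hK : K x = 1 ↔ Real.circleAverage (fun μ => (A m x 0 μ).det) 0 1 = -1 := by
    rw [circleAverage_det_A_zero, neg_inj, ofReal_eq_one]
  rw [IFTSystem, SolvesMonodromyProblem, hK, H₁_eq_zero_iff, H₂_eq_zero_iff]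
  constructor
  · rintro ⟨hF, hG, hH₁, hH₂, hdet⟩
    exact ⟨fun j _ μ => mon_mem_specialUnitaryGroup htransport
        (fun μ hμ => (hSU μ hμ).2 ⟨hF μ hμ, hG μ hμ⟩) j,
      fun j _ => isDiag_mon htransport ((hdiag 1 norm_one (hG 1 norm_one)).2 hH₁)
        ((hdiag (-1) hneg (hG (-1) hneg)).2 hH₂) j, hdet⟩
  · rintro ⟨hmem, hisDiag, hdet⟩
    have hpos : 0 < nn m := Nat.succ_pos _
    have hFG := fun μ hμ => (hSU μ hμ).1 (hmem 0 hpos μ hμ)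
    exact ⟨fun μ hμ => (hFG μ hμ).1, fun μ hμ => (hFG μ hμ).2,
      (hdiag 1 norm_one (hFG 1 norm_one).2).1 (hisDiag 0 hpos).1,
      (hdiag (-1) hneg (hFG (-1) hneg).2).1 (hisDiag 0 hpos).2, hdet⟩

end MonodromyProblem

section Solution

variable {ρ : ℝ} [hρ : Fact (1 ≤ ρ)] {m : ℕ} {t : ℝ} {x : Param ρ} {μ : ℂ}

theorem two_pi_I_inv_mul_eq_conj_iff {z w : ℂ} :
    (2 * Real.pi * I)⁻¹ * z = conj ((2 * Real.pi * I)⁻¹ * w) ↔ conj w = -z := by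
  have hconj : conj (2 * Real.pi * I)⁻¹ = -(2 * Real.pi * I)⁻¹ := by
    rw [map_inv₀, map_mul, map_mul, map_ofNat, conj_ofReal, conj_I, mul_neg, inv_neg]
  rw [map_mul, hconj, neg_mul, ← mul_neg, mul_right_inj' (inv_ne_zero two_pi_I_ne_zero), eq_comm,
    neg_eq_iff_eq_neg]

variable (hm : 1 ≤ m) (hB : ‖(t : ℂ) • gauged m (paramEquiv x)‖ < 1)

include hm hB

theorem norm_mon_sub_one_le (hμ : ‖μ‖ = 1) :
    ‖Mon m t x 0 μ - 1‖ ≤ ‖odeEnd ((t : ℂ) • gauged m (paramEquiv x)) - 1‖ := by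
  rw [mon_zero_eq hμ hm hB, ← map_one (evalMat (ρ := ρ) hμ), ← map_sub]
  exact norm_evalMat_le hμ _

variable (hE : ‖odeEnd ((t : ℂ) • gauged m (paramEquiv x)) - 1‖ < 1 / 4)

include hE

theorem eval_monLog (hμ : ‖μ‖ = 1) (i k : Fin 2) :
    eval hμ (monLog ρ m t (paramEquiv x) i k) = (2 * Real.pi * I)⁻¹ * Mt m t x μ i k := by
  have hlog : evalMat hμ (odeLog ((t : ℂ) • gauged m (paramEquiv x))) = matLog (Mon m t x 0 μ) := by
    rw [odeLog, evalMat_logOneAdd hμ (hE.trans (by norm_num)), map_sub, map_one,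
      ← mon_zero_eq hμ hm hB, matLog_eq]
  rw [← evalMat_apply, monLog, map_smul, hlog, Mt, Matrix.smul_apply, Matrix.smul_apply,
    smul_eq_mul, smul_eq_mul, mul_inv, mul_assoc, one_div]

theorem isReal_monLog (i k : Fin 2) : IsReal (monLog ρ m t (paramEquiv x) i k) := by
  refine isReal_of_conj_eval fun μ hμ => ?_
  rw [eval_monLog hm hB hE, eval_monLog hm hB hE, eq_comm, two_pi_I_inv_mul_eq_conj_iff,
    conj_Mt_conj (fun μ hμ => ⟨_, isTransport_evalMat hμ hm hB⟩)
      (fun μ hμ => (norm_mon_sub_one_le hm hB hμ).trans_lt hE) hμ]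

theorem iftSystem_iff_isSolution :
    IFTSystem m t x ↔ IsSolution (monLog ρ m t (paramEquiv x), normDefect (paramEquiv x)) := by
  have hreal := isReal_monLog hm hB hE
  have hF : (∀ μ : ℂ, ‖μ‖ = 1 → F m t x μ = 0) ↔
      ∀ k, coefF k (monLog ρ m t (paramEquiv x), normDefect (paramEquiv x)) = 0 := by
    simp only [coefF_apply, entry_mk, sub_eq_zero]
    rw [← eval_eq_conj_eval_iff (hreal 0 0) (hreal 0 0)]
    refine forall₂_congr fun μ hμ => ?_
    rw [F_eq_zero_iff hμ, eval_monLog hm hB hE, two_pi_I_inv_mul_eq_conj_iff]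
  have hG : (∀ μ : ℂ, ‖μ‖ = 1 → G m t x μ = 0) ↔
      ∀ k, coefG k (monLog ρ m t (paramEquiv x), normDefect (paramEquiv x)) = 0 := by
    simp only [coefG_apply, entry_mk, sub_eq_zero]
    rw [← eval_eq_conj_eval_iff (hreal 1 0) (hreal 0 1)]
    refine forall₂_congr fun μ hμ => ?_
    rw [G_eq_zero_iff hμ, eval_monLog hm hB hE, eval_monLog hm hB hE,
      two_pi_I_inv_mul_eq_conj_iff]
  have hne : (2 * Real.pi * I : ℂ)⁻¹ ≠ 0 := inv_ne_zero two_pi_I_ne_zero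
  have hH₁ : H₁ m t x = 0 ↔ valOne (monLog ρ m t (paramEquiv x) 0 1) = 0 := by
    rw [H₁_eq_zero_iff, (hreal 0 1).valOne_eq_zero_iff, eval_monLog hm hB hE,
      mul_eq_zero_iff_left hne]
  have hH₂ : H₂ m t x = 0 ↔ valNegOne (monLog ρ m t (paramEquiv x) 0 1) = 0 := by
    rw [H₂_eq_zero_iff, (hreal 0 1).valNegOne_eq_zero_iff, eval_monLog hm hB hE,
      mul_eq_zero_iff_left hne]
  rw [IFTSystem, hF, hG, hH₁, hH₂, ← sub_eq_zero (a := K x), ← normDefect_paramEquiv]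
  exact ⟨fun ⟨hF, hG, hH₁, hH₂, hK⟩ => ⟨hF, hG, hH₁, hH₂, hK⟩,
    fun ⟨hF, hG, hH₁, hH₂, hK⟩ => ⟨hF, hG, hH₁, hH₂, hK⟩⟩

theorem iftSystem_iff_systemMap_eq_zero :
    IFTSystem m t x ↔ systemMap ρ m t (paramEquiv x) = 0 :=
  (iftSystem_iff_isSolution hm hB hE).trans linInv_eq_zero_iff.symm

end Solution

end DPW

end

theorem mainTheorem4_general (m : ℕ) (hm : 1 ≤ m) (ρ : ℝ) (hρ : 1 ≤ ρ) :
    ∃ δ₀ > 0, ∀ δ : ℝ, 0 < δ → δ ≤ δ₀ → ∃ ε > 0, ∀ t : ℝ, t ≠ 0 → |t| < ε →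
      (∃! x : DPW.Param ρ, x ∈ DPW.nbhd ρ δ ∧ DPW.IFTSystem m t x) ∧
      (∀ x ∈ DPW.nbhd ρ δ, DPW.IFTSystem m t x ↔ DPW.SolvesMonodromyProblem m t x) := by
  have : Fact (1 ≤ ρ) := ⟨hρ⟩
  obtain ⟨δ₀, hδ₀, hzero⟩ := DPW.exists_existsUnique_zero_systemMap ρ m
  refine ⟨δ₀, hδ₀, fun δ hδ hδδ₀ => ?_⟩
  obtain ⟨ε, hε, hzero⟩ := hzero δ hδ hδδ₀
  refine ⟨ε, hε, fun t ht htε => ?_⟩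
  obtain ⟨hunique, hsmall⟩ := hzero t ht htε
  have hsmall := fun x hx => hsmall (DPW.paramEquiv x) ((DPW.mem_nbhd_iff x δ).1 hx)
  refine ⟨(DPW.paramEquiv.existsUnique_congr fun {x} => ?_).2 hunique, fun x hx => ?_⟩
  · rw [DPW.mem_nbhd_iff]
    refine and_congr_right fun hx => ?_
    obtain ⟨hB, hE⟩ := hsmall x ((DPW.mem_nbhd_iff x δ).2 hx)
    exact DPW.iftSystem_iff_systemMap_eq_zero hm hB hE
  · obtain ⟨hB, hE⟩ := hsmall x hx
    exact DPW.iftSystem_iff_solvesMonodromyProblem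
      (fun μ hμ => ⟨_, DPW.isTransport_evalMat hμ hm hB⟩)
      (fun μ hμ => (DPW.norm_mon_sub_one_le hm hB hμ).trans_lt hE) ht

theorem mainTheorem4 (m : ℕ) (hm : 1 ≤ m) (ρ : ℝ) (hρ : 1 < ρ) :
    ∃ δ₀ > 0, ∀ δ : ℝ, 0 < δ → δ ≤ δ₀ → ∃ ε > 0, ∀ t : ℝ, 0 < t → t < ε →
      (∃! x : DPW.Param ρ, x ∈ DPW.nbhd ρ δ ∧ DPW.IFTSystem m t x) ∧
      (∀ x ∈ DPW.nbhd ρ δ, DPW.IFTSystem m t x ↔ DPW.SolvesMonodromyProblem m t x) := by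
  obtain ⟨δ₀, hδ₀, h⟩ := mainTheorem4_general m hm ρ hρ.le
  refine ⟨δ₀, hδ₀, fun δ hδ hδδ₀ => (h δ hδ hδδ₀).imp fun ε hε => ⟨hε.1, fun t ht htε => ?_⟩⟩
  exact hε.2 t ht.ne' (by rwa [abs_of_pos ht])
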